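/- Let $\mathbb X=(X_k)_{k\ge 1}$ be a (possibly non-symmetric and non-homogeneous) Rademacher sequence on a probability space $(\Omega,\mathcal A,\mathbb P)$: the $X_k$ are independent with $\mathbb P(X_k=1)=p_k$, $\mathbb P(X_k=-1)=q_k=1-p_k$ and $p_k\in(0,1)$. Put $Y_k=\frac{X_k+q_k-p_k}{2\sqrt{p_kq_k}}$, $\mathcal F_k=\sigma(X_1,\dots,X_k)$ (with $\mathcal F_0$ trivial), $\mathcal G_k=\sigma(X_j:j\neq k)$ and $L^2_{\mathbb X}=L^2(\Omega,\sigma(\mathbb X),\mathbb P)$. For $F=f(\mathbb X)\in L^2_{\mathbb X}$ let $D_kF=F-\mathbb E[F\mid\mathcal G_k]$ and $$\hat D_kF=\sqrt{p_kq_k}\,\bigl(f(X_1,\dots,X_{k-1},1,X_{k+1},\dots)-f(X_1,\dots,X_{k-1},-1,X_{k+1},\dots)\bigr).$$ Let $\mathcal S\subset L^2_{\mathbb X}$ be the set of square-integrable random variables that are $\mathcal F_n$-measurable for some $n$. The operators $D$ and $\hat D$ are the closures of $F\mapsto(D_kF)_{k\ge1}$ and $F\mapsto(\hat D_kF)_{k\ge1}$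 from $\mathcal S$, as unbounded operators from $L^2_{\mathbb X}$ to $L^2(\mathbb N\times\Omega)$ (counting measure times $\mathbb P$ on $\sigma(\mathbb X)$). Let $\delta$ be the adjoint of $D$ and $L=-\delta D$ with $\operatorname{dom}(L)=\{G\in\operatorname{dom}(D): DG\in\operatorname{dom}(\delta)\}$. For centered $F\in L^2_{\mathbb X}$, $L^{-1}F$ is the centered $G\in\operatorname{dom}(L)$ with $LG=F$. Let $Z\sim N(0,1)$, and let $d_{\mathcal W}(F,Z)=\sup_{h}|\mathbb E h(F)-\mathbb E h(Z)|$ (supremum over all $1$-Lipschitz $h:\mathbb R\to\mathbb R$) and $d_{\mathcal K}(F,Z)=\sup_{z\in\mathbb R}|\mathbb P(F\le z)-\mathbb P(Z\le z)|$. Then $\operatorname{dom}(\hat D)=\operatorname{dom}(D)$. Moreover, for every $F\in\operatorname{dom}(D)$ with $\mathbb E[F]=0$, $L^{-1}F$ exists, the random series inside the expectations $\mathbb E|\cdot|$ below converge absolutely almost surely, and the following bounds hold, where the right-hand sides are allowed to be $+\infty$. Malliavin–Stein bounds: $$d_{\mathcal W}(F,Z)\le\sqrt{\tfrac2\pi}\,\mathbb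 E\Bigl|1-\sum_{k=1}^\infty\hat D_k(-L^{-1}F)\,\hat D_kF\,Y_k^2\Bigr|+\sum_{k=1}^\infty\frac{1-2p_kq_k}{\sqrt{p_kq_k}}\,\mathbb E\bigl[|\hat D_k(-L^{-1}F)|(\hat D_kF)^2\bigr],$$ $$d_{\mathcal K}(F,Z)\le\mathbb E\Bigl|1-\sum_{k=1}^\infty\hat D_k(-L^{-1}F)\,\hat D_kF\,Y_k^2\Bigr|+2\sum_{k=1}^\infty|p_k-q_k|\,\mathbb E\bigl[|\hat D_kL^{-1}F|\,|\hat D_kF|\bigr]+4\,\mathbb E\Bigl|\sum_{k=1}^\infty\sqrt{p_kq_k}\,|\hat D_kL^{-1}F|\,\hat D_kF\,Y_k\Bigr|.$$ Clark–Ocone bounds: $$d_{\mathcal W}(F,Z)\le\sqrt{\tfrac2\pi}\,\mathbb E\Bigl|1-\sum_{k=1}^\infty\mathbb E[\hat D_kF\mid\mathcal F_{k-1}]\,\hat D_kF\,Y_k^2\Bigr|+\sum_{k=1}^\infty\frac{1-2p_kq_k}{\sqrt{p_kq_k}}\,\mathbb E\bigl[|\mathbb E[\hat D_kF\mid\mathcal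 F_{k-1}]|(\hat D_kF)^2\bigr],$$ $$d_{\mathcal K}(F,Z)\le\mathbb E\Bigl|1-\sum_{k=1}^\infty\mathbb E[\hat D_kF\mid\mathcal F_{k-1}]\,\hat D_kF\,Y_k^2\Bigr|+2\sum_{k=1}^\infty|p_k-q_k|\,\mathbb E\bigl[|\mathbb E[\hat D_kF\mid\mathcal F_{k-1}]|\,|\hat D_kF|\bigr]+4\,\mathbb E\Bigl|\sum_{k=1}^\infty\sqrt{p_kq_k}\,|\mathbb E[\hat D_kF\mid\mathcal F_{k-1}]|\,\hat D_kF\,Y_k\Bigr|.$$ -/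

import Mathlib

open MeasureTheory ProbabilityTheory Filter Topology
open scoped ENNReal NNReal

namespace RademacherStein

noncomputable section

/-! Conventions: sequences are indexed by `ℕ = {0, 1, 2, …}`. Square-integrable functionals of `X`
are represented by functions `Ω → ℝ`, and all notions below are invariant under a.e. equality. -/

variable {Ω : Type*} [MeasurableSpace Ω]

/-- `X` is a (possibly non-symmetric and non-homogeneous) Rademacher sequence with success
probabilities `p k`, that is, the `X k` are independent, `P(X k = 1) = p k` and
`P(X k = -1) = 1 - p k`, where `0 < p k < 1`. -/
structure IsRademacherSeq (P : Measure Ω) (X : ℕ → Ω → ℝ) (p : ℕ → ℝ) : Prop where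
  measurable : ∀ k, Measurable (X k)
  indep : iIndepFun X P
  pos : ∀ k, 0 < p k
  lt_one : ∀ k, p k < 1
  prob_one : ∀ k, P {ω | X k ω = 1} = ENNReal.ofReal (p k)
  prob_neg_one : ∀ k, P {ω | X k ω = -1} = ENNReal.ofReal (1 - p k)

/-- The σ-field generated by the coordinates `X j`, `j ∈ M`. -/
@[reducible] def sigmaOf (X : ℕ → Ω → ℝ) (M : Set ℕ) : MeasurableSpace Ω :=
  ⨆ j ∈ M, MeasurableSpace.comap (X j) inferInstance

/-- The σ-field generated by all coordinates strictly before `k`. -/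
@[reducible] def pastSigma (X : ℕ → Ω → ℝ) (k : ℕ) : MeasurableSpace Ω :=
  sigmaOf X {j | j < k}

/-- The σ-field generated by all coordinates except the `k`-th one. -/
@[reducible] def exceptSigma (X : ℕ → Ω → ℝ) (k : ℕ) : MeasurableSpace Ω :=
  sigmaOf X {j | j ≠ k}

/-- Square-integrable random variables that are (a.e. equal to) functionals of `X`. -/
def MemL2X (P : Measure Ω) (X : ℕ → Ω → ℝ) (F : Ω → ℝ) : Prop :=
  AEStronglyMeasurable[sigmaOf X Set.univ] F P ∧ MemLp F 2 P

/-- Square-integrable random variables that depend on finitely many coordinates of `X` only. -/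
def IsCylindrical (P : Measure Ω) (X : ℕ → Ω → ℝ) (F : Ω → ℝ) : Prop :=
  (∃ n, AEStronglyMeasurable[pastSigma X n] F P) ∧ MemLp F 2 P

/-- Square-integrable processes: `L²` of the product of the counting measure on `ℕ` and `P`
restricted to `σ(X)`. -/
def MemL2Process (P : Measure Ω) (X : ℕ → Ω → ℝ) (U : ℕ → Ω → ℝ) : Prop :=
  (∀ k, MemL2X P X (U k)) ∧ ∑' k, ∫⁻ ω, ‖U k ω‖ₑ ^ 2 ∂P < ∞

/-- The graph of the closure of the operator `F ↦ (T k F)_k`, initially defined on cylindrical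
functionals, as an operator from square-integrable functionals to square-integrable processes. -/
def IsClosureOn (P : Measure Ω) (X : ℕ → Ω → ℝ) (T : ℕ → (Ω → ℝ) → Ω → ℝ)
    (F : Ω → ℝ) (V : ℕ → Ω → ℝ) : Prop :=
  MemL2X P X F ∧ MemL2Process P X V ∧
    ∃ S : ℕ → Ω → ℝ, (∀ n, IsCylindrical P X (S n)) ∧
      Tendsto (fun n => ∫⁻ ω, ‖S n ω - F ω‖ₑ ^ 2 ∂P) atTop (𝓝 0) ∧
      Tendsto (fun n => ∑' k, ∫⁻ ω, ‖T k (S n) ω - V k ω‖ₑ ^ 2 ∂P) atTop (𝓝 0)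

/-- `D_k F = F - E[F | X_j, j ≠ k]`. -/
def D (P : Measure Ω) (X : ℕ → Ω → ℝ) (k : ℕ) (F : Ω → ℝ) : Ω → ℝ :=
  F - P[F | exceptSigma X k]

open Classical in
/-- A measurable `f` with `F = f(X)` almost surely (`0` if there is none). It is unique up to
null sets of the law of `X`. -/
def representative (P : Measure Ω) (X : ℕ → Ω → ℝ) (F : Ω → ℝ) : (ℕ → ℝ) → ℝ :=
  if h : ∃ f : (ℕ → ℝ) → ℝ, Measurable f ∧ F =ᵐ[P] fun ω => f (fun n => X n ω)
  then h.choose else 0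

/-- The Rademacher derivative
`√(p_k q_k) (f(…, X_{k-1}, 1, X_{k+1}, …) - f(…, X_{k-1}, -1, X_{k+1}, …))`, where `F = f(X)`. -/
def Dhat (P : Measure Ω) (X : ℕ → Ω → ℝ) (p : ℕ → ℝ) (k : ℕ) (F : Ω → ℝ) : Ω → ℝ := fun ω =>
  √(p k * (1 - p k)) *
    (representative P X F (Function.update (fun n => X n ω) k 1) -
      representative P X F (Function.update (fun n => X n ω) k (-1)))

/-- The domain of the Malliavin derivative `D` on the product space. -/
def MemDomD (P : Measure Ω) (X : ℕ → Ω → ℝ) (F : Ω → ℝ) : Prop :=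
  ∃ V, IsClosureOn P X (D P X) F V

/-- The domain of the Rademacher derivative `D̂`. -/
def MemDomDhat (P : Measure Ω) (X : ℕ → Ω → ℝ) (p : ℕ → ℝ) (F : Ω → ℝ) : Prop :=
  ∃ V, IsClosureOn P X (Dhat P X p) F V

/-- The graph of the divergence `δ`, the Hilbert space adjoint of (the closed operator) `D`:
`U ∈ dom(δ)` and `δ U = H`. -/
def IsDivergence (P : Measure Ω) (X : ℕ → Ω → ℝ) (U : ℕ → Ω → ℝ) (H : Ω → ℝ) : Prop :=
  MemL2Process P X U ∧ MemL2X P X H ∧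
    ∀ G V, IsClosureOn P X (D P X) G V → ∑' k, ∫ ω, V k ω * U k ω ∂P = ∫ ω, G ω * H ω ∂P

/-- The graph of the Ornstein-Uhlenbeck generator `L = -δ D`: `G ∈ dom(L)` and `L G = K`. -/
def IsOUGenerator (P : Measure Ω) (X : ℕ → Ω → ℝ) (G K : Ω → ℝ) : Prop :=
  ∃ V, IsClosureOn P X (D P X) G V ∧ IsDivergence P X V (-K)

/-- `G = L⁻¹ F` for centered `F`: `G` is a centered element of `dom(L)` with `L G = F`. -/
def IsPseudoInverse (P : Measure Ω) (X : ℕ → Ω → ℝ) (F G : Ω → ℝ) : Prop :=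
  IsOUGenerator P X G F ∧ ∫ ω, G ω ∂P = 0

/-- The normalization `Y_k = (X_k + q_k - p_k) / (2 √(p_k q_k))`, where `q_k = 1 - p_k`. -/
def Y (X : ℕ → Ω → ℝ) (p : ℕ → ℝ) (k : ℕ) (ω : Ω) : ℝ :=
  (X k ω + (1 - p k) - p k) / (2 * √(p k * (1 - p k)))

/-- The Wasserstein distance of two laws on `ℝ`. -/
def dW (μ ν : Measure ℝ) : ℝ≥0∞ :=
  ⨆ (h : ℝ → ℝ) (_ : LipschitzWith 1 h), ENNReal.ofReal |∫ x, h x ∂μ - ∫ x, h x ∂ν|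

/-- The Kolmogorov distance of two laws on `ℝ`. -/
def dK (μ ν : Measure ℝ) : ℝ≥0∞ :=
  ⨆ z : ℝ, ENNReal.ofReal |μ.real (Set.Iic z) - ν.real (Set.Iic z)|

/-- The expression bounding the Wasserstein distance, for processes `A` and `B`:
`√(2/π) E|1 - ∑ A_k B_k Y_k²| + ∑ (1 - 2 p_k q_k) / √(p_k q_k) E[|A_k| B_k²]`. -/
def boundW (P : Measure Ω) (X : ℕ → Ω → ℝ) (p : ℕ → ℝ) (A B : ℕ → Ω → ℝ) : ℝ≥0∞ :=
  ENNReal.ofReal (√(2 / Real.pi)) * ∫⁻ ω, ‖1 - ∑' k, A k ω * B k ω * Y X p k ω ^ 2‖ₑ ∂P +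
    ∑' k, ENNReal.ofReal ((1 - 2 * p k * (1 - p k)) / √(p k * (1 - p k))) *
      ∫⁻ ω, ‖A k ω‖ₑ * ‖B k ω‖ₑ ^ 2 ∂P

/-- The expression bounding the Kolmogorov distance, for processes `A` and `B`:
`E|1 - ∑ A_k B_k Y_k²| + 2 ∑ |p_k - q_k| E[|A_k| |B_k|] + 4 E|∑ √(p_k q_k) |A_k| B_k Y_k|`. -/
def boundK (P : Measure Ω) (X : ℕ → Ω → ℝ) (p : ℕ → ℝ) (A B : ℕ → Ω → ℝ) : ℝ≥0∞ :=
  ∫⁻ ω, ‖1 - ∑' k, A k ω * B k ω * Y X p k ω ^ 2‖ₑ ∂P +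
    2 * ∑' k, ENNReal.ofReal |p k - (1 - p k)| * ∫⁻ ω, ‖A k ω‖ₑ * ‖B k ω‖ₑ ∂P +
    4 * ∫⁻ ω, ‖∑' k, √(p k * (1 - p k)) * (|A k ω| * B k ω) * Y X p k ω‖ₑ ∂P

/-- The two random series in the bounds converge (absolutely) almost surely. -/
def SeriesConverge (P : Measure Ω) (X : ℕ → Ω → ℝ) (p : ℕ → ℝ) (A B : ℕ → Ω → ℝ) : Prop :=
  (∀ᵐ ω ∂P, Summable fun k => A k ω * B k ω * Y X p k ω ^ 2) ∧
    ∀ᵐ ω ∂P, Summable fun k => √(p k * (1 - p k)) * (|A k ω| * B k ω) * Y X p k ω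

end

end RademacherStein

/-! ### The standard normal density, distribution function and Mills ratio. -/

namespace RademacherStein
noncomputable section

/-! Both pairs of bounds are instances of one estimate. Call a process `A` representing for `F`
(`IsRepresenting`) if `A k` does not depend on the `k`-th coordinate, `∑ E[A_k²] < ∞`, and `E[F H] =
∑ E[A_k D̂_k H]` for all `H` in the domain of `D`. The choice `A_k = D̂_k(-L⁻¹F)` is representing
because `δ` is the adjoint of `D`, the choice `A_k = E[D̂_k F | F_{k-1}]` because of the Clark-Ocone
formula.

Let `f` solve Stein's equation for a test function, and let `U`, `V` be `F` with `X_k` replaced by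
`1` and `-1`. Then `D̂_k F = √(pq)(U - V)`, and `D̂_k f(F)` is the same expression in `f(U)`,
`f(V)`. The representation of `E[F f(F)]` is compared with `∑ E[f'(F) A_k D̂_k F Y_k²]`. Averaging
over `X_k` turns `f'(F) Y_k²` into `q f'(U) + p f'(V)`, so the error is governed by the defect `f(U)
- f(V) - (U - V)(q f'(U) + p f'(V))` (`enorm_integral_sub_le`).

For a Lipschitz test function, `|f'| ≤ √(2/π)` and `f'` is 2-Lipschitz (`steinSol_bounds`), so the
defect is at most `(p² + q²)(U - V)²`. For the indicator of `(-∞, z]`, the defect is at most `max(p,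
q)(U - V)(M(U) - M(V))` with `M(x) = x f(x) - 1_{x ≤ z}` increasing. Since `max(p, q) ≤ 2pq + |p -
q|`, one part recombines into `E[M(F) ∑ √(pq)|A_k| D̂_k F Y_k]` and the rest carries `|p - q|`.

On the operator side, conditional expectations given sets of coordinates compose by intersecting the
sets. This reduces the Clark-Ocone formula, the Poincaré inequality and the existence of `L⁻¹` to
the Hilbert space setting of `IsProjectionSystem`. As `D_k = Y_k D̂_k` with `Y_k` normalized and
independent of `D̂_k F`, the two operators are isometric. Hence both closures are the maximal
operators on the same domain, approximation being by `E[F | F_n]` (`isClosureOn_iff`). -/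

/-- The density of the standard normal distribution. -/
def gpdf (x : ℝ) : ℝ := (√(2 * Real.pi))⁻¹ * Real.exp (-x ^ 2 / 2)

/-- The distribution function of the standard normal distribution. -/
def gcdf (x : ℝ) : ℝ := ∫ t in Set.Iic x, gpdf t

theorem gpdf_eq : gpdf = gaussianPDFReal 0 1 := by
  ext x; simp [gpdf, gaussianPDFReal]

theorem gpdf_pos (x : ℝ) : 0 < gpdf x := by unfold gpdf; positivity

theorem gpdf_neg (x : ℝ) : gpdf (-x) = gpdf x := by simp [gpdf]

theorem hasDerivAt_gpdf (x : ℝ) : HasDerivAt gpdf (-x * gpdf x) x := by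
  have h : HasDerivAt (fun x : ℝ => -x ^ 2 / 2) (-x) x := by
    refine (((hasDerivAt_id' x).fun_pow 2).fun_neg.div_const 2).congr_deriv ?_
    norm_num; ring
  refine (h.exp.const_mul (√(2 * Real.pi))⁻¹).congr_deriv ?_
  simp only [gpdf]; ring

theorem continuous_gpdf : Continuous gpdf := by unfold gpdf; fun_prop

theorem integrable_gpdf : Integrable gpdf := gpdf_eq ▸ integrable_gaussianPDFReal 0 1

theorem integral_gpdf : ∫ x, gpdf x = 1 := by
  rw [gpdf_eq]; exact integral_gaussianPDFReal_eq_one 0 one_ne_zero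

theorem integral_gaussianReal_eq_gpdf (h : ℝ → ℝ) :
    ∫ x, h x ∂(gaussianReal 0 1) = ∫ x, h x * gpdf x := by
  rw [integral_gaussianReal_eq_integral_smul one_ne_zero, gpdf_eq]
  simp [mul_comm]

theorem integrable_mul_gpdf {h : ℝ → ℝ} (hh : Integrable h (gaussianReal 0 1)) :
    Integrable (fun x => h x * gpdf x) := by
  rw [gaussianReal_of_var_ne_zero _ one_ne_zero,
    integrable_withDensity_iff (measurable_gaussianPDF 0 1) (ae_of_all _ fun _ => gaussianPDF_lt_top)] at hh
  simpa [toReal_gaussianPDF, gpdf_eq] using hh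

theorem integrable_id_mul_gpdf : Integrable (fun x => x * gpdf x) :=
  integrable_mul_gpdf ((memLp_id_gaussianReal 1).integrable (by simp))

theorem gaussianReal_real_Iic (z : ℝ) : (gaussianReal 0 1).real (Set.Iic z) = gcdf z := by
  rw [measureReal_def, gaussianReal_apply_eq_integral _ one_ne_zero, gcdf, gpdf_eq,
    ENNReal.toReal_ofReal (integral_nonneg fun _ => gaussianPDFReal_nonneg _ _ _)]

theorem gcdf_eq_add (x : ℝ) : gcdf x = gcdf 0 + ∫ t in (0 : ℝ)..x, gpdf t := by
  rw [← intervalIntegral.integral_Iic_sub_Iic integrable_gpdf.integrableOn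
    integrable_gpdf.integrableOn]
  simp [gcdf]

theorem hasDerivAt_gcdf (x : ℝ) : HasDerivAt gcdf (gpdf x) x := by
  have h : HasDerivAt (fun x => gcdf 0 + ∫ t in (0 : ℝ)..x, gpdf t) (gpdf x) x :=
    (continuous_gpdf.integral_hasStrictDerivAt 0 x).hasDerivAt.const_add _
  exact h.congr_of_eventuallyEq (Eventually.of_forall gcdf_eq_add)

theorem integral_Ioi_gpdf (x : ℝ) : ∫ t in Set.Ioi x, gpdf t = gcdf (-x) := by
  rw [gcdf, ← integral_comp_neg_Ioi]
  simp [gpdf_neg]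

theorem gcdf_add_gcdf_neg (x : ℝ) : gcdf x + gcdf (-x) = 1 := by
  rw [← integral_Ioi_gpdf, gcdf, ← integral_gpdf]
  exact intervalIntegral.integral_Iic_add_Ioi integrable_gpdf.integrableOn
    integrable_gpdf.integrableOn

theorem gcdf_pos (x : ℝ) : 0 < gcdf x := by
  unfold gcdf
  rw [setIntegral_pos_iff_support_of_nonneg_ae (ae_of_all _ fun x => (gpdf_pos x).le)
    integrable_gpdf.integrableOn]
  have : Function.support gpdf = Set.univ := by
    ext x; simp [(gpdf_pos x).ne']
  simp [this]

theorem gcdf_zero : gcdf 0 = 1 / 2 := by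
  have := gcdf_add_gcdf_neg 0
  simp only [neg_zero] at this; linarith

theorem tendsto_gpdf_atBot : Tendsto gpdf atBot (𝓝 0) := by
  have h : Tendsto (fun x : ℝ => -x ^ 2 / 2) atBot atBot := by
    have : Tendsto (fun x : ℝ => x ^ 2) atBot atTop := by
      have := tendsto_pow_atTop (α := ℝ) (n := 2) (by norm_num)
      have h2 := this.comp tendsto_neg_atBot_atTop
      refine h2.congr fun x => by simp
    have := (tendsto_neg_atTop_atBot.comp this).atBot_mul_const (r := (1 / 2 : ℝ)) (by norm_num)
    refine this.congr fun x => by simp; ring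
  have := (Real.tendsto_exp_atBot.comp h).const_mul (√(2 * Real.pi))⁻¹
  rw [mul_zero] at this
  exact this

theorem tendsto_gcdf_atBot : Tendsto gcdf atBot (𝓝 0) := by
  have := tendsto_setIntegral_of_antitone (μ := volume) (f := gpdf)
    (s := fun x : ℝᵒᵈ => Set.Iic (OrderDual.ofDual x)) (fun _ => measurableSet_Iic)
    (fun a b hab => Set.Iic_subset_Iic.2 hab) ⟨OrderDual.toDual 0, integrable_gpdf.integrableOn⟩
  have he : (⋂ n : ℝᵒᵈ, Set.Iic (OrderDual.ofDual n)) = ∅ := by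
    ext x; simp only [Set.mem_iInter, Set.mem_Iic, Set.mem_empty_iff_false, iff_false, not_forall]
    exact ⟨OrderDual.toDual (x - 1), by simp⟩
  rw [he] at this
  simpa using! this

theorem integral_Iic_id_mul_gpdf (w : ℝ) : ∫ t in Set.Iic w, t * gpdf t = -gpdf w := by
  have := integral_Iic_of_hasDerivAt_of_tendsto' (a := w) (f := fun t => -gpdf t)
    (f' := fun t => t * gpdf t) (m := 0) (fun x _ => by
      exact (hasDerivAt_gpdf x).fun_neg.congr_deriv (by ring)) integrable_id_mul_gpdf.integrableOn
      (by simpa using tendsto_gpdf_atBot.neg)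
  simpa using this

theorem integral_Ioi_id_mul_gpdf (w : ℝ) : ∫ t in Set.Ioi w, t * gpdf t = gpdf w := by
  have h := integral_comp_neg_Ioi w (fun t => t * gpdf t)
  rw [integral_Iic_id_mul_gpdf, gpdf_neg] at h
  simp only [gpdf_neg, neg_mul, integral_neg] at h
  linarith

/-- `E (w - Z)⁺` for a standard normal random variable `Z`. -/
def gloss (w : ℝ) : ℝ := w * gcdf w + gpdf w

theorem integral_Iic_sub_mul_gpdf (w : ℝ) :
    ∫ t in Set.Iic w, (w - t) * gpdf t = gloss w := by
  simp only [sub_mul]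
  rw [integral_sub (integrable_gpdf.const_mul w).integrableOn integrable_id_mul_gpdf.integrableOn,
    integral_Iic_id_mul_gpdf, integral_const_mul]
  simp [gloss, gcdf]

theorem integral_Ioi_sub_mul_gpdf (w : ℝ) :
    ∫ t in Set.Ioi w, (t - w) * gpdf t = gloss (-w) := by
  simp only [sub_mul]
  rw [integral_sub integrable_id_mul_gpdf.integrableOn (integrable_gpdf.const_mul w).integrableOn,
    integral_Ioi_id_mul_gpdf, integral_const_mul, integral_Ioi_gpdf]
  simp [gloss, gpdf_neg]; ring

theorem gloss_nonneg (w : ℝ) : 0 ≤ gloss w := by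
  rw [← integral_Iic_sub_mul_gpdf]
  refine setIntegral_nonneg measurableSet_Iic fun t ht => ?_
  exact mul_nonneg (sub_nonneg.2 ht) (gpdf_pos t).le

/-- A lower bound for Mills' ratio. -/
theorem mills_lower (w : ℝ) : 0 ≤ (1 + w ^ 2) * gcdf w + w * gpdf w := by
  -- The claim divided by `1 + w²` is increasing and vanishes at `-∞`.
  let ψ : ℝ → ℝ := fun w => gcdf w + w / (1 + w ^ 2) * gpdf w
  have hψ : ∀ w, HasDerivAt ψ (2 * gpdf w / (1 + w ^ 2) ^ 2) w := fun w => by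
    have hw : (1 + w ^ 2) ≠ 0 := by positivity
    have h1 : HasDerivAt (fun w : ℝ => 1 + w ^ 2) (2 * w) w := by
      simpa using ((hasDerivAt_id w).pow 2).const_add 1
    have := (hasDerivAt_gcdf w).add ((((hasDerivAt_id' w).fun_div h1 hw)).fun_mul (hasDerivAt_gpdf w))
    refine this.congr_deriv ?_
    field_simp; ring
  have hmono : Monotone ψ := monotone_of_hasDerivAt_nonneg hψ fun w => by
    have := gpdf_pos w; positivity
  have hlim : Tendsto ψ atBot (𝓝 0) := by
    have hb : Tendsto (fun w : ℝ => w / (1 + w ^ 2) * gpdf w) atBot (𝓝 0) := by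
      refine squeeze_zero_norm (fun w => ?_) tendsto_gpdf_atBot
      rw [norm_mul, Real.norm_of_nonneg (gpdf_pos w).le, norm_div, Real.norm_eq_abs,
        Real.norm_of_nonneg (by positivity : 0 ≤ 1 + w ^ 2)]
      refine mul_le_of_le_one_left (gpdf_pos w).le ?_
      rw [div_le_one (by positivity)]
      nlinarith [sq_abs w, sq_nonneg (|w| - 1), abs_nonneg w]
    simpa [ψ] using tendsto_gcdf_atBot.add hb
  have h0 : 0 ≤ ψ w := hmono.le_of_tendsto hlim w
  have hw : 0 < (1 + w ^ 2) := by positivity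
  have := mul_nonneg hw.le h0
  simp only [ψ] at this
  field_simp at this
  linarith
end
end RademacherStein
-- Stein's equation for Lipschitz test functions.
namespace RademacherStein
noncomputable section

theorem integral_mul_gpdf_comp_mul (w : ℝ) :
    ∫ c in (0 : ℝ)..1, w * gpdf (w * c) = gcdf w - 1 / 2 := by
  rw [intervalIntegral.integral_eq_sub_of_hasDerivAt (f := fun c => gcdf (w * c))]
  · simp [gcdf_zero]
  · intro c _
    have := (hasDerivAt_gcdf (w * c)).comp c ((hasDerivAt_id' c).const_mul w)
    exact this.congr_deriv (by ring)
  · have := continuous_gpdf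
    exact Continuous.intervalIntegrable (by fun_prop) _ _

theorem exp_eq_gpdf_mul_gpdf (w c : ℝ) :
    Real.exp (-w ^ 2 * (1 + c ^ 2) / 2) = 2 * Real.pi * (gpdf w * gpdf (w * c)) := by
  have h : √(2 * Real.pi) ^ 2 = 2 * Real.pi := Real.sq_sqrt (by positivity)
  have h0 : √(2 * Real.pi) ≠ 0 := by positivity
  have : -w ^ 2 * (1 + c ^ 2) / 2 = -w ^ 2 / 2 + -(w * c) ^ 2 / 2 := by ring
  rw [this, Real.exp_add, gpdf, gpdf]
  field_simp
  rw [h]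

/-- Owen's formula. -/
theorem gcdf_mul_gcdf_neg (w : ℝ) :
    Real.pi * (gcdf w * gcdf (-w)) =
      ∫ c in (0 : ℝ)..1, Real.exp (-w ^ 2 * (1 + c ^ 2) / 2) / (1 + c ^ 2) := by
  -- Both sides have derivative `π φ(w)(1 - 2Φ(w))`, and at `0` both equal `π / 4`, on the right as
  -- `arctan 1`.
  let T : ℝ → ℝ := fun w => ∫ c in (0 : ℝ)..1, Real.exp (-w ^ 2 * (1 + c ^ 2) / 2) / (1 + c ^ 2)
  have hpos : ∀ c : ℝ, 1 + c ^ 2 ≠ 0 := fun c => by positivity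
  have hT : ∀ w, HasDerivAt T (-(2 * Real.pi * gpdf w) * (gcdf w - 1 / 2)) w := fun w => by
    have key := intervalIntegral.hasDerivAt_integral_of_dominated_loc_of_deriv_le
      (μ := volume) (a := 0) (b := 1) (s := Metric.ball w 1) (x₀ := w)
      (F := fun w c : ℝ => Real.exp (-w ^ 2 * (1 + c ^ 2) / 2) / (1 + c ^ 2))
      (F' := fun w c : ℝ => -w * Real.exp (-w ^ 2 * (1 + c ^ 2) / 2))
      (bound := fun _ => |w| + 1) (Metric.ball_mem_nhds _ one_pos)
      (Eventually.of_forall fun x => Continuous.aestronglyMeasurable (by fun_prop (disch := exact hpos _)))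
      (Continuous.intervalIntegrable (by fun_prop (disch := exact hpos _)) _ _)
      (Continuous.aestronglyMeasurable (by fun_prop))
      (ae_of_all _ fun c _ x hx => ?_)
      intervalIntegrable_const
      (ae_of_all _ fun c _ x hx => ?_)
    · refine key.2.congr_deriv ?_
      rw [← integral_mul_gpdf_comp_mul, ← intervalIntegral.integral_const_mul]
      congr 1; ext c
      rw [exp_eq_gpdf_mul_gpdf]; ring
    · rw [norm_mul, norm_neg, Real.norm_eq_abs, Real.norm_of_nonneg (Real.exp_pos _).le]
      have h1 : |x| ≤ |w| + 1 := by
        rw [Metric.mem_ball, Real.dist_eq] at hx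
        have := abs_sub_abs_le_abs_sub x w; linarith
      have h2 : Real.exp (-x ^ 2 * (1 + c ^ 2) / 2) ≤ 1 := by
        rw [Real.exp_le_one_iff]
        have : 0 ≤ x ^ 2 * (1 + c ^ 2) := by positivity
        linarith
      calc _ ≤ |x| * 1 := by gcongr
        _ ≤ _ := by linarith
    · have h := (((hasDerivAt_id' x).fun_pow 2).fun_neg.mul_const (1 + c ^ 2)).div_const 2
      refine (h.exp.div_const (1 + c ^ 2)).congr_deriv ?_
      have := hpos c
      field_simp; norm_num; ring
  have hS : ∀ w, HasDerivAt (fun w => Real.pi * (gcdf w * gcdf (-w)) - T w) 0 w := fun w => by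
    have h1 : ∀ w, gcdf (-w) = 1 - gcdf w := fun w => by linarith [gcdf_add_gcdf_neg w]
    simp only [h1]
    refine ((((hasDerivAt_gcdf w).fun_mul ((hasDerivAt_gcdf w).const_sub 1)).const_mul
      Real.pi).fun_sub (hT w)).congr_deriv ?_
    ring
  have := is_const_of_deriv_eq_zero (fun w => (hS w).differentiableAt)
    (fun w => (hS w).deriv) w 0
  have h0 : Real.pi * (gcdf 0 * gcdf (-0)) - T 0 = 0 := by
    simp [T, gcdf_zero]
    ring
  simp only [h0] at this
  linarith

/-- This is the source of the sharp constant `√(2/π)`; equality holds at `w = 0`. Owen's formula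
writes the left side as `φ(w)(φ(w) + 2 ∫₀¹ w² φ(wc) c²/(1 + c²) dc)`. The inequality `2c ≤ 1 + c²`
bounds the second term by `∫₀¹ w² c φ(wc) dc = φ(0) - φ(w)`. -/
theorem gloss_mul_gloss_neg_le (w : ℝ) : gloss w * gloss (-w) ≤ gpdf 0 * gpdf w := by
  have hc : ∀ c : ℝ, 1 + c ^ 2 ≠ 0 := fun c => by positivity
  have h1 : gcdf (-w) = 1 - gcdf w := by linarith [gcdf_add_gcdf_neg w]
  have hφ := gpdf_pos w
  have hint : ∀ f : ℝ → ℝ, Continuous f → IntervalIntegrable f volume 0 1 :=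
    fun f hf => hf.intervalIntegrable _ _
  have hg := continuous_gpdf
  -- `∫ w² c φ(w c) dc`
  have hA : ∫ c in (0 : ℝ)..1, w ^ 2 * c * gpdf (w * c) = gpdf 0 - gpdf w := by
    rw [intervalIntegral.integral_eq_sub_of_hasDerivAt (f := fun c => -gpdf (w * c))]
    · simp; ring
    · intro c _
      have := ((hasDerivAt_gpdf (w * c)).comp c ((hasDerivAt_id' c).const_mul w)).fun_neg
      exact this.congr_deriv (by ring)
    · exact hint _ (by fun_prop)
  have hB : gcdf w * gcdf (-w) = 2 * gpdf w * ∫ c in (0 : ℝ)..1, gpdf (w * c) / (1 + c ^ 2) := by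
    have := gcdf_mul_gcdf_neg w
    simp only [exp_eq_gpdf_mul_gpdf] at this
    have h2 : Real.pi * (gcdf w * gcdf (-w)) =
        Real.pi * (2 * gpdf w * ∫ c in (0 : ℝ)..1, gpdf (w * c) / (1 + c ^ 2)) := by
      rw [this, ← intervalIntegral.integral_const_mul, ← intervalIntegral.integral_const_mul]
      congr 1; ext c; ring
    exact mul_left_cancel₀ Real.pi_ne_zero h2
  have hC : w * (2 * gcdf w - 1) = 2 * ∫ c in (0 : ℝ)..1, w ^ 2 * gpdf (w * c) := by
    have := integral_mul_gpdf_comp_mul w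
    have h2 : ∫ c in (0 : ℝ)..1, w ^ 2 * gpdf (w * c) = w * ∫ c in (0 : ℝ)..1, w * gpdf (w * c) := by
      rw [← intervalIntegral.integral_const_mul]; congr 1; ext c; ring
    rw [h2, this]; ring
  have hD : 2 * ∫ c in (0 : ℝ)..1, (w ^ 2 * gpdf (w * c) - w ^ 2 * (gpdf (w * c) / (1 + c ^ 2))) ≤
      gpdf 0 - gpdf w := by
    rw [← hA, ← intervalIntegral.integral_const_mul]
    refine intervalIntegral.integral_mono_on zero_le_one
      (hint _ (by fun_prop (disch := exact hc _))) (hint _ (by fun_prop)) fun c hc' => ?_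
    have e : 2 * (w ^ 2 * gpdf (w * c) - w ^ 2 * (gpdf (w * c) / (1 + c ^ 2))) =
        w ^ 2 * gpdf (w * c) * c * (2 * c / (1 + c ^ 2)) := by
      have := hc c
      field_simp; ring
    have e2 : 2 * c / (1 + c ^ 2) ≤ 1 := by
      rw [div_le_one (by positivity)]; nlinarith [sq_nonneg (c - 1)]
    rw [e]
    have h3 : 0 ≤ w ^ 2 * gpdf (w * c) * c :=
      mul_nonneg (mul_nonneg (sq_nonneg _) (gpdf_pos _).le) hc'.1
    calc _ ≤ w ^ 2 * gpdf (w * c) * c * 1 := by gcongr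
      _ = _ := by ring
  rw [intervalIntegral.integral_sub (hint _ (by fun_prop))
    (hint _ (by fun_prop (disch := exact hc _))), intervalIntegral.integral_const_mul (w ^ 2)
      (fun c => gpdf (w * c) / (1 + c ^ 2))] at hD
  have e : gloss w * gloss (-w) = gpdf w * (gpdf w + w * (2 * gcdf w - 1)) -
      w ^ 2 * (gcdf w * gcdf (-w)) := by
    simp only [gloss, gpdf_neg, h1]; ring
  rw [e, hB, hC]
  have := mul_le_mul_of_nonneg_left hD hφ.le
  linarith

/-- The solution `f` of Stein's equation `f' w - w f w = h w - ∫ h dN(0, 1)`. -/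
def steinSol (h : ℝ → ℝ) (w : ℝ) : ℝ :=
  (gpdf w)⁻¹ * ∫ t in Set.Iic w, (h t - ∫ x, h x ∂(gaussianReal 0 1)) * gpdf t

theorem integrable_of_lipschitz {h : ℝ → ℝ} {K : ℝ≥0} (hh : LipschitzWith K h) :
    Integrable h (gaussianReal 0 1) := by
  have h1 : Integrable (fun x : ℝ => |h 0| + K * |x|) (gaussianReal 0 1) :=
    (integrable_const _).add
      (((memLp_id_gaussianReal 1).integrable (by simp)).abs.const_mul _)
  refine h1.mono' hh.continuous.aestronglyMeasurable (ae_of_all _ fun x => ?_)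
  have := hh.dist_le_mul x 0
  rw [Real.dist_eq, Real.dist_eq, sub_zero] at this
  have h2 := abs_sub_abs_le_abs_sub (h x) (h 0)
  rw [Real.norm_eq_abs]; linarith

section LipschitzStein
variable {h : ℝ → ℝ} (hh : LipschitzWith 1 h)
include hh

theorem hasDerivAt_steinSol (w : ℝ) :
    HasDerivAt (steinSol h) (w * steinSol h w + (h w - ∫ x, h x ∂(gaussianReal 0 1))) w := by
  set m := ∫ x, h x ∂(gaussianReal 0 1) with hm
  let k : ℝ → ℝ := fun t => (h t - m) * gpdf t
  have hki : Integrable k :=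
    integrable_mul_gpdf ((integrable_of_lipschitz hh).sub (integrable_const m))
  have hkc : Continuous k := by
    have := hh.continuous; have := continuous_gpdf; fun_prop
  have hK : HasDerivAt (fun w => ∫ t in Set.Iic w, k t) (k w) w := by
    have h1 : HasDerivAt (fun x => (∫ t in Set.Iic 0, k t) + ∫ t in (0 : ℝ)..x, k t) (k w) w :=
      (hkc.integral_hasStrictDerivAt 0 w).hasDerivAt.const_add _
    refine h1.congr_of_eventuallyEq (Eventually.of_forall fun x => ?_)
    simp only
    rw [← intervalIntegral.integral_Iic_sub_Iic hki.integrableOn hki.integrableOn]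
    ring
  have hne := (gpdf_pos w).ne'
  refine (((hasDerivAt_gpdf w).fun_inv hne).fun_mul hK).congr_deriv ?_
  simp only [steinSol, k, ← hm]
  field_simp

/-- Split `E h(Z) - h(w)` into its parts `a` from `(-∞, w]` and `b` from `(w, ∞)`. The Lipschitz
property gives `|a| ≤ gloss w` and `|b| ≤ gloss (-w)`. Both quantities are linear in `a` and `b`,
with coefficients whose signs are known from `gloss_nonneg` and `mills_lower`, so inserting the
extreme values suffices. The second quantity is the derivative of `w f(w)`. -/
theorem steinSol_bounds (w : ℝ) :
    |w * steinSol h w + (h w - ∫ x, h x ∂(gaussianReal 0 1))| ≤ √(2 / Real.pi) ∧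
    |steinSol h w + w * (w * steinSol h w + (h w - ∫ x, h x ∂(gaussianReal 0 1)))| ≤ 1 := by
  set m := ∫ x, h x ∂(gaussianReal 0 1) with hm
  let k : ℝ → ℝ := fun t => (h t - h w) * gpdf t
  have hki : Integrable k :=
    integrable_mul_gpdf ((integrable_of_lipschitz hh).sub (integrable_const _))
  set a := ∫ t in Set.Iic w, k t with ha
  set b := ∫ t in Set.Ioi w, k t with hb
  have hφ := gpdf_pos w
  have hΦ := gcdf_add_gcdf_neg w
  have hab : m - h w = a + b := by
    rw [ha, hb, intervalIntegral.integral_Iic_add_Ioi hki.integrableOn hki.integrableOn]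
    rw [hm, integral_gaussianReal_eq_gpdf]
    simp only [k, sub_mul]
    rw [integral_sub (integrable_mul_gpdf (integrable_of_lipschitz hh))
      (integrable_gpdf.const_mul _), integral_const_mul, integral_gpdf, mul_one]
  have hf : steinSol h w = (gpdf w)⁻¹ * (a * gcdf (-w) - b * gcdf w) := by
    have : ∫ t in Set.Iic w, (h t - m) * gpdf t = a - (a + b) * gcdf w := by
      have e : ∀ t, (h t - m) * gpdf t = k t - (a + b) * gpdf t := fun t => by
        simp only [k, ← hab]; ring
      simp only [e]
      rw [integral_sub hki.integrableOn (integrable_gpdf.const_mul _).integrableOn,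
        integral_const_mul, ha, gcdf]
    rw [steinSol, ← hm, this]
    congr 1
    linear_combination -a * hΦ
  have hlip : ∀ t, |h t - h w| ≤ |t - w| := fun t => by
    simpa [Real.dist_eq] using hh.dist_le_mul t w
  have hA : |a| ≤ gloss w := by
    rw [ha, ← integral_Iic_sub_mul_gpdf]
    refine norm_integral_le_of_norm_le (f := k) ?_
      ((ae_restrict_iff' measurableSet_Iic).2 (ae_of_all _ fun t (ht : t ≤ w) => ?_))
    · simp only [sub_mul]
      exact ((integrable_gpdf.const_mul w).sub integrable_id_mul_gpdf).integrableOn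
    · simp only [k, norm_mul, Real.norm_eq_abs, abs_of_pos (gpdf_pos t)]
      have := hlip t
      rw [abs_of_nonpos (sub_nonpos.2 ht), neg_sub] at this
      exact mul_le_mul_of_nonneg_right this (gpdf_pos t).le
  have hB : |b| ≤ gloss (-w) := by
    rw [hb, ← integral_Ioi_sub_mul_gpdf]
    refine norm_integral_le_of_norm_le (f := k) ?_
      ((ae_restrict_iff' measurableSet_Ioi).2 (ae_of_all _ fun t (ht : w < t) => ?_))
    · simp only [sub_mul]
      exact (integrable_id_mul_gpdf.sub (integrable_gpdf.const_mul w)).integrableOn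
    · simp only [k, norm_mul, Real.norm_eq_abs, abs_of_pos (gpdf_pos t)]
      have := hlip t
      rw [abs_of_pos (sub_pos.2 ht)] at this
      exact mul_le_mul_of_nonneg_right this (gpdf_pos t).le
  have hJ := gloss_nonneg w
  have hJ' := gloss_nonneg (-w)
  have hM := mills_lower w
  have hM' := mills_lower (-w)
  rw [gpdf_neg] at hM'
  have hmw : h w - m = -(a + b) := by linarith
  have e1 : gpdf w * (w * steinSol h w + (h w - m)) = -(a * gloss (-w) + b * gloss w) := by
    rw [hf, hmw]
    simp only [gloss, gpdf_neg]
    field_simp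
    ring
  have hs : √(2 / Real.pi) = 2 * gpdf 0 := by
    have h2 : √(2 * Real.pi) = √2 * √Real.pi := Real.sqrt_mul zero_le_two _
    have h3 : √2 * √2 = 2 := Real.mul_self_sqrt zero_le_two
    have : √2 ≠ 0 := by positivity
    rw [Real.sqrt_div zero_le_two, gpdf, h2]
    simp
    field_simp
    linarith
  constructor
  · refine le_of_mul_le_mul_left ?_ hφ
    rw [← abs_of_pos hφ, ← abs_mul, abs_of_pos hφ, e1, abs_neg, hs]
    calc _ ≤ |a * gloss (-w)| + |b * gloss w| := abs_add_le _ _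
      _ = |a| * gloss (-w) + |b| * gloss w := by
        rw [abs_mul, abs_mul, abs_of_nonneg hJ, abs_of_nonneg hJ']
      _ ≤ gloss w * gloss (-w) + gloss (-w) * gloss w := by gcongr
      _ ≤ _ := by linarith [gloss_mul_gloss_neg_le w]
  · have e2 : gpdf w * (steinSol h w + w * (w * steinSol h w + (h w - m))) =
        a * ((1 + (-w) ^ 2) * gcdf (-w) + -w * gpdf w) -
          b * ((1 + w ^ 2) * gcdf w + w * gpdf w) := by
      have e3 : gpdf w * steinSol h w = a * gcdf (-w) - b * gcdf w := by
        rw [hf]; field_simp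
      rw [mul_add, mul_left_comm, e1, e3]
      simp only [gloss, gpdf_neg]; ring
    refine le_of_mul_le_mul_left ?_ hφ
    rw [← abs_of_pos hφ, ← abs_mul, abs_of_pos hφ, e2]
    calc _ ≤ |a * ((1 + (-w) ^ 2) * gcdf (-w) + -w * gpdf w)| +
          |b * ((1 + w ^ 2) * gcdf w + w * gpdf w)| := abs_sub _ _
      _ = |a| * ((1 + (-w) ^ 2) * gcdf (-w) + -w * gpdf w) +
          |b| * ((1 + w ^ 2) * gcdf w + w * gpdf w) := by
        rw [abs_mul, abs_mul, abs_of_nonneg hM, abs_of_nonneg hM']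
      _ ≤ gloss w * ((1 + (-w) ^ 2) * gcdf (-w) + -w * gpdf w) +
          gloss (-w) * ((1 + w ^ 2) * gcdf w + w * gpdf w) := by gcongr
      _ = _ := by
        simp only [gloss, gpdf_neg]; linear_combination gpdf w * hΦ

/-- Stein's equation for a Lipschitz test function. -/
theorem exists_stein_solution_lipschitz :
    ∃ f f' : ℝ → ℝ, (∀ x, HasDerivAt f (f' x) x) ∧ (∀ x, |f' x| ≤ √(2 / Real.pi)) ∧
      LipschitzWith 2 f' ∧ ∀ x, f' x - x * f x = h x - ∫ x, h x ∂(gaussianReal 0 1) := by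
  refine ⟨steinSol h, fun w => w * steinSol h w + (h w - ∫ x, h x ∂(gaussianReal 0 1)),
    hasDerivAt_steinSol hh, fun w => (steinSol_bounds hh w).1, ?_, fun x => by ring⟩
  -- Since `h` need not be differentiable, `f'` is treated as `w f(w)` plus `h` minus a constant:
  -- each of the first two is 1-Lipschitz, whence the constant 2.
  have h1 : LipschitzWith 1 (fun w => w * steinSol h w) := by
    have hd : ∀ w, HasDerivAt (fun w => w * steinSol h w) (steinSol h w + w *
        (w * steinSol h w + (h w - ∫ x, h x ∂(gaussianReal 0 1)))) w := fun w =>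
      ((hasDerivAt_id' w).fun_mul (hasDerivAt_steinSol hh w)).congr_deriv (by ring)
    refine lipschitzWith_of_nnnorm_deriv_le (fun w => (hd w).differentiableAt) fun w => ?_
    rw [(hd w).deriv, ← NNReal.coe_le_coe]
    exact (steinSol_bounds hh w).2
  have h2 := h1.add (hh.sub (LipschitzWith.const (∫ x, h x ∂(gaussianReal 0 1))))
  refine h2.weaken ?_
  norm_num
end LipschitzStein
end
end RademacherStein
-- Stein's equation for half-lines, and two-point expansions.
namespace RademacherStein
noncomputable section

/-- The quotient `Φ / φ` for the standard normal distribution. -/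
def mills (w : ℝ) : ℝ := gcdf w / gpdf w

theorem hasDerivAt_mills (w : ℝ) : HasDerivAt mills (1 + w * mills w) w := by
  have h := (gpdf_pos w).ne'
  refine ((hasDerivAt_gcdf w).fun_div (hasDerivAt_gpdf w) h).congr_deriv ?_
  simp only [mills]; field_simp; ring

theorem one_add_mul_mills_nonneg (w : ℝ) : 0 ≤ 1 + w * mills w := by
  have h := gpdf_pos w
  have : 1 + w * mills w = gloss w / gpdf w := by
    simp only [mills, gloss]; field_simp; ring
  rw [this]; exact div_nonneg (gloss_nonneg w) h.le

/-- The derivative is the quantity of `mills_lower` divided by `φ`. This is what makes `x f(x)`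
increasing for half-line test functions. -/
theorem monotone_mul_mills : Monotone fun w => w * mills w := by
  refine monotone_of_hasDerivAt_nonneg
    (fun w => (hasDerivAt_id' w).fun_mul (hasDerivAt_mills w)) fun w => ?_
  have h := gpdf_pos w
  have : 1 * mills w + w * (1 + w * mills w) =
      ((1 + w ^ 2) * gcdf w + w * gpdf w) / gpdf w := by
    simp only [mills]; field_simp; ring
  simp only [Pi.zero_apply, this]
  exact div_nonneg (mills_lower w) h.le

/-- The two branches of the Stein solution meet at `z`. -/
theorem gcdf_neg_mul_mills (z : ℝ) : gcdf (-z) * mills z = gcdf z * mills (-z) := by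
  simp only [mills, gpdf_neg]; ring

theorem sub_bounds_of_monotone_deriv {f f' : ℝ → ℝ} (hf : ∀ x, HasDerivAt f (f' x) x)
    (hf' : Monotone f') {a c : ℝ} (hac : a ≤ c) :
    (c - a) * f' a ≤ f c - f a ∧ f c - f a ≤ (c - a) * f' c := by
  rcases hac.eq_or_lt with rfl | hlt
  · simp
  obtain ⟨ξ, hξ, he⟩ := exists_hasDerivAt_eq_slope f f' hlt
    (fun x _ => (hf x).continuousAt.continuousWithinAt) fun x _ => hf x
  have hpos : 0 < c - a := sub_pos.2 hlt
  have e : f c - f a = (c - a) * f' ξ := by rw [he]; field_simp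
  rw [e]
  exact ⟨mul_le_mul_of_nonneg_left (hf' hξ.1.le) hpos.le,
    mul_le_mul_of_nonneg_left (hf' hξ.2.le) hpos.le⟩

/-- Stein's equation for the indicator function of `(-∞, z]`: `g x = x * f x`, and
`g + 1_{(-∞, z]} - Φ z` acts as the derivative of `f`. -/
theorem exists_stein_solution_Iic (z : ℝ) :
    ∃ f g : ℝ → ℝ, (∀ x, x * f x = g x) ∧ Monotone g ∧
      (∀ x, gcdf z - 1 ≤ g x ∧ g x ≤ gcdf z) ∧
      ∀ a c, a ≤ c →
        (c - a) * (g a + (Set.Iic z).indicator 1 c - gcdf z) ≤ f c - f a ∧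
        f c - f a ≤ (c - a) * (g c + (Set.Iic z).indicator 1 a - gcdf z) := by
  -- `L` and `R` are the branches of the classical solution below and above `z`. Their derivatives
  -- are `g + 1 - Φ(z)` and `g - Φ(z)`, so the derivative of `f` jumps at `z`, and the claim is
  -- stated with increments. As `g` increases and the indicator decreases, each bound evaluates them
  -- at opposite endpoints.
  let L : ℝ → ℝ := fun w => gcdf (-z) * mills w
  let R : ℝ → ℝ := fun w => gcdf z * mills (-w)
  have hLR : L z = R z := gcdf_neg_mul_mills z
  have hz := gcdf_pos z
  have hz' := gcdf_pos (-z)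
  have hsum := gcdf_add_gcdf_neg z
  let L' : ℝ → ℝ := fun w => gcdf (-z) * (1 + w * mills w)
  let R' : ℝ → ℝ := fun w => -(gcdf z * (1 + -w * mills (-w)))
  have hL : ∀ w, HasDerivAt L (L' w) w := fun w => (hasDerivAt_mills w).const_mul _
  have hR : ∀ w, HasDerivAt R (R' w) w := fun w =>
    (((hasDerivAt_mills (-w)).comp w (hasDerivAt_neg w)).const_mul _).congr_deriv (by
      simp only [R']; ring)
  have hL'm : Monotone L' := fun a b hab =>
    mul_le_mul_of_nonneg_left (add_le_add_right (monotone_mul_mills hab) _) hz'.le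
  have hR'm : Monotone R' := fun a b hab => neg_le_neg <|
    mul_le_mul_of_nonneg_left (add_le_add_right (monotone_mul_mills (neg_le_neg hab)) _) hz.le
  let f : ℝ → ℝ := fun w => if w ≤ z then L w else R w
  let g : ℝ → ℝ := fun w => w * f w
  have hfL : ∀ {w}, w ≤ z → f w = L w := fun h => if_pos h
  have hfR : ∀ {w}, z ≤ w → f w = R w := fun {w} h => by
    rcases h.eq_or_lt with rfl | h
    · simp only [f, le_refl, if_true, hLR]
    · exact if_neg h.not_ge
  have hgL : ∀ {w}, w ≤ z → g w = L' w - (1 - gcdf z) := fun {w} h => by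
    simp only [g, hfL h, L, L']; linear_combination (-1 : ℝ) * hsum
  have hgR : ∀ {w}, z ≤ w → g w = R' w + gcdf z := fun {w} h => by
    simp only [g, hfR h, R, R']; ring
  have hgm : Monotone g := by
    have h1 : MonotoneOn g (Set.Iic z) := fun a ha b hb hab => by
      rw [hgL ha, hgL hb]; exact sub_le_sub_right (hL'm hab) _
    have h2 : MonotoneOn g (Set.Ici z) := fun a ha b hb hab => by
      rw [hgR ha, hgR hb]; exact add_le_add_left (hR'm hab) _
    exact h1.Iic_union_Ici h2
  have hlow : ∀ x, x ≤ z → gcdf z - 1 ≤ g x := fun x hx => by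
    rw [hgL hx]
    have := mul_nonneg hz'.le (one_add_mul_mills_nonneg x)
    simp only [L']; linarith
  have hup : ∀ x, z ≤ x → g x ≤ gcdf z := fun x hx => by
    rw [hgR hx]
    have := mul_nonneg hz.le (one_add_mul_mills_nonneg (-x))
    simp only [R']; linarith
  refine ⟨f, g, fun _ => rfl, hgm, fun x => ?_, fun a c hac => ?_⟩
  · rcases le_total x z with h | h
    · exact ⟨hlow x h, (hgm h).trans (hup z le_rfl)⟩
    · exact ⟨(hlow z le_rfl).trans (hgm h), hup x h⟩
  · rcases le_or_gt c z with hc | hc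
    · have ha : a ≤ z := hac.trans hc
      have := sub_bounds_of_monotone_deriv hL hL'm hac
      rw [Set.indicator_of_mem (s := Set.Iic z) hc, Set.indicator_of_mem (s := Set.Iic z) ha,
        hgL ha, hgL hc, hfL ha, hfL hc]
      simp only [Pi.one_apply]
      constructor
      · refine le_trans (le_of_eq ?_) this.1; ring
      · refine this.2.trans (le_of_eq ?_); ring
    · rw [Set.indicator_of_notMem (s := Set.Iic z) (not_le.2 hc)]
      rcases le_or_gt a z with ha | ha
      · rw [Set.indicator_of_mem (s := Set.Iic z) ha]
        have h1 := sub_bounds_of_monotone_deriv hL hL'm ha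
        have h2 := sub_bounds_of_monotone_deriv hR hR'm hc.le
        have h3 := hgm ha
        have h4 := hgm hc.le
        have e1 := hgL ha
        have e2 := hgL le_rfl
        have e3 := hgR le_rfl
        have e4 := hgR hc.le
        have p1 : 0 ≤ z - a := sub_nonneg.2 ha
        have p2 : 0 ≤ c - z := sub_nonneg.2 hc.le
        have e5 : f c - f a = (R c - R z) + (L z - L a) := by rw [hfL ha, hfR hc.le, hLR]; ring
        rw [e5]
        simp only [Pi.one_apply]
        constructor
        · have q1 : (z - a) * (g a + 0 - gcdf z) ≤ (z - a) * L' a :=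
            mul_le_mul_of_nonneg_left (by linarith) p1
          have q2 : (c - z) * (g a + 0 - gcdf z) ≤ (c - z) * R' z :=
            mul_le_mul_of_nonneg_left (by linarith) p2
          linarith
        · have q1 : (z - a) * L' z ≤ (z - a) * (g c + 1 - gcdf z) :=
            mul_le_mul_of_nonneg_left (by linarith) p1
          have q2 : (c - z) * R' c ≤ (c - z) * (g c + 1 - gcdf z) :=
            mul_le_mul_of_nonneg_left (by linarith) p2
          linarith
      · rw [Set.indicator_of_notMem (s := Set.Iic z) (not_le.2 ha)]
        have := sub_bounds_of_monotone_deriv hR hR'm hac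
        rw [hgR ha.le, hgR hc.le, hfR ha.le, hfR hc.le]
        constructor
        · refine le_trans (le_of_eq ?_) this.1; ring
        · refine this.2.trans (le_of_eq ?_); ring

/-- Expansion of the Stein solution of a Lipschitz test function around both endpoints. -/
theorem two_point_expansion_lipschitz {f f' : ℝ → ℝ} (hf : ∀ x, HasDerivAt f (f' x) x)
    (hf' : LipschitzWith 2 f') {p : ℝ} (a b : ℝ) :
    |f b - f a - (b - a) * ((1 - p) * f' b + p * f' a)| ≤ (p ^ 2 + (1 - p) ^ 2) * (b - a) ^ 2 := by
  have taylor : ∀ x y, |f y - f x - (y - x) * f' x| ≤ (y - x) ^ 2 := fun x y => by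
    have hcont : Continuous f' := hf'.continuous
    have hi : f y - f x - (y - x) * f' x = ∫ t in (0:ℝ)..1, (y - x) * (f' (x + t * (y - x)) - f' x) := by
      rw [intervalIntegral.integral_eq_sub_of_hasDerivAt
        (f := fun t => f (x + t * (y - x)) - t * ((y - x) * f' x))]
      · simp; ring
      · intro t _
        have h1 : HasDerivAt (fun t => x + t * (y - x)) (y - x) t := by
          simpa using ((hasDerivAt_id' t).mul_const (y - x)).const_add x
        exact (((hf _).comp t h1).fun_sub
          ((hasDerivAt_id' t).mul_const ((y - x) * f' x))).congr_deriv (by ring)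
      · exact Continuous.intervalIntegrable (by fun_prop) _ _
    have h2 : ∫ t in (0:ℝ)..1, (y - x) ^ 2 * (2 * t) = (y - x) ^ 2 := by
      rw [intervalIntegral.integral_const_mul, intervalIntegral.integral_const_mul, integral_id]
      norm_num
    rw [hi, ← h2]
    refine intervalIntegral.norm_integral_le_of_norm_le (μ := volume)
      (f := fun t => (y - x) * (f' (x + t * (y - x)) - f' x)) (g := fun t => (y - x) ^ 2 * (2 * t))
      zero_le_one (ae_of_all _ fun t ht => ?_) (Continuous.intervalIntegrable (by fun_prop) _ _)
    have h3 := hf'.dist_le_mul (x + t * (y - x)) x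
    rw [Real.dist_eq, Real.dist_eq, add_sub_cancel_left, abs_mul, abs_of_pos ht.1] at h3
    rw [norm_mul, Real.norm_eq_abs, Real.norm_eq_abs, ← sq_abs (y - x)]
    calc _ ≤ |y - x| * (2 * (t * |y - x|)) := mul_le_mul_of_nonneg_left h3 (abs_nonneg _)
      _ = _ := by ring
  -- Expanding from both endpoints to this common point yields the weights `p` at `a` and `1 - p` at
  -- `b`; the two squared distances sum to `(p² + (1 - p)²)(b - a)²`.
  have h1 := taylor a (a + p * (b - a))
  have h2 := taylor b (a + p * (b - a))
  have e : f b - f a - (b - a) * ((1 - p) * f' b + p * f' a) =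
      (f (a + p * (b - a)) - f a - (a + p * (b - a) - a) * f' a) -
      (f (a + p * (b - a)) - f b - (a + p * (b - a) - b) * f' b) := by ring
  rw [e]
  refine (abs_sub _ _).trans ((add_le_add h1 h2).trans (le_of_eq ?_))
  ring

/-- Expansion of a function as in `exists_stein_solution_Iic` around both endpoints. -/
theorem two_point_expansion_Iic {f g ι : ℝ → ℝ} {s p : ℝ} (hp : 0 ≤ p) (hp1 : p ≤ 1)
    (hg : Monotone g) (hι : Antitone ι)
    (hf : ∀ a c, a ≤ c → (c - a) * (g a + ι c - s) ≤ f c - f a ∧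
        f c - f a ≤ (c - a) * (g c + ι a - s)) (a b : ℝ) :
    |f b - f a - (b - a) * ((1 - p) * (g b + ι b - s) + p * (g a + ι a - s))| ≤
      max p (1 - p) * ((b - a) * ((g b - ι b) - (g a - ι a))) := by
  -- Subtracting the weighted average from the upper bound leaves `r` times the increase of `g` plus
  -- `1 - r` times the decrease of `ι`, scaled by `b - a`; the lower bound has these weights
  -- exchanged. A general `r` is needed because swapping the endpoints replaces `p` by `1 - p`.
  have key : ∀ r : ℝ, 0 ≤ r → r ≤ 1 → ∀ a b, a ≤ b →
      |f b - f a - (b - a) * ((1 - r) * (g b + ι b - s) + r * (g a + ι a - s))| ≤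
      max r (1 - r) * ((b - a) * ((g b - ι b) - (g a - ι a))) := by
    intro r hr hr1 a b hab
    have h := hf a b hab
    have h1 : 0 ≤ (b - a) * (g b - g a) :=
      mul_nonneg (sub_nonneg.2 hab) (sub_nonneg.2 (hg hab))
    have h2 : 0 ≤ (b - a) * (ι a - ι b) :=
      mul_nonneg (sub_nonneg.2 hab) (sub_nonneg.2 (hι hab))
    have m1 := mul_le_mul_of_nonneg_right (le_max_left r (1 - r)) h1
    have m2 := mul_le_mul_of_nonneg_right (le_max_left r (1 - r)) h2
    have m3 := mul_le_mul_of_nonneg_right (le_max_right r (1 - r)) h1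
    have m4 := mul_le_mul_of_nonneg_right (le_max_right r (1 - r)) h2
    rw [abs_le]
    constructor <;> nlinarith
  rcases le_total a b with hab | hab
  · exact key p hp hp1 a b hab
  · have := key (1 - p) (by linarith) (by linarith) b a hab
    rw [sub_sub_cancel, max_comm] at this
    rw [← abs_neg]
    convert this using 1
    · congr 1; ring
    · ring
end
end RademacherStein
-- Abstract Malliavin calculus: Clark-Ocone, Poincaré and the pseudo-inverse in a Hilbert space.
namespace RademacherStein
noncomputable section

section Hilbert
open scoped InnerProductSpace
variable {E : Type*} [NormedAddCommGroup E] [InnerProductSpace ℝ E]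

/-- Orthogonal projections `A n` and `Q k` satisfying the algebraic relations of the conditional
expectations given the first `n` coordinates, and given all coordinates but the `k`-th one. -/
structure IsProjectionSystem (A Q : ℕ → E →L[ℝ] E) : Prop where
  symm_left : ∀ n x y, ⟪A n x, y⟫_ℝ = ⟪x, A n y⟫_ℝ
  symm_right : ∀ n x y, ⟪Q n x, y⟫_ℝ = ⟪x, Q n y⟫_ℝ
  comp_of_le : ∀ n m x, n ≤ m → A n (A m x) = A n x
  comp_of_ge : ∀ n m x, n ≤ m → A m (A n x) = A n x
  idem : ∀ k x, Q k (Q k x) = Q k x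
  comm : ∀ n k x, A n (Q k x) = Q k (A n x)
  comp_succ : ∀ k x, A (k + 1) (Q k x) = A k x

theorem norm_sq_proj_add {T : E →L[ℝ] E} (hs : ∀ x y, ⟪T x, y⟫_ℝ = ⟪x, T y⟫_ℝ)
    (hi : ∀ x, T (T x) = T x) (x : E) : ‖T x‖ ^ 2 + ‖x - T x‖ ^ 2 = ‖x‖ ^ 2 := by
  have h : ⟪T x, x - T x⟫_ℝ = 0 := by rw [hs, map_sub, hi, sub_self, inner_zero_right]
  have := norm_add_sq_eq_norm_sq_add_norm_sq_of_inner_eq_zero _ _ h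
  rw [add_sub_cancel] at this
  simp only [sq]; linarith

theorem norm_proj_le {T : E →L[ℝ] E} (hs : ∀ x y, ⟪T x, y⟫_ℝ = ⟪x, T y⟫_ℝ)
    (hi : ∀ x, T (T x) = T x) (x : E) : ‖T x‖ ≤ ‖x‖ :=
  (sq_le_sq₀ (norm_nonneg _) (norm_nonneg _)).1 (by
    have := norm_sq_proj_add hs hi x; nlinarith [sq_nonneg ‖x - T x‖])

theorem norm_sub_proj_le {T : E →L[ℝ] E} (hs : ∀ x y, ⟪T x, y⟫_ℝ = ⟪x, T y⟫_ℝ)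
    (hi : ∀ x, T (T x) = T x) (x : E) : ‖x - T x‖ ≤ ‖x‖ :=
  (sq_le_sq₀ (norm_nonneg _) (norm_nonneg _)).1 (by
    have := norm_sq_proj_add hs hi x; nlinarith [sq_nonneg ‖T x‖])

theorem summable_inner_of_sq {u v : ℕ → E} (hu : Summable fun k => ‖u k‖ ^ 2)
    (hv : Summable fun k => ‖v k‖ ^ 2) : Summable fun k => ⟪u k, v k⟫_ℝ := by
  refine (hu.add hv).of_norm_bounded fun k => ?_
  have := norm_inner_le_norm (𝕜 := ℝ) (u k) (v k)
  nlinarith [sq_nonneg (‖u k‖ - ‖v k‖), sq_nonneg (‖u k‖ + ‖v k‖)]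

namespace IsProjectionSystem
variable {A Q : ℕ → E →L[ℝ] E} (h : IsProjectionSystem A Q)
include h

theorem norm_left_le (n : ℕ) (x : E) : ‖A n x‖ ≤ ‖x‖ :=
  norm_proj_le (h.symm_left n) (fun x => h.comp_of_le n n x le_rfl) x

theorem left_right_of_le {n k : ℕ} (hnk : n ≤ k) (x : E) : A n (Q k x) = A n x := by
  rw [← h.comp_of_le n (k + 1) _ (by omega), h.comp_succ, h.comp_of_le n k _ hnk]

/-- By commutation the difference is, up to sign, the part of `x - Q k x` orthogonal to the range of
`A n`. The bound is uniform in `n` and serves as the dominating sequence below. -/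
theorem norm_sub_left_le (n k : ℕ) (x : E) :
    ‖(A n x - Q k (A n x)) - (x - Q k x)‖ ≤ ‖x - Q k x‖ := by
  rw [← h.comm, ← map_sub, norm_sub_rev]
  exact norm_sub_proj_le (h.symm_left n) (fun x => h.comp_of_le n n x le_rfl) (x - Q k x)

/-- Dominated convergence in `k`. Consequently `A n x` approximates `x` in the graph norm, so that
cylindrical functionals form a core. -/
theorem tendsto_tsum_norm_sub {x : E} (hx : Tendsto (fun n => A n x) atTop (𝓝 x))
    (hs : Summable fun k => ‖x - Q k x‖ ^ 2) :
    Tendsto (fun n => ∑' k, ‖(A n x - Q k (A n x)) - (x - Q k x)‖ ^ 2) atTop (𝓝 0) := by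
  have := tendsto_tsum_of_dominated_convergence (𝓕 := atTop)
    (f := fun n k => ‖(A n x - Q k (A n x)) - (x - Q k x)‖ ^ 2) (g := fun _ => (0 : ℝ)) hs
    (fun k => by
      have h1 : Tendsto (fun n => (A n x - Q k (A n x)) - (x - Q k x)) atTop
          (𝓝 ((x - Q k x) - (x - Q k x))) :=
        (hx.sub (((Q k).continuous.tendsto x).comp hx)).sub_const _
      simpa using (h1.norm.pow 2))
    (Eventually.of_forall fun n k => by
      rw [Real.norm_of_nonneg (sq_nonneg _)]
      have := h.norm_sub_left_le n k x
      gcongr)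
  simpa using this

/-- Projected derivatives are martingale increments, hence their sums telescope. -/
theorem increment_eq (k : ℕ) (x : E) : A (k + 1) (x - Q k x) = A (k + 1) x - A k x := by
  rw [map_sub, h.comp_succ]

/-- The increment lies in the kernel of `Q k`, so it only sees the component `y - Q k y`. -/
theorem inner_increment (k : ℕ) (x y : E) :
    ⟪A (k + 1) (x - Q k x), y⟫_ℝ = ⟪A (k + 1) (x - Q k x), y - Q k y⟫_ℝ := by
  rw [inner_sub_right, ← h.symm_right]
  have : Q k (A (k + 1) (x - Q k x)) = 0 := by
    rw [← h.comm, map_sub, h.idem, sub_self, map_zero]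
  rw [this, inner_zero_left, sub_zero]

theorem sum_increment (n : ℕ) {x : E} (hx0 : A 0 x = 0) :
    ∑ k ∈ Finset.range n, A (k + 1) (x - Q k x) = A n x := by
  simp only [h.increment_eq]
  rw [Finset.sum_range_sub (fun k => A k x), hx0, sub_zero]

/-- Each squared norm is the inner product of the increment with `x`, so the partial sums are `⟪A n
x, x⟫ ≤ ‖x‖²`. No differentiability of `x` enters. -/
theorem summable_increment {x : E} (hx0 : A 0 x = 0) :
    Summable fun k => ‖A (k + 1) (x - Q k x)‖ ^ 2 := by
  refine summable_of_sum_range_le (c := ‖x‖ ^ 2) (fun _ => sq_nonneg _) fun n => ?_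
  have e : ∀ k, ‖A (k + 1) (x - Q k x)‖ ^ 2 = ⟪A (k + 1) (x - Q k x), x⟫_ℝ := fun k => by
    rw [h.inner_increment, ← real_inner_self_eq_norm_sq, ← h.symm_left (k + 1) _ (x - Q k x)]
    rw [h.comp_of_le _ _ _ le_rfl]
  simp only [e]
  rw [← sum_inner, h.sum_increment n hx0]
  calc ⟪A n x, x⟫_ℝ ≤ ‖A n x‖ * ‖x‖ := real_inner_le_norm _ _
    _ ≤ ‖x‖ * ‖x‖ := mul_le_mul_of_nonneg_right (h.norm_left_le n x) (norm_nonneg _)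
    _ = _ := (sq _).symm

/-- The Clark-Ocone formula. -/
theorem hasSum_clarkOcone {x y : E} (hx : Tendsto (fun n => A n x) atTop (𝓝 x)) (hx0 : A 0 x = 0)
    (hy : Summable fun k => ‖y - Q k y‖ ^ 2) :
    HasSum (fun k => ⟪A (k + 1) (x - Q k x), y - Q k y⟫_ℝ) ⟪x, y⟫_ℝ := by
  have hs := summable_inner_of_sq (h.summable_increment hx0) hy
  rw [hs.hasSum_iff_tendsto_nat]
  simp only [← h.inner_increment, ← sum_inner, h.sum_increment _ hx0]
  exact hx.inner tendsto_const_nhds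

/-- The Poincaré (Efron-Stein) inequality. -/
theorem norm_sq_le_tsum {x : E} (hx : Tendsto (fun n => A n x) atTop (𝓝 x)) (hx0 : A 0 x = 0)
    (hs : Summable fun k => ‖x - Q k x‖ ^ 2) : ‖x‖ ^ 2 ≤ ∑' k, ‖x - Q k x‖ ^ 2 := by
  have hc := h.hasSum_clarkOcone hx hx0 hs
  rw [← real_inner_self_eq_norm_sq, ← hc.tsum_eq]
  refine hc.summable.tsum_le_tsum (fun k => ?_) hs
  calc _ ≤ ‖A (k + 1) (x - Q k x)‖ * ‖x - Q k x‖ := real_inner_le_norm _ _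
    _ ≤ ‖x - Q k x‖ * ‖x - Q k x‖ :=
      mul_le_mul_of_nonneg_right (h.norm_left_le _ _) (norm_nonneg _)
    _ = _ := (sq _).symm

theorem tendsto_left_of_tendsto {g : ℕ → E} {x : E} (hg : Tendsto g atTop (𝓝 x))
    (hgt : ∀ m, Tendsto (fun n => A n (g m)) atTop (𝓝 (g m))) :
    Tendsto (fun n => A n x) atTop (𝓝 x) := by
  rw [Metric.tendsto_atTop] at hg ⊢
  intro ε hε
  obtain ⟨m, hm⟩ := hg (ε / 3) (by positivity)
  have hm' := hm m le_rfl
  obtain ⟨N, hN⟩ := Metric.tendsto_atTop.1 (hgt m) (ε / 3) (by positivity)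
  refine ⟨N, fun n hn => ?_⟩
  have h1 := hN n hn
  have h2 : dist (A n x) (A n (g m)) ≤ dist x (g m) := by
    rw [dist_eq_norm, dist_eq_norm, ← map_sub]; exact h.norm_left_le _ _
  rw [dist_comm x] at h2
  calc dist (A n x) x ≤ dist (A n x) (A n (g m)) + dist (A n (g m)) (g m) + dist (g m) x :=
        dist_triangle4 _ _ _ _
    _ < ε := by linarith

/-- Existence of the pseudo-inverse of the Ornstein-Uhlenbeck operator. -/
theorem exists_pseudoInverse [CompleteSpace E] {x : E}
    (hx : Tendsto (fun n => A n x) atTop (𝓝 x)) (hx0 : A 0 x = 0) :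
    ∃ g, Tendsto (fun n => A n g) atTop (𝓝 g) ∧ A 0 g = 0 ∧ (Summable fun k => ‖g - Q k g‖ ^ 2) ∧
      ∀ y, Tendsto (fun n => A n y) atTop (𝓝 y) → (Summable fun k => ‖y - Q k y‖ ^ 2) →
        ∑' k, ⟪y - Q k y, g - Q k g⟫_ℝ = ⟪y, x⟫_ℝ := by
  have mem_iff : ∀ f : ℕ → E, Memℓp f 2 ↔ Summable fun k => ‖f k‖ ^ 2 := fun f => by
    rw [memℓp_gen_iff (by simp)]; simp
  -- The centered part of the domain of the derivative `𝒟`; there `‖y‖ ≤ ‖𝒟 y‖` by the Poincaré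
  -- inequality.
  let W : Submodule ℝ E :=
    { carrier := {y | Tendsto (fun n => A n y) atTop (𝓝 y) ∧ A 0 y = 0 ∧
        Memℓp (fun k => y - Q k y) 2}
      zero_mem' := by
        refine ⟨by simp, by simp, ?_⟩
        have : (fun k => (0 : E) - Q k 0) = 0 := by ext; simp
        rw [this]; exact zero_memℓp
      add_mem' := by
        rintro a b ⟨h1, h2, h3⟩ ⟨h4, h5, h6⟩
        refine ⟨by simpa using h1.add h4, by simp [h2, h5], ?_⟩
        convert h3.add h6 using 1
        ext k; simp; abel
      smul_mem' := by
        rintro c a ⟨h1, h2, h3⟩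
        refine ⟨by simpa using h1.const_smul c, by simp [h2], ?_⟩
        convert h3.const_smul c using 1
        ext k; simp [smul_sub] }
  let 𝒟 : W →ₗ[ℝ] lp (fun _ : ℕ => E) 2 :=
    { toFun := fun y => ⟨fun k => (y : E) - Q k y, y.2.2.2⟩
      map_add' := fun a b => Subtype.ext <| funext fun k => by
        change ((a : E) + b) - Q k (a + b) = ((a : E) - Q k a) + (b - Q k b)
        rw [map_add]; abel
      map_smul' := fun c a => Subtype.ext <| funext fun k => by
        change c • (a : E) - Q k (c • (a : E)) = c • ((a : E) - Q k a)
        rw [map_smul, smul_sub] }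
  have norm_D : ∀ y : W, ‖(y : E)‖ ≤ ‖𝒟 y‖ := fun y => by
    have h1 := h.norm_sq_le_tsum y.2.1 y.2.2.1 ((mem_iff _).1 y.2.2.2)
    have h2 : ‖𝒟 y‖ ^ 2 = ∑' k, ‖(y : E) - Q k y‖ ^ 2 := by
      have := lp.norm_rpow_eq_tsum (p := 2) (by simp) (𝒟 y)
      simpa using! this
    rw [← h2] at h1
    exact (sq_le_sq₀ (norm_nonneg _) (norm_nonneg _)).1 h1
  -- By Clark-Ocone, `u` satisfies `⟪𝒟 y, u⟫ = ⟪y, x⟫`, but it need not be a derivative. Its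
  -- projection `w` onto the closed range has the same pairings. By the Poincaré inequality
  -- preimages of a sequence tending to `w` are Cauchy, and their limit `G` has derivative `w`.
  let u : lp (fun _ : ℕ => E) 2 := ⟨fun k => A (k + 1) (x - Q k x), (mem_iff _).2 (h.summable_increment hx0)⟩
  let R : Submodule ℝ (lp (fun _ : ℕ => E) 2) := (LinearMap.range 𝒟).topologicalClosure
  have hRc : IsClosed (R : Set (lp (fun _ : ℕ => E) 2)) := Submodule.isClosed_topologicalClosure _
  have : CompleteSpace R := hRc.completeSpace_coe
  let w : lp (fun _ : ℕ => E) 2 := R.starProjection u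
  have hwR : w ∈ R := Submodule.starProjection_apply_mem R u
  obtain ⟨s, hs, hsw⟩ := mem_closure_iff_seq_limit.1
    (show w ∈ closure (LinearMap.range 𝒟 : Set (lp (fun _ : ℕ => E) 2)) from hwR)
  choose g hg using hs
  have hcau : CauchySeq fun n => (g n : E) := by
    have h1 : CauchySeq s := hsw.cauchySeq
    rw [Metric.cauchySeq_iff] at h1 ⊢
    intro ε hε
    obtain ⟨N, hN⟩ := h1 ε hε
    refine ⟨N, fun m hm n hn => ?_⟩
    refine lt_of_le_of_lt ?_ (hN m hm n hn)
    have := norm_D (g m - g n)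
    rw [map_sub, hg, hg] at this
    simpa [dist_eq_norm] using this
  obtain ⟨G, hG⟩ := cauchySeq_tendsto_of_complete hcau
  have hGw : ∀ k, G - Q k G = w k := fun k => by
    have h1 : Tendsto (fun n => (s n) k) atTop (𝓝 (w k)) := by
      have := (lp.evalCLM ℝ (fun _ : ℕ => E) 2 k).continuous.tendsto w
      exact this.comp hsw
    have h2 : Tendsto (fun n => (s n) k) atTop (𝓝 (G - Q k G)) := by
      have : ∀ n, (s n) k = (g n : E) - Q k (g n) := fun n => by rw [← hg]; rfl
      simp only [this]
      exact hG.sub (((Q k).continuous.tendsto G).comp hG)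
    exact tendsto_nhds_unique h2 h1
  have hGt := h.tendsto_left_of_tendsto hG fun m => (g m).2.1
  have hG0 : A 0 G = 0 := by
    have h1 : Tendsto (fun n => A 0 (g n)) atTop (𝓝 (A 0 G)) :=
      ((A 0).continuous.tendsto G).comp hG
    have h2 : ∀ n, A 0 (g n) = 0 := fun n => (g n).2.2.1
    simp only [h2] at h1
    exact tendsto_nhds_unique h1 tendsto_const_nhds
  have hwsum : Summable fun k => ‖w k‖ ^ 2 := (mem_iff _).1 (lp.memℓp w)
  refine ⟨G, hGt, hG0, by simpa only [hGw] using hwsum, fun y hy hys => ?_⟩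
  -- Only centered elements belong to `W`; removing the mean does not change the derivative.
  let y' : E := y - A 0 y
  have hy'Q : ∀ k, y' - Q k y' = y - Q k y := fun k => by
    simp only [y', map_sub, ← h.comm, h.left_right_of_le (Nat.zero_le k)]; abel
  have hy'W : y' ∈ W := by
    refine ⟨?_, ?_, ?_⟩
    · simp only [y', map_sub, h.comp_of_ge _ _ _ (Nat.zero_le _)]
      exact hy.sub_const _
    · simp only [y', map_sub, h.comp_of_ge _ _ _ (Nat.zero_le _), sub_self]
    · rw [mem_iff]; simpa only [hy'Q] using hys
  have hin : ⟪𝒟 ⟨y', hy'W⟩, w⟫_ℝ = ⟪𝒟 ⟨y', hy'W⟩, u⟫_ℝ := by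
    have h1 := Submodule.starProjection_inner_eq_zero u (𝒟 ⟨y', hy'W⟩) (K := R)
      (Submodule.le_topologicalClosure _ (LinearMap.mem_range_self _ _))
    rw [inner_sub_left, sub_eq_zero] at h1
    rw [real_inner_comm, ← h1, real_inner_comm]
  rw [lp.inner_eq_tsum, lp.inner_eq_tsum] at hin
  have e1 : ∑' k, ⟪y - Q k y, G - Q k G⟫_ℝ = ∑' k, ⟪(𝒟 ⟨y', hy'W⟩) k, w k⟫_ℝ :=
    tsum_congr fun k => by rw [hGw, ← hy'Q]; rfl
  have e2 : ∑' k, ⟪(𝒟 ⟨y', hy'W⟩) k, u k⟫_ℝ =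
      ∑' k, ⟪A (k + 1) (x - Q k x), y - Q k y⟫_ℝ :=
    tsum_congr fun k => by rw [real_inner_comm, ← hy'Q]; rfl
  rw [e1, hin, e2, (h.hasSum_clarkOcone hx hx0 hys).tsum_eq, real_inner_comm]

end IsProjectionSystem
end Hilbert
end
end RademacherStein
-- Conditioning on sets of coordinates, and splitting along one coordinate.
namespace RademacherStein
noncomputable section

theorem sigmaOf_mono {Ω : Type*} {X : ℕ → Ω → ℝ} {M N : Set ℕ} (h : M ⊆ N) : sigmaOf X M ≤ sigmaOf X N :=
  biSup_mono fun _ hj => h hj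

theorem measurable_sigmaOf {Ω : Type*} {X : ℕ → Ω → ℝ} {M : Set ℕ} {j : ℕ} (hj : j ∈ M) : Measurable[sigmaOf X M] (X j) :=
  (comap_measurable (X j)).mono (le_biSup (fun j => MeasurableSpace.comap (X j) inferInstance) hj)
    le_rfl

variable {Ω : Type*} [mΩ : MeasurableSpace Ω] {P : Measure Ω} {X : ℕ → Ω → ℝ} {p : ℕ → ℝ}

namespace IsRademacherSeq
variable (hX : IsRademacherSeq P X p)
include hX

theorem sigmaOf_le (M : Set ℕ) : sigmaOf X M ≤ mΩ :=
  iSup₂_le fun j _ => (hX.measurable j).comap_le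

theorem indep_sigmaOf {M N : Set ℕ} (h : Disjoint M N) :
    Indep (sigmaOf X M) (sigmaOf X N) P :=
  indep_iSup_of_disjoint (fun j => (hX.measurable j).comap_le) hX.indep h

variable [IsProbabilityMeasure P]

theorem setIntegral_inter {M N : Set ℕ} (hMN : Disjoint M N) {G : Ω → ℝ}
    (hG : AEStronglyMeasurable[sigmaOf X M] G P) (hGi : Integrable G P) {a b : Set Ω}
    (ha : MeasurableSet[sigmaOf X M] a) (hb : MeasurableSet[sigmaOf X N] b) :
    ∫ ω in a ∩ b, G ω ∂P = P.real b * ∫ ω in a, G ω ∂P := by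
  have hle := hX.sigmaOf_le N
  have hleM := hX.sigmaOf_le M
  obtain ⟨G', hG', hGG'⟩ := hG
  have hG'i : Integrable G' P := hGi.congr hGG'
  rw [setIntegral_congr_ae (hleM _ ha |>.inter (hle _ hb)) (hGG'.mono fun _ h _ => h),
    setIntegral_congr_ae (hleM _ ha) (hGG'.mono fun _ h _ => h)]
  have h1 := condExp_indep_eq (μ := P) hleM hle (hG'.indicator ha) (hX.indep_sigmaOf hMN)
  have h2 := setIntegral_condExp hle (hG'i.indicator (hleM _ ha)) hb
  rw [setIntegral_congr_ae (hle _ hb) (h1.mono fun _ h _ => h), setIntegral_const,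
    setIntegral_indicator (hleM _ ha), integral_indicator (hleM _ ha), Set.inter_comm b a] at h2
  rw [← h2, smul_eq_mul]

/-- A Dynkin argument over finite cylinders. The constraints on coordinates outside `M` are
independent of both integrands and factor out, leaving an event of `M ∩ N`. -/
theorem setIntegral_eq_of_forall {M N : Set ℕ} {G H : Ω → ℝ}
    (hG : AEStronglyMeasurable[sigmaOf X M] G P) (hGi : Integrable G P)
    (hH : AEStronglyMeasurable[sigmaOf X M] H P) (hHi : Integrable H P)
    (h : ∀ a, MeasurableSet[sigmaOf X (M ∩ N)] a → ∫ ω in a, G ω ∂P = ∫ ω in a, H ω ∂P)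
    {s : Set Ω} (hs : MeasurableSet[sigmaOf X N] s) :
    ∫ ω in s, G ω ∂P = ∫ ω in s, H ω ∂P := by
  classical
  have hle := hX.sigmaOf_le N
  have huniv : ∫ ω, G ω ∂P = ∫ ω, H ω ∂P := by
    have := h Set.univ MeasurableSet.univ
    simpa using this
  induction s, hs using MeasurableSpace.induction_on_inter
    (generateFrom_piiUnionInter_measurableSet
      (fun j => MeasurableSpace.comap (X j) inferInstance) N).symm
    (isPiSystem_piiUnionInter _ (fun j =>
      @MeasurableSpace.isPiSystem_measurableSet Ω (MeasurableSpace.comap (X j) inferInstance)) _) with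
  | empty => simp
  | basic s hs =>
    obtain ⟨t, htN, f, hf, rfl⟩ := hs
    have hmeas : ∀ (t' : Finset ℕ) (K : Set ℕ), t' ⊆ t → (↑t' ⊆ K) →
        MeasurableSet[sigmaOf X K] (⋂ x ∈ t', f x) := fun t' K ht' hK =>
      Finset.measurableSet_biInter _ fun x hx =>
        le_biSup (fun j => MeasurableSpace.comap (X j) inferInstance) (hK hx) _ (hf x (ht' hx))
    have e : (⋂ x ∈ t, f x) = (⋂ x ∈ t.filter (· ∈ M), f x) ∩ ⋂ x ∈ t.filter (· ∉ M), f x := by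
      ext ω
      simp only [Set.mem_iInter, Set.mem_inter_iff, Finset.mem_filter]
      constructor
      · exact fun h => ⟨fun i hi => h i hi.1, fun i hi => h i hi.1⟩
      · rintro ⟨h1, h2⟩ i hi
        by_cases hiM : i ∈ M
        · exact h1 i ⟨hi, hiM⟩
        · exact h2 i ⟨hi, hiM⟩
    have ha : MeasurableSet[sigmaOf X (M ∩ N)] (⋂ x ∈ t.filter (· ∈ M), f x) :=
      hmeas _ _ (Finset.filter_subset _ _) fun x hx => by
        have := Finset.mem_filter.1 (Finset.mem_coe.1 hx)
        exact ⟨this.2, htN this.1⟩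
    have hb : MeasurableSet[sigmaOf X Mᶜ] (⋂ x ∈ t.filter (· ∉ M), f x) :=
      hmeas _ _ (Finset.filter_subset _ _) fun x hx =>
        (Finset.mem_filter.1 (Finset.mem_coe.1 hx)).2
    have ha' := sigmaOf_mono (X := X) Set.inter_subset_left _ ha
    rw [e, hX.setIntegral_inter disjoint_compl_right hG hGi ha' hb,
      hX.setIntegral_inter disjoint_compl_right hH hHi ha' hb, h _ ha]
  | compl t ht ih =>
    have h1 := integral_add_compl (hle _ ht) hGi
    have h2 := integral_add_compl (hle _ ht) hHi
    linarith
  | iUnion f hd hm ih =>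
    rw [integral_iUnion (fun i => hle _ (hm i)) hd hGi.integrableOn,
      integral_iUnion (fun i => hle _ (hm i)) hd hHi.integrableOn]
    exact tsum_congr ih

/-- Conditioning a functional of the coordinates in `M` on the coordinates in `N`. -/
theorem condExp_sigmaOf_inter {M : Set ℕ} (N : Set ℕ) {H : Ω → ℝ}
    (hH : AEStronglyMeasurable[sigmaOf X M] H P) (hHi : Integrable H P) :
    P[H | sigmaOf X N] =ᵐ[P] P[H | sigmaOf X (M ∩ N)] := by
  have hle := hX.sigmaOf_le (M ∩ N)
  refine (ae_eq_condExp_of_forall_setIntegral_eq (hX.sigmaOf_le N) hHi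
    (fun _ _ _ => integrable_condExp.integrableOn) (fun s hs _ => ?_)
    (stronglyMeasurable_condExp.mono
      (sigmaOf_mono Set.inter_subset_right)).aestronglyMeasurable).symm
  exact hX.setIntegral_eq_of_forall (N := N) (stronglyMeasurable_condExp.mono
      (sigmaOf_mono Set.inter_subset_left)).aestronglyMeasurable integrable_condExp hH hHi
    (fun a ha => setIntegral_condExp hle hHi ha) hs

/-- All relations of `IsProjectionSystem` except symmetry become identities between index sets
through this rule. -/
theorem condExp_condExp_sigmaOf (M N : Set ℕ) {H : Ω → ℝ} :
    P[P[H | sigmaOf X M] | sigmaOf X N] =ᵐ[P] P[H | sigmaOf X (M ∩ N)] :=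
  (hX.condExp_sigmaOf_inter N stronglyMeasurable_condExp.aestronglyMeasurable
    integrable_condExp).trans
    (condExp_condExp_of_le (sigmaOf_mono Set.inter_subset_left) (hX.sigmaOf_le M))

omit [IsProbabilityMeasure P] in
theorem sub_pos (k : ℕ) : 0 < 1 - p k := _root_.sub_pos.2 (hX.lt_one k)

omit [IsProbabilityMeasure P] in
theorem sqrt_pos (k : ℕ) : 0 < √(p k * (1 - p k)) :=
  Real.sqrt_pos.2 (mul_pos (hX.pos k) (hX.sub_pos k))

omit [IsProbabilityMeasure P] in
theorem sq_sqrt (k : ℕ) : √(p k * (1 - p k)) ^ 2 = p k * (1 - p k) :=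
  Real.sq_sqrt (mul_pos (hX.pos k) (hX.sub_pos k)).le

theorem ae_eq_or (k : ℕ) : ∀ᵐ ω ∂P, X k ω = 1 ∨ X k ω = -1 := by
  have hm1 : MeasurableSet {ω | X k ω = 1} := hX.measurable k (measurableSet_singleton 1)
  have hm2 : MeasurableSet {ω | X k ω = -1} := hX.measurable k (measurableSet_singleton (-1))
  have hd : Disjoint {ω | X k ω = 1} {ω | X k ω = -1} := by
    rw [Set.disjoint_left]
    intro ω (h1 : X k ω = 1) (h2 : X k ω = -1)
    rw [h1] at h2; norm_num at h2
  have h : P ({ω | X k ω = 1} ∪ {ω | X k ω = -1}) = 1 := by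
    rw [measure_union hd hm2, hX.prob_one, hX.prob_neg_one,
      ← ENNReal.ofReal_add (hX.pos k).le (hX.sub_pos k).le]
    simp
  exact (prob_compl_eq_zero_iff (hm1.union hm2)).2 h

end IsRademacherSeq

/-- `F` is equal to `U` on `{X k = 1}` and to `V` on `{X k = -1}`, where `U` and `V` do not depend
on the `k`-th coordinate. -/
structure IsSplit {β : Type*} [TopologicalSpace β] (P : Measure Ω) (X : ℕ → Ω → ℝ) (k : ℕ)
    (F U V : Ω → β) : Prop where
  left : AEStronglyMeasurable[exceptSigma X k] U P
  right : AEStronglyMeasurable[exceptSigma X k] V P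
  eq_left : ∀ᵐ ω ∂P, X k ω = 1 → F ω = U ω
  eq_right : ∀ᵐ ω ∂P, X k ω = -1 → F ω = V ω

namespace IsSplit
variable {k : ℕ}

theorem self {β : Type*} [TopologicalSpace β] {A : Ω → β}
    (hA : AEStronglyMeasurable[exceptSigma X k] A P) : IsSplit P X k A A A :=
  ⟨hA, hA, ae_of_all _ fun _ _ => rfl, ae_of_all _ fun _ _ => rfl⟩

theorem comp {γ : Type*} [TopologicalSpace γ] [MeasurableSpace γ] [BorelSpace γ]
    [SecondCountableTopology γ] [TopologicalSpace.PseudoMetrizableSpace γ]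
    {F U V : Ω → ℝ} (h : IsSplit P X k F U V) {φ : ℝ → γ} (hφ : Measurable φ) :
    IsSplit P X k (fun ω => φ (F ω)) (fun ω => φ (U ω)) (fun ω => φ (V ω)) := by
  have key : ∀ {W : Ω → ℝ}, AEStronglyMeasurable[exceptSigma X k] W P →
      AEStronglyMeasurable[exceptSigma X k] (fun ω => φ (W ω)) P := by
    rintro W ⟨W', hW', he⟩
    exact ⟨fun ω => φ (W' ω), (hφ.comp hW'.measurable).stronglyMeasurable, he.fun_comp φ⟩
  exact ⟨key h.left, key h.right, h.eq_left.mono fun ω h1 h2 => by rw [h1 h2],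
    h.eq_right.mono fun ω h1 h2 => by rw [h1 h2]⟩

theorem mul {F U V F' U' V' : Ω → ℝ} (h : IsSplit P X k F U V) (h' : IsSplit P X k F' U' V') :
    IsSplit P X k (fun ω => F ω * F' ω) (fun ω => U ω * U' ω) (fun ω => V ω * V' ω) := by
  refine ⟨h.left.mul h'.left, h.right.mul h'.right, ?_, ?_⟩
  · filter_upwards [h.eq_left, h'.eq_left] with ω h1 h2 h3
    rw [h1 h3, h2 h3]
  · filter_upwards [h.eq_right, h'.eq_right] with ω h1 h2 h3
    rw [h1 h3, h2 h3]

theorem of_coordinate (φ : ℝ → ℝ) :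
    IsSplit P X k (fun ω => φ (X k ω)) (fun _ => φ 1) (fun _ => φ (-1)) :=
  ⟨stronglyMeasurable_const.aestronglyMeasurable, stronglyMeasurable_const.aestronglyMeasurable,
    ae_of_all _ fun ω h => by rw [h], ae_of_all _ fun ω h => by rw [h]⟩

theorem congr_ae {β : Type*} [TopologicalSpace β] {F F' U V : Ω → β} (h : IsSplit P X k F U V)
    (hF : F =ᵐ[P] F') : IsSplit P X k F' U V :=
  ⟨h.left, h.right, by filter_upwards [h.eq_left, hF] with ω h1 h2 h3; rw [← h2, h1 h3],
    by filter_upwards [h.eq_right, hF] with ω h1 h2 h3; rw [← h2, h1 h3]⟩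

variable (hX : IsRademacherSeq P X p) [IsProbabilityMeasure P]
include hX

/-- Fubini in the `k`-th coordinate, expressed through independence rather than a product space. -/
theorem lintegral_eq {F U V : Ω → ℝ≥0∞} (h : IsSplit P X k F U V) :
    ∫⁻ ω, F ω ∂P = ENNReal.ofReal (p k) * ∫⁻ ω, U ω ∂P +
      ENNReal.ofReal (1 - p k) * ∫⁻ ω, V ω ∂P := by
  obtain ⟨U', hU', hUU'⟩ := h.left
  obtain ⟨V', hV', hVV'⟩ := h.right
  have hle := hX.sigmaOf_le {j | j ≠ k}
  have hlek := hX.sigmaOf_le {k}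
  have hind := hX.indep_sigmaOf (M := {k}) (N := {j | j ≠ k}) (by
    rw [Set.disjoint_left]; rintro j rfl h; exact h rfl)
  have hm : ∀ c : ℝ, MeasurableSet[sigmaOf X {k}] {ω | X k ω = c} := fun c =>
    measurable_sigmaOf (Set.mem_singleton k) (measurableSet_singleton c)
  have key : ∀ (c : ℝ) (W : Ω → ℝ≥0∞), Measurable[exceptSigma X k] W →
      ∫⁻ ω, {ω | X k ω = c}.indicator (fun _ => 1) ω * W ω ∂P =
        P {ω | X k ω = c} * ∫⁻ ω, W ω ∂P := fun c W hW => by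
    rw [lintegral_mul_eq_lintegral_mul_lintegral_of_independent_measurableSpace hlek hle hind
      (measurable_const.indicator (hm c)) hW, lintegral_indicator_const (hlek _ (hm c)), one_mul]
  have hF : F =ᵐ[P] fun ω => {ω | X k ω = 1}.indicator (fun _ => 1) ω * U' ω +
      {ω | X k ω = -1}.indicator (fun _ => 1) ω * V' ω := by
    filter_upwards [h.eq_left, h.eq_right, hX.ae_eq_or k, hUU', hVV'] with ω h1 h2 h3 h4 h5
    rcases h3 with h3 | h3
    · rw [h1 h3, h4, Set.indicator_of_mem (show ω ∈ {ω | X k ω = 1} from h3),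
        Set.indicator_of_notMem (by rw [Set.mem_ofPred_eq, h3]; norm_num)]
      simp
    · rw [h2 h3, h5, Set.indicator_of_mem (show ω ∈ {ω | X k ω = -1} from h3),
        Set.indicator_of_notMem (by rw [Set.mem_ofPred_eq, h3]; norm_num)]
      simp
  rw [lintegral_congr_ae hF, lintegral_congr_ae hUU', lintegral_congr_ae hVV',
    lintegral_add_left, key _ _ hU'.measurable, key _ _ hV'.measurable, hX.prob_one,
    hX.prob_neg_one]
  exact (measurable_const.indicator (hlek _ (hm 1))).mul (hU'.measurable.mono hle le_rfl)

theorem aestronglyMeasurable {F U V : Ω → ℝ} (h : IsSplit P X k F U V) :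
    AEStronglyMeasurable F P := by
  have hle := hX.sigmaOf_le {j | j ≠ k}
  have hm : MeasurableSet {ω | X k ω = 1} := hX.measurable k (measurableSet_singleton 1)
  classical
  refine ⟨{ω | X k ω = 1}.piecewise (h.left.mk _) (h.right.mk _),
    (h.left.stronglyMeasurable_mk.mono hle).piecewise hm
      (h.right.stronglyMeasurable_mk.mono hle), ?_⟩
  filter_upwards [h.eq_left, h.eq_right, hX.ae_eq_or k, h.left.ae_eq_mk, h.right.ae_eq_mk]
    with ω h1 h2 h3 h4 h5
  by_cases h6 : X k ω = 1
  · rw [Set.piecewise_eq_of_mem _ _ _ (show ω ∈ {ω | X k ω = 1} from h6), ← h4, h1 h6]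
  · rw [Set.piecewise_eq_of_notMem _ _ _ (show ω ∉ {ω | X k ω = 1} from h6), ← h5, h2 (h3.resolve_left h6)]

theorem integrable_iff {F U V : Ω → ℝ} (h : IsSplit P X k F U V) :
    Integrable F P ↔ Integrable U P ∧ Integrable V P := by
  have hle := hX.sigmaOf_le {j | j ≠ k}
  have h1 := (h.comp measurable_enorm).lintegral_eq hX
  have hp : ENNReal.ofReal (p k) ≠ 0 := by simpa using hX.pos k
  have hq : ENNReal.ofReal (1 - p k) ≠ 0 := by simpa using hX.lt_one k
  have e : ∀ {c x : ℝ≥0∞}, c ≠ 0 → c ≠ ∞ → (c * x < ∞ ↔ x < ∞) := fun {c x} h0 ht => by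
    simp only [lt_top_iff_ne_top, ne_eq, ENNReal.mul_eq_top, h0, ht]; simp
  simp only [Integrable, h.aestronglyMeasurable hX, h.left.mono hle, h.right.mono hle, true_and,
    HasFiniteIntegral, h1, ENNReal.add_lt_top, e hp ENNReal.ofReal_ne_top,
    e hq ENNReal.ofReal_ne_top]

theorem integral_eq {F U V : Ω → ℝ} (h : IsSplit P X k F U V) (hU : Integrable U P)
    (hV : Integrable V P) :
    ∫ ω, F ω ∂P = p k * ∫ ω, U ω ∂P + (1 - p k) * ∫ ω, V ω ∂P := by
  have hle := hX.sigmaOf_le {j | j ≠ k}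
  have hlek := hX.sigmaOf_le {k}
  have hdis : Disjoint {j | j ≠ k} {k} := by
    rw [Set.disjoint_left]; rintro j h rfl; exact h rfl
  have hm : ∀ c : ℝ, MeasurableSet[sigmaOf X {k}] {ω | X k ω = c} := fun c =>
    measurable_sigmaOf (Set.mem_singleton k) (measurableSet_singleton c)
  have hF : F =ᵐ[P] fun ω => {ω | X k ω = 1}.indicator U ω + {ω | X k ω = -1}.indicator V ω := by
    filter_upwards [h.eq_left, h.eq_right, hX.ae_eq_or k] with ω h1 h2 h3
    rcases h3 with h3 | h3
    · rw [h1 h3, Set.indicator_of_mem (show ω ∈ {ω | X k ω = 1} from h3),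
        Set.indicator_of_notMem (by rw [Set.mem_ofPred_eq, h3]; norm_num)]
      simp
    · rw [h2 h3, Set.indicator_of_mem (show ω ∈ {ω | X k ω = -1} from h3),
        Set.indicator_of_notMem (by rw [Set.mem_ofPred_eq, h3]; norm_num)]
      simp
  have key : ∀ (c : ℝ) (W : Ω → ℝ), AEStronglyMeasurable[exceptSigma X k] W P → Integrable W P →
      ∫ ω in {ω | X k ω = c}, W ω ∂P = P.real {ω | X k ω = c} * ∫ ω, W ω ∂P := fun c W hW hWi => by
    have := hX.setIntegral_inter hdis hW hWi (a := Set.univ) MeasurableSet.univ (hm c)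
    simpa using this
  rw [integral_congr_ae hF, integral_add (hU.indicator (hlek _ (hm _)))
    (hV.indicator (hlek _ (hm _))), integral_indicator (hlek _ (hm _)),
    integral_indicator (hlek _ (hm _)), key _ _ h.left hU, key _ _ h.right hV, measureReal_def,
    measureReal_def, hX.prob_one, hX.prob_neg_one, ENNReal.toReal_ofReal (hX.pos k).le,
    ENNReal.toReal_ofReal (hX.sub_pos k).le]

theorem condExp_eq {F U V : Ω → ℝ} (h : IsSplit P X k F U V) (hF : Integrable F P) :
    P[F | exceptSigma X k] =ᵐ[P] fun ω => p k * U ω + (1 - p k) * V ω := by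
  have hle := hX.sigmaOf_le {j | j ≠ k}
  obtain ⟨hU, hV⟩ := (h.integrable_iff hX).1 hF
  refine (ae_eq_condExp_of_forall_setIntegral_eq hle hF
    (fun _ _ _ => ((hU.const_mul _).add (hV.const_mul _)).integrableOn) (fun s hs _ => ?_)
    ((h.left.const_mul _).add (h.right.const_mul _))).symm
  have hs' := hle _ hs
  have hspl : IsSplit P X k (s.indicator F) (s.indicator U) (s.indicator V) := by
    have hind : ∀ {W : Ω → ℝ}, AEStronglyMeasurable[exceptSigma X k] W P →
        AEStronglyMeasurable[exceptSigma X k] (s.indicator W) P := by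
      rintro W ⟨W', hW', he⟩
      refine ⟨s.indicator W', hW'.indicator hs, he.mono fun ω hω => ?_⟩
      by_cases h : ω ∈ s <;> simp [h, hω]
    refine ⟨hind h.left, hind h.right, ?_, ?_⟩
    · filter_upwards [h.eq_left] with ω h1 h2
      by_cases hω : ω ∈ s <;> simp [hω, h1 h2]
    · filter_upwards [h.eq_right] with ω h1 h2
      by_cases hω : ω ∈ s <;> simp [hω, h1 h2]
  rw [← integral_indicator hs', ← integral_indicator hs',
    hspl.integral_eq hX (hU.indicator hs') (hV.indicator hs'),
    integral_indicator hs', integral_indicator hs', integral_indicator hs',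
    integral_add' (hU.const_mul _).integrableOn (hV.const_mul _).integrableOn,
    integral_const_mul, integral_const_mul]

/-- The differences split the zero function, whose integral weights both of them positively.
Therefore `Dhat` may be computed from any splitting, not just from the chosen representative. -/
theorem unique {F U V U' V' : Ω → ℝ} (h : IsSplit P X k F U V) (h' : IsSplit P X k F U' V') :
    U =ᵐ[P] U' ∧ V =ᵐ[P] V' := by
  have h1 : IsSplit P X k (fun _ => (0 : ℝ≥0∞)) (fun ω => ‖U ω - U' ω‖ₑ)
      (fun ω => ‖V ω - V' ω‖ₑ) := by
    refine ⟨?_, ?_, ?_, ?_⟩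
    · exact continuous_enorm.comp_aestronglyMeasurable (h.left.sub h'.left)
    · exact continuous_enorm.comp_aestronglyMeasurable (h.right.sub h'.right)
    · filter_upwards [h.eq_left, h'.eq_left] with ω h1 h2 h3
      rw [← h1 h3, ← h2 h3]; simp
    · filter_upwards [h.eq_right, h'.eq_right] with ω h1 h2 h3
      rw [← h1 h3, ← h2 h3]; simp
  have h2 := h1.lintegral_eq hX
  have hp : ENNReal.ofReal (p k) ≠ 0 := by simpa using hX.pos k
  have hq : ENNReal.ofReal (1 - p k) ≠ 0 := by simpa using hX.lt_one k
  have hle := hX.sigmaOf_le {j | j ≠ k}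
  have hm1 : AEMeasurable (fun ω => ‖U ω - U' ω‖ₑ) P := ((h.left.sub h'.left).mono hle).enorm
  have hm2 : AEMeasurable (fun ω => ‖V ω - V' ω‖ₑ) P := ((h.right.sub h'.right).mono hle).enorm
  rw [lintegral_zero, eq_comm, add_eq_zero, mul_eq_zero, mul_eq_zero, or_iff_right hp,
    or_iff_right hq, lintegral_eq_zero_iff' hm1,
    lintegral_eq_zero_iff' hm2] at h2
  refine ⟨h2.1.mono fun ω hω => ?_, h2.2.mono fun ω hω => ?_⟩ <;>
  · simpa [sub_eq_zero] using hω

end IsSplit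
end
end RademacherStein
-- The two derivatives `D` and `Dhat` and their isometry.
namespace RademacherStein
noncomputable section
variable {Ω : Type*} [mΩ : MeasurableSpace Ω] {P : Measure Ω} {X : ℕ → Ω → ℝ} {p : ℕ → ℝ}

theorem IsSplit.sub {k : ℕ} {F U V F' U' V' : Ω → ℝ} (h : IsSplit P X k F U V)
    (h' : IsSplit P X k F' U' V') :
    IsSplit P X k (fun ω => F ω - F' ω) (fun ω => U ω - U' ω) (fun ω => V ω - V' ω) := by
  refine ⟨h.left.sub h'.left, h.right.sub h'.right, ?_, ?_⟩
  · filter_upwards [h.eq_left, h'.eq_left] with ω h1 h2 h3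
    rw [h1 h3, h2 h3]
  · filter_upwards [h.eq_right, h'.eq_right] with ω h1 h2 h3
    rw [h1 h3, h2 h3]

theorem sigmaOf_univ_eq_comap {Ω : Type*} (X : ℕ → Ω → ℝ) :
    sigmaOf X Set.univ = MeasurableSpace.comap (fun ω n => X n ω) MeasurableSpace.pi := by
  simp only [sigmaOf, MeasurableSpace.pi, MeasurableSpace.comap_iSup, MeasurableSpace.comap_comp]
  simp [Function.comp_def]

theorem representative_spec {F : Ω → ℝ} (hF : AEStronglyMeasurable[sigmaOf X Set.univ] F P) :
    Measurable (representative P X F) ∧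
      F =ᵐ[P] fun ω => representative P X F (fun n => X n ω) := by
  have h : ∃ f : (ℕ → ℝ) → ℝ, Measurable f ∧ F =ᵐ[P] fun ω => f (fun n => X n ω) := by
    obtain ⟨F', hF', he⟩ := hF
    have hm : Measurable[MeasurableSpace.comap (fun ω n => X n ω) MeasurableSpace.pi] F' := by
      rw [← sigmaOf_univ_eq_comap]; exact hF'.measurable
    obtain ⟨f, hf, rfl⟩ := hm.exists_eq_measurable_comp
    exact ⟨f, hf, he⟩
  rw [representative, dif_pos h]
  exact h.choose_spec

/-- The link between `Dhat`, defined by substituting values into a function of sequences, and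
splittings on `Ω`. -/
theorem isSplit_representative {F : Ω → ℝ} (hF : AEStronglyMeasurable[sigmaOf X Set.univ] F P)
    (k : ℕ) : IsSplit P X k F
      (fun ω => representative P X F (Function.update (fun n => X n ω) k 1))
      (fun ω => representative P X F (Function.update (fun n => X n ω) k (-1))) := by
  obtain ⟨hm, he⟩ := representative_spec hF
  have key : ∀ c : ℝ, AEStronglyMeasurable[exceptSigma X k]
      (fun ω => representative P X F (Function.update (fun n => X n ω) k c)) P := fun c => by
    refine (Measurable.stronglyMeasurable (hm.comp ?_)).aestronglyMeasurable
    refine @measurable_pi_lambda _ _ _ (exceptSigma X k) _ _ fun j => ?_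
    rcases eq_or_ne j k with rfl | hj
    · simp
    · simp only [Function.update_of_ne hj]
      exact measurable_sigmaOf (M := {j | j ≠ k}) hj
  refine ⟨key 1, key (-1), ?_, ?_⟩
  · filter_upwards [he] with ω h1 h2
    rw [h1, ← h2, Function.update_eq_self]
  · filter_upwards [he] with ω h1 h2
    rw [h1, ← h2, Function.update_eq_self]

theorem MemL2X.sub {F G : Ω → ℝ} (hF : MemL2X P X F) (hG : MemL2X P X G) :
    MemL2X P X (fun ω => F ω - G ω) := ⟨hF.1.sub hG.1, hF.2.sub hG.2⟩

theorem MemL2X.neg {F : Ω → ℝ} (hF : MemL2X P X F) : MemL2X P X (-F) := ⟨hF.1.neg, hF.2.neg⟩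

theorem MemL2X.congr_ae {F G : Ω → ℝ} (hF : MemL2X P X F) (h : F =ᵐ[P] G) : MemL2X P X G :=
  ⟨hF.1.congr h, (memLp_congr_ae h).1 hF.2⟩

theorem MemL2X.integrable [IsFiniteMeasure P] {F : Ω → ℝ} (hF : MemL2X P X F) : Integrable F P :=
  hF.2.integrable (by norm_num)

theorem isSplit_Y (k : ℕ) : IsSplit P X k (Y X p k)
    (fun _ => (1 - p k) / √(p k * (1 - p k))) (fun _ => -(p k / √(p k * (1 - p k)))) := by
  have := IsSplit.of_coordinate (P := P) (X := X) (k := k)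
    (fun x => (x + (1 - p k) - p k) / (2 * √(p k * (1 - p k))))
  convert this using 2
  · rfl
  · rw [show 1 + (1 - p k) - p k = 2 * (1 - p k) by ring, mul_div_mul_left _ _ two_ne_zero]
  · rw [show -1 + (1 - p k) - p k = 2 * (-p k) by ring, mul_div_mul_left _ _ two_ne_zero, neg_div]

theorem isSplit_Y_sq (k : ℕ) (hX : IsRademacherSeq P X p) : IsSplit P X k (fun ω => Y X p k ω ^ 2)
    (fun _ => (1 - p k) / p k) (fun _ => p k / (1 - p k)) := by
  have h := (isSplit_Y (P := P) (X := X) (p := p) k).comp (φ := fun x => x ^ 2) (by fun_prop)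
  have hp := (hX.pos k).ne'
  have hq := (hX.sub_pos k).ne'
  convert h using 2
  · rw [div_pow, hX.sq_sqrt]; field_simp
  · rw [neg_sq, div_pow, hX.sq_sqrt]; field_simp

variable [IsProbabilityMeasure P]

theorem IsSplit.Dhat_ae_eq (hX : IsRademacherSeq P X p) {k : ℕ} {F U V : Ω → ℝ}
    (h : IsSplit P X k F U V) (hF : AEStronglyMeasurable[sigmaOf X Set.univ] F P) :
    Dhat P X p k F =ᵐ[P] fun ω => √(p k * (1 - p k)) * (U ω - V ω) := by
  obtain ⟨h1, h2⟩ := (isSplit_representative hF k).unique hX h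
  filter_upwards [h1, h2] with ω h1 h2
  rw [Dhat, h1, h2]

omit [IsProbabilityMeasure P] in
theorem aestronglyMeasurable_Dhat {F : Ω → ℝ}
    (hF : AEStronglyMeasurable[sigmaOf X Set.univ] F P) (k : ℕ) :
    AEStronglyMeasurable[exceptSigma X k] (Dhat P X p k F) P := by
  have h := isSplit_representative hF k
  exact (h.left.sub h.right).const_mul _

variable (hX : IsRademacherSeq P X p)
include hX

theorem IsSplit.memLp_two {k : ℕ} {F U V : Ω → ℝ} (h : IsSplit P X k F U V) (hF : MemLp F 2 P) :
    MemLp U 2 P ∧ MemLp V 2 P := by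
  have hle := hX.sigmaOf_le {j | j ≠ k}
  have hs := ((h.comp (φ := fun x : ℝ => x ^ 2) (by fun_prop)).integrable_iff hX).1
    ((memLp_two_iff_integrable_sq hF.1).1 hF)
  exact ⟨(memLp_two_iff_integrable_sq (h.left.mono hle)).2 hs.1,
    (memLp_two_iff_integrable_sq (h.right.mono hle)).2 hs.2⟩

theorem MemL2X.Dhat {F : Ω → ℝ} (hF : MemL2X P X F) (k : ℕ) : MemL2X P X (Dhat P X p k F) := by
  have h := (isSplit_representative hF.1 k).memLp_two hX hF.2
  exact ⟨(aestronglyMeasurable_Dhat hF.1 k).mono (sigmaOf_mono (Set.subset_univ _)),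
    (h.1.sub h.2).const_mul _⟩

omit [IsProbabilityMeasure P] hX in
theorem MemL2X.D {F : Ω → ℝ} (hF : MemL2X P X F) (k : ℕ) : MemL2X P X (D P X k F) :=
  ⟨hF.1.sub (stronglyMeasurable_condExp.aestronglyMeasurable.mono
    (sigmaOf_mono (Set.subset_univ _))), hF.2.sub (hF.2.condExp one_le_two)⟩

omit hX in
theorem D_sub_ae_eq {F G : Ω → ℝ} (hF : MemL2X P X F) (hG : MemL2X P X G) (k : ℕ) :
    D P X k (fun ω => F ω - G ω) =ᵐ[P] fun ω => D P X k F ω - D P X k G ω := by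
  have := condExp_sub hF.integrable hG.integrable (exceptSigma X k)
  filter_upwards [this] with ω h
  simp only [D, Pi.sub_apply] at h ⊢
  change F ω - G ω - (P[F - G | exceptSigma X k]) ω = _
  rw [h]; ring

theorem Dhat_sub_ae_eq {F G : Ω → ℝ} (hF : MemL2X P X F) (hG : MemL2X P X G) (k : ℕ) :
    Dhat P X p k (fun ω => F ω - G ω) =ᵐ[P] fun ω => Dhat P X p k F ω - Dhat P X p k G ω := by
  have h := ((isSplit_representative hF.1 k).sub (isSplit_representative hG.1 k)).Dhat_ae_eq hX
    (hF.sub hG).1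
  filter_upwards [h] with ω h
  rw [h]; simp only [RademacherStein.Dhat]; ring

theorem Dhat_neg_ae_eq {F : Ω → ℝ} (hF : MemL2X P X F) (k : ℕ) :
    Dhat P X p k (-F) =ᵐ[P] fun ω => -Dhat P X p k F ω := by
  have h := ((isSplit_representative hF.1 k).comp (φ := fun x => -x) (by fun_prop)).Dhat_ae_eq hX
    hF.neg.1
  filter_upwards [h] with ω h
  change Dhat P X p k (fun ω => -F ω) ω = _
  rw [h]; simp only [RademacherStein.Dhat]; ring

/-- `D_k F = Y_k D̂_k F`. -/
theorem D_ae_eq_Y_mul_Dhat {F : Ω → ℝ} (hF : MemL2X P X F) (k : ℕ) :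
    D P X k F =ᵐ[P] fun ω => Y X p k ω * Dhat P X p k F ω := by
  have h := isSplit_representative hF.1 k
  have hs := hX.sqrt_pos k
  filter_upwards [h.condExp_eq hX hF.integrable, h.eq_left, h.eq_right, hX.ae_eq_or k,
    (isSplit_Y (P := P) (X := X) (p := p) k).eq_left,
    (isSplit_Y (P := P) (X := X) (p := p) k).eq_right] with ω h1 h2 h3 h4 h5 h6
  simp only [D, Pi.sub_apply, h1, Dhat]
  rcases h4 with h4 | h4
  · rw [h2 h4, h5 h4]; field_simp; ring
  · rw [h3 h4, h6 h4]; field_simp; ring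

theorem isSplit_D {F : Ω → ℝ} (hF : MemL2X P X F) (k : ℕ) : IsSplit P X k (D P X k F)
    (fun ω => (1 - p k) / √(p k * (1 - p k)) * Dhat P X p k F ω)
    (fun ω => -(p k / √(p k * (1 - p k))) * Dhat P X p k F ω) :=
  ((isSplit_Y k).mul (IsSplit.self (aestronglyMeasurable_Dhat hF.1 k))).congr_ae
    (D_ae_eq_Y_mul_Dhat hX hF k).symm

/-- `D_k F = Y_k D̂_k F`, where `Y_k` has second moment one and `D̂_k F` does not depend on `X_k`.
This isometry is the reason why the two domains coincide. -/
theorem lintegral_enorm_D_sq {F : Ω → ℝ} (hF : MemL2X P X F) (k : ℕ) :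
    ∫⁻ ω, ‖D P X k F ω‖ₑ ^ 2 ∂P = ∫⁻ ω, ‖Dhat P X p k F ω‖ₑ ^ 2 ∂P := by
  have h := ((isSplit_D hX hF k).comp (φ := fun x => ‖x‖ₑ ^ 2) (by fun_prop)).lintegral_eq hX
  have hp := hX.pos k
  have hq := hX.sub_pos k
  have hs := hX.sqrt_pos k
  have e : ∀ c : ℝ, ‖c‖ₑ ^ 2 = ENNReal.ofReal (c ^ 2) := fun c => by
    rw [← ofReal_norm, ← ENNReal.ofReal_pow (norm_nonneg _), Real.norm_eq_abs, sq_abs]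
  simp only [enorm_mul, mul_pow] at h
  have hm : AEMeasurable (fun ω => ‖Dhat P X p k F ω‖ₑ ^ 2) P := (hF.Dhat hX k).2.1.enorm.pow_const 2
  rw [lintegral_const_mul'' _ hm, lintegral_const_mul'' _ hm, e, e, ← mul_assoc, ← mul_assoc,
    ← add_mul, ← ENNReal.ofReal_mul hp.le, ← ENNReal.ofReal_mul hq.le,
    ← ENNReal.ofReal_add (by positivity) (by positivity)] at h
  rw [h]
  convert one_mul _
  rw [neg_sq, div_pow, div_pow, hX.sq_sqrt]
  have : p k * ((1 - p k) ^ 2 / (p k * (1 - p k))) + (1 - p k) * (p k ^ 2 / (p k * (1 - p k))) =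
      1 := by field_simp; ring
  rw [this, ENNReal.ofReal_one]

theorem lintegral_enorm_Dhat_sub_sq {F G : Ω → ℝ} (hF : MemL2X P X F) (hG : MemL2X P X G)
    (k : ℕ) : ∫⁻ ω, ‖Dhat P X p k F ω - Dhat P X p k G ω‖ₑ ^ 2 ∂P =
      ∫⁻ ω, ‖D P X k F ω - D P X k G ω‖ₑ ^ 2 ∂P := by
  have h := lintegral_enorm_D_sq hX (hF.sub hG) k
  have h1 := lintegral_congr_ae ((D_sub_ae_eq hF hG k).fun_comp fun x => ‖x‖ₑ ^ 2)
  have h2 := lintegral_congr_ae ((Dhat_sub_ae_eq hX hF hG k).fun_comp fun x => ‖x‖ₑ ^ 2)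
  exact h2.symm.trans (h.symm.trans h1)

/-- Integrating out `Y_k²`. -/
theorem integral_mul_Y_sq {k : ℕ} {A : Ω → ℝ} (hA : AEStronglyMeasurable[exceptSigma X k] A P)
    (hAi : Integrable A P) :
    Integrable (fun ω => A ω * Y X p k ω ^ 2) P ∧
      ∫ ω, A ω * Y X p k ω ^ 2 ∂P = ∫ ω, A ω ∂P := by
  have h := (IsSplit.self hA).mul (isSplit_Y_sq k hX)
  have hp := (hX.pos k).ne'
  have hq := (hX.sub_pos k).ne'
  refine ⟨(h.integrable_iff hX).2 ⟨hAi.mul_const _, hAi.mul_const _⟩, ?_⟩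
  rw [h.integral_eq hX (hAi.mul_const _) (hAi.mul_const _), integral_mul_const,
    integral_mul_const]
  field_simp
  ring

theorem integral_D_mul_D {F G : Ω → ℝ} (hF : MemL2X P X F) (hG : MemL2X P X G) (k : ℕ) :
    ∫ ω, D P X k F ω * D P X k G ω ∂P = ∫ ω, Dhat P X p k F ω * Dhat P X p k G ω ∂P := by
  refine Eq.trans (integral_congr_ae ?_) (integral_mul_Y_sq hX ((aestronglyMeasurable_Dhat hF.1 k).mul
    (aestronglyMeasurable_Dhat hG.1 k)) ((hF.Dhat hX k).2.integrable_mul (hG.Dhat hX k).2)).2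
  filter_upwards [D_ae_eq_Y_mul_Dhat hX hF k, D_ae_eq_Y_mul_Dhat hX hG k] with ω h1 h2
  rw [h1, h2]
  simp only [Pi.mul_apply]; ring

end
end RademacherStein
-- Conditional expectations on `L²` as a projection system.
namespace RademacherStein
noncomputable section
variable {Ω : Type*} [mΩ : MeasurableSpace Ω] {P : Measure Ω} {X : ℕ → Ω → ℝ} {p : ℕ → ℝ}

section Lp
open scoped InnerProductSpace

/-- The conditional expectation as an operator on `L²`. -/
def condExpLp {Ω : Type*} {m : MeasurableSpace Ω} [mΩ : MeasurableSpace Ω] (P : Measure Ω) (hm : m ≤ mΩ) :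
    Lp ℝ 2 P →L[ℝ] Lp ℝ 2 P :=
  (lpMeas ℝ ℝ m 2 P).subtypeL ∘L condExpL2 ℝ ℝ hm

theorem coeFn_condExpLp {Ω : Type*} {m : MeasurableSpace Ω} [mΩ : MeasurableSpace Ω]
    {P : Measure Ω} [IsFiniteMeasure P] (hm : m ≤ mΩ) (x : Lp ℝ 2 P) :
    condExpLp P hm x =ᵐ[P] P[x | m] := by
  have h := (Lp.memLp x).condExpL2_ae_eq_condExp (𝕜 := ℝ) hm
  rwa [Lp.toLp_coeFn] at h

theorem inner_condExpLp {Ω : Type*} {m : MeasurableSpace Ω} [mΩ : MeasurableSpace Ω]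
    (P : Measure Ω) (hm : m ≤ mΩ) (x y : Lp ℝ 2 P) :
    ⟪condExpLp P hm x, y⟫_ℝ = ⟪x, condExpLp P hm y⟫_ℝ :=
  inner_condExpL2_left_eq_right (E := ℝ) (𝕜 := ℝ) hm

theorem inner_eq_integral {x y : Lp ℝ 2 P} {F G : Ω → ℝ} (hF : x =ᵐ[P] F) (hG : y =ᵐ[P] G) :
    ⟪x, y⟫_ℝ = ∫ ω, F ω * G ω ∂P := by
  rw [L2.inner_def]
  refine integral_congr_ae ?_
  filter_upwards [hF, hG] with ω h1 h2
  rw [h1, h2]; simp [mul_comm]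

theorem ofReal_norm_sq {x : Lp ℝ 2 P} {F : Ω → ℝ} (hF : x =ᵐ[P] F) :
    ENNReal.ofReal (‖x‖ ^ 2) = ∫⁻ ω, ‖F ω‖ₑ ^ 2 ∂P := by
  have h := eLpNorm_nnreal_pow_eq_lintegral (f := F) (μ := P) (p := 2) two_ne_zero
  simp only [NNReal.coe_ofNat, ENNReal.rpow_ofNat, ENNReal.coe_ofNat] at h
  rw [← h, ← eLpNorm_congr_ae hF, Lp.norm_def, ENNReal.ofReal_pow ENNReal.toReal_nonneg,
    ENNReal.ofReal_toReal (Lp.eLpNorm_ne_top x)]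

namespace IsRademacherSeq
variable (hX : IsRademacherSeq P X p)

/-- The conditional expectation given the coordinates in `M`, as an operator on `L²`. -/
def proj (M : Set ℕ) : Lp ℝ 2 P →L[ℝ] Lp ℝ 2 P := condExpLp P (hX.sigmaOf_le M)

variable [IsProbabilityMeasure P]

theorem coeFn_proj (M : Set ℕ) {x : Lp ℝ 2 P} {F : Ω → ℝ} (hF : x =ᵐ[P] F) :
    hX.proj M x =ᵐ[P] P[F | sigmaOf X M] :=
  (coeFn_condExpLp _ x).trans (condExp_congr_ae hF)

theorem proj_proj (M N : Set ℕ) (x : Lp ℝ 2 P) :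
    hX.proj N (hX.proj M x) = hX.proj (M ∩ N) x :=
  Lp.ext <| (hX.coeFn_proj N (hX.coeFn_proj M EventuallyEq.rfl)).trans <|
    (hX.condExp_condExp_sigmaOf M N).trans (hX.coeFn_proj _ EventuallyEq.rfl).symm

theorem isProjectionSystem :
    IsProjectionSystem (fun n => hX.proj {j | j < n}) (fun k => hX.proj {j | j ≠ k}) where
  symm_left _ := inner_condExpLp P _
  symm_right _ := inner_condExpLp P _
  comp_of_le n m x h := by
    rw [hX.proj_proj]
    congr 2; ext j; simp only [Set.mem_inter_iff, Set.mem_ofPred_eq]; omega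
  comp_of_ge n m x h := by
    rw [hX.proj_proj]
    congr 2; ext j; simp only [Set.mem_inter_iff, Set.mem_ofPred_eq]; omega
  idem k x := by rw [hX.proj_proj, Set.inter_self]
  comm n k x := by rw [hX.proj_proj, hX.proj_proj, Set.inter_comm]
  comp_succ k x := by
    rw [hX.proj_proj]
    congr 2; ext j; simp only [Set.mem_inter_iff, Set.mem_ofPred_eq]; omega

theorem coeFn_sub_proj (k : ℕ) {x : Lp ℝ 2 P} {F : Ω → ℝ} (hF : x =ᵐ[P] F) :
    ⇑(x - hX.proj {j | j ≠ k} x) =ᵐ[P] D P X k F := by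
  filter_upwards [Lp.coeFn_sub x (hX.proj {j | j ≠ k} x), hX.coeFn_proj {j | j ≠ k} hF, hF]
    with ω h1 h2 h3
  rw [h1, Pi.sub_apply, h2, h3]; rfl

/-- Lévy's upward theorem gives almost sure convergence. With Fatou and contractivity the norms
converge too, and Pythagoras turns this into convergence in `L²`. -/
theorem tendsto_proj {x : Lp ℝ 2 P} (hx : AEStronglyMeasurable[sigmaOf X Set.univ] x P) :
    Tendsto (fun n => hX.proj {j | j < n} x) atTop (𝓝 x) := by
  have hsys := hX.isProjectionSystem
  let ℱ : Filtration ℕ mΩ :=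
    { seq := fun n => pastSigma X n
      mono' := fun n m hnm => sigmaOf_mono fun j (hj : j < n) => hj.trans_le hnm
      le' := fun n => hX.sigmaOf_le _ }
  have hsup : (⨆ n, ℱ n) = sigmaOf X Set.univ := by
    refine le_antisymm (iSup_le fun n => sigmaOf_mono (Set.subset_univ _)) (iSup₂_le fun j _ => ?_)
    exact le_iSup_of_le (j + 1) (measurable_sigmaOf (M := {i | i < j + 1})
      (Nat.lt_succ_self j)).comap_le
  have hlim : ∀ᵐ ω ∂P, Tendsto (fun n => hX.proj {j | j < n} x ω) atTop (𝓝 (x ω)) := by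
    have h1 := tendsto_ae_condExp (μ := P) (ℱ := ℱ) x
    rw [hsup] at h1
    have h2 := condExp_of_aestronglyMeasurable' (hX.sigmaOf_le Set.univ) hx
      ((Lp.memLp x).integrable (by norm_num))
    have h3 : ∀ᵐ ω ∂P, ∀ n, hX.proj {j | j < n} x ω = (P[x | pastSigma X n]) ω :=
      ae_all_iff.2 fun n => hX.coeFn_proj {j | j < n} EventuallyEq.rfl
    filter_upwards [h1, h2, h3] with ω h1 h2 h3
    rw [h2] at h1
    simpa only [h3] using h1
  have hliminf := Lp.eLpNorm_lim_le_liminf_eLpNorm (p := 2) (μ := P)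
    (fun n => (Lp.aestronglyMeasurable (hX.proj {j | j < n} x))) x hlim
  have hle : ∀ n, eLpNorm (hX.proj {j | j < n} x) 2 P ≤ eLpNorm x 2 P := fun n => by
    have := hsys.norm_left_le n x
    rwa [Lp.norm_def, Lp.norm_def, ENNReal.toReal_le_toReal (Lp.eLpNorm_ne_top _)
      (Lp.eLpNorm_ne_top _)] at this
  have hnorm : Tendsto (fun n => ‖hX.proj {j | j < n} x‖) atTop (𝓝 ‖x‖) := by
    simp only [Lp.norm_def]
    refine (ENNReal.tendsto_toReal (Lp.eLpNorm_ne_top x)).comp ?_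
    exact tendsto_of_le_liminf_of_limsup_le hliminf
      (limsup_le_of_le (h := Eventually.of_forall hle))
  have hsq : ∀ n, ‖hX.proj {j | j < n} x - x‖ = √(‖x‖ ^ 2 - ‖hX.proj {j | j < n} x‖ ^ 2) :=
    fun n => by
      have := norm_sq_proj_add (hsys.symm_left n) (fun x => hsys.comp_of_le n n x le_rfl) x
      rw [← this, add_sub_cancel_left, Real.sqrt_sq (norm_nonneg _), norm_sub_rev]
  rw [tendsto_iff_norm_sub_tendsto_zero]
  simp only [hsq]
  have := ((hnorm.pow 2).const_sub (‖x‖ ^ 2)).sqrt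
  simpa using this

theorem proj_zero_eq_zero_iff {x : Lp ℝ 2 P} :
    hX.proj {j | j < 0} x = 0 ↔ ∫ ω, x ω ∂P = 0 := by
  have hbot : sigmaOf X {j | j < 0} = ⊥ := by simp [sigmaOf]
  have h := hX.coeFn_proj {j | j < 0} (x := x) EventuallyEq.rfl
  rw [hbot, condExp_bot] at h
  constructor
  · intro h0
    rw [h0] at h
    have h1 : ∀ᵐ ω ∂P, (0 : ℝ) = ∫ ω, x ω ∂P := by
      filter_upwards [h, Lp.coeFn_zero ℝ 2 P] with ω h1 h2
      rw [← h1, h2]; rfl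
    obtain ⟨ω, hω⟩ := h1.exists
    exact hω.symm
  · intro h0
    refine Lp.ext (h.trans ?_)
    filter_upwards [Lp.coeFn_zero ℝ 2 P] with ω h2
    rw [h2, h0]; rfl

/-- The converse of `tendsto_proj`; it shows that the Hilbert space solution of `L G = F` is a
functional of `X`. -/
theorem aestronglyMeasurable_of_tendsto_proj {x : Lp ℝ 2 P}
    (hx : Tendsto (fun n => hX.proj {j | j < n} x) atTop (𝓝 x)) :
    AEStronglyMeasurable[sigmaOf X Set.univ] x P := by
  have h1 : Tendsto (fun n => hX.proj Set.univ (hX.proj {j | j < n} x)) atTop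
      (𝓝 (hX.proj Set.univ x)) := ((hX.proj Set.univ).continuous.tendsto x).comp hx
  simp only [hX.proj_proj, Set.inter_univ] at h1
  have h2 := tendsto_nhds_unique hx h1
  have h3 := hX.coeFn_proj Set.univ (x := x) EventuallyEq.rfl
  rw [← h2] at h3
  exact stronglyMeasurable_condExp.aestronglyMeasurable.congr h3.symm

theorem summable_iff {F : Ω → ℝ} {x : Lp ℝ 2 P} (hF : x =ᵐ[P] F) :
    (Summable fun k => ‖x - hX.proj {j | j ≠ k} x‖ ^ 2) ↔
      ∑' k, ∫⁻ ω, ‖D P X k F ω‖ₑ ^ 2 ∂P < ∞ := by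
  simp only [← fun k => ofReal_norm_sq (hX.coeFn_sub_proj k hF)]
  constructor
  · exact fun h => h.tsum_ofReal_lt_top
  · intro h
    have := ENNReal.summable_toReal h.ne
    simpa only [ENNReal.toReal_ofReal (sq_nonneg _)] using this

end IsRademacherSeq
end Lp
end
end RademacherStein
-- Identification of the closures, and the two representing processes.
namespace RademacherStein
noncomputable section
variable {Ω : Type*} [mΩ : MeasurableSpace Ω] {P : Measure Ω} {X : ℕ → Ω → ℝ} {p : ℕ → ℝ}

theorem lintegral_enorm_sub_sq_le {f g h : Ω → ℝ} (hf : AEStronglyMeasurable f P)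
    (hg : AEStronglyMeasurable g P) :
    ∫⁻ ω, ‖f ω - h ω‖ₑ ^ 2 ∂P ≤
      2 * ∫⁻ ω, ‖g ω - f ω‖ₑ ^ 2 ∂P + 2 * ∫⁻ ω, ‖g ω - h ω‖ₑ ^ 2 ∂P := by
  have hm : AEMeasurable (fun ω => ‖g ω - f ω‖ₑ ^ 2) P := (hg.sub hf).enorm.pow_const 2
  rw [← lintegral_const_mul'' _ hm, ← lintegral_const_mul' _ _ ENNReal.ofNat_ne_top,
    ← lintegral_add_left' (hm.const_mul 2)]
  refine lintegral_mono fun ω => ?_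
  have e : ∀ c : ℝ, ‖c‖ₑ ^ 2 = ENNReal.ofReal (c ^ 2) := fun c => by
    rw [← ofReal_norm, ← ENNReal.ofReal_pow (norm_nonneg _), Real.norm_eq_abs, sq_abs]
  simp only [e]
  rw [← ENNReal.ofReal_ofNat 2, ← ENNReal.ofReal_mul (by norm_num),
    ← ENNReal.ofReal_mul (by norm_num), ← ENNReal.ofReal_add (by positivity) (by positivity)]
  exact ENNReal.ofReal_le_ofReal (by nlinarith [sq_nonneg (g ω - f ω + (g ω - h ω))])

namespace IsRademacherSeq
variable [IsProbabilityMeasure P] (hX : IsRademacherSeq P X p)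
include hX

theorem lintegral_enorm_D_sub_sq_le {F G : Ω → ℝ} (hF : MemL2X P X F) (hG : MemL2X P X G)
    (k : ℕ) : ∫⁻ ω, ‖D P X k F ω - D P X k G ω‖ₑ ^ 2 ∂P ≤ ∫⁻ ω, ‖F ω - G ω‖ₑ ^ 2 ∂P := by
  have hsys := hX.isProjectionSystem
  have hx := (hF.sub hG).2.coeFn_toLp
  have h1 := lintegral_congr_ae ((D_sub_ae_eq hF hG k).fun_comp fun x => ‖x‖ₑ ^ 2)
  refine h1.symm.le.trans ?_
  rw [← ofReal_norm_sq hx]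
  refine (ofReal_norm_sq (hX.coeFn_sub_proj k hx)).symm.le.trans (ENNReal.ofReal_le_ofReal ?_)
  have := norm_sub_proj_le (hsys.symm_right k) (hsys.idem k) ((hF.sub hG).2.toLp _)
  gcongr

theorem tendsto_condExp_past {F : Ω → ℝ} (hF : MemL2X P X F)
    (hs : ∑' k, ∫⁻ ω, ‖D P X k F ω‖ₑ ^ 2 ∂P < ∞) :
    Tendsto (fun n => ∫⁻ ω, ‖(P[F | pastSigma X n]) ω - F ω‖ₑ ^ 2 ∂P) atTop (𝓝 0) ∧
    Tendsto (fun n => ∑' k, ∫⁻ ω, ‖D P X k (P[F | pastSigma X n]) ω - D P X k F ω‖ₑ ^ 2 ∂P)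
      atTop (𝓝 0) := by
  have hsys := hX.isProjectionSystem
  have hx := hF.2.coeFn_toLp
  set x := hF.2.toLp F
  have hxt := hX.tendsto_proj (x := x) (hF.1.congr hx.symm)
  have hsum := (hX.summable_iff hx).2 hs
  have hn : ∀ n, hX.proj {j | j < n} x =ᵐ[P] P[F | pastSigma X n] := fun n => hX.coeFn_proj _ hx
  constructor
  · have h1 : ∀ n, ⇑(hX.proj {j | j < n} x - x) =ᵐ[P] fun ω => (P[F | pastSigma X n]) ω - F ω :=
      fun n => by
        filter_upwards [Lp.coeFn_sub (hX.proj {j | j < n} x) x, hn n, hx] with ω h1 h2 h3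
        rw [h1, Pi.sub_apply, h2, h3]
    simp only [← fun n => ofReal_norm_sq (h1 n)]
    rw [← ENNReal.ofReal_zero]
    refine ENNReal.tendsto_ofReal ?_
    simpa using (tendsto_iff_norm_sub_tendsto_zero.1 hxt).pow 2
  · have h1 : ∀ n k, ⇑((hX.proj {j | j < n} x - hX.proj {j | j ≠ k} (hX.proj {j | j < n} x)) -
        (x - hX.proj {j | j ≠ k} x)) =ᵐ[P]
        fun ω => D P X k (P[F | pastSigma X n]) ω - D P X k F ω := fun n k => by
      filter_upwards [Lp.coeFn_sub (hX.proj {j | j < n} x -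
        hX.proj {j | j ≠ k} (hX.proj {j | j < n} x)) (x - hX.proj {j | j ≠ k} x),
        hX.coeFn_sub_proj k (hn n), hX.coeFn_sub_proj k hx] with ω h1 h2 h3
      rw [h1, Pi.sub_apply, h2, h3]
    simp only [← fun n k => ofReal_norm_sq (h1 n k)]
    have h2 : ∀ n, Summable fun k => ‖(hX.proj {j | j < n} x -
        hX.proj {j | j ≠ k} (hX.proj {j | j < n} x)) - (x - hX.proj {j | j ≠ k} x)‖ ^ 2 :=
      fun n => hsum.of_nonneg_of_le (fun _ => sq_nonneg _) fun k => by
        have := hsys.norm_sub_left_le n k x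
        gcongr
    simp only [← fun n => ENNReal.ofReal_tsum_of_nonneg (fun _ => sq_nonneg _) (h2 n)]
    rw [← ENNReal.ofReal_zero]
    exact ENNReal.tendsto_ofReal (hsys.tendsto_tsum_norm_sub hxt hsum)

/-- The closure of a family of operators which is isometric to `D` is the maximal operator. -/
theorem isClosureOn_iff {T : ℕ → (Ω → ℝ) → Ω → ℝ} (hT : ∀ k F, MemL2X P X F → MemL2X P X (T k F))
    (hTn : ∀ k F, MemL2X P X F → ∫⁻ ω, ‖D P X k F ω‖ₑ ^ 2 ∂P = ∫⁻ ω, ‖T k F ω‖ₑ ^ 2 ∂P)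
    (hTs : ∀ k F G, MemL2X P X F → MemL2X P X G → ∫⁻ ω, ‖T k F ω - T k G ω‖ₑ ^ 2 ∂P =
      ∫⁻ ω, ‖D P X k F ω - D P X k G ω‖ₑ ^ 2 ∂P) {F : Ω → ℝ} {V : ℕ → Ω → ℝ} :
    IsClosureOn P X T F V ↔
      MemL2X P X F ∧ (∀ k, V k =ᵐ[P] T k F) ∧ ∑' k, ∫⁻ ω, ‖D P X k F ω‖ₑ ^ 2 ∂P < ∞ := by
  constructor
  · rintro ⟨hF, hV, S, hS, hSF, hSV⟩
    have hSX : ∀ n, MemL2X P X (S n) := fun n => by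
      obtain ⟨⟨m, hm⟩, h2⟩ := hS n
      exact ⟨hm.mono (sigmaOf_mono (Set.subset_univ _)), h2⟩
    -- Every single `T k` inherits from `D` the contraction property, so the limit process is
    -- determined coordinate by coordinate; this contains closability.
    have hVT : ∀ k, V k =ᵐ[P] T k F := fun k => by
      have hVm := (hV.1 k).2.1
      have hTm := (hT k F hF).2.1
      have hle : ∀ n, ∫⁻ ω, ‖V k ω - T k F ω‖ₑ ^ 2 ∂P ≤
          2 * (∑' k, ∫⁻ ω, ‖T k (S n) ω - V k ω‖ₑ ^ 2 ∂P) + 2 * ∫⁻ ω, ‖S n ω - F ω‖ₑ ^ 2 ∂P :=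
        fun n => by
          refine (lintegral_enorm_sub_sq_le (g := T k (S n)) hVm (hT k _ (hSX n)).2.1).trans ?_
          refine add_le_add (mul_le_mul' le_rfl ?_) (mul_le_mul' le_rfl ?_)
          · exact ENNReal.le_tsum (f := fun k => ∫⁻ ω, ‖T k (S n) ω - V k ω‖ₑ ^ 2 ∂P) k
          · rw [hTs k _ _ (hSX n) hF]
            exact hX.lintegral_enorm_D_sub_sq_le (hSX n) hF k
      have hlim : Tendsto (fun n => 2 * (∑' k, ∫⁻ ω, ‖T k (S n) ω - V k ω‖ₑ ^ 2 ∂P) +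
          2 * ∫⁻ ω, ‖S n ω - F ω‖ₑ ^ 2 ∂P) atTop (𝓝 0) := by
        have := (ENNReal.Tendsto.const_mul hSV (.inr (ENNReal.ofNat_ne_top (n := 2)))).add
          (ENNReal.Tendsto.const_mul hSF (.inr (ENNReal.ofNat_ne_top (n := 2))))
        simpa using this
      have h0 : ∫⁻ ω, ‖V k ω - T k F ω‖ₑ ^ 2 ∂P = 0 :=
        le_antisymm (ge_of_tendsto' hlim hle) zero_le
      have hm : AEMeasurable (fun ω => ‖V k ω - T k F ω‖ₑ ^ 2) P := (hVm.sub hTm).enorm.pow_const 2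
      rw [lintegral_eq_zero_iff' hm] at h0
      filter_upwards [h0] with ω hω
      simpa [sub_eq_zero] using hω
    refine ⟨hF, hVT, ?_⟩
    have e : ∀ k, ∫⁻ ω, ‖D P X k F ω‖ₑ ^ 2 ∂P = ∫⁻ ω, ‖V k ω‖ₑ ^ 2 ∂P := fun k => by
      rw [hTn k F hF]
      exact (lintegral_congr_ae ((hVT k).fun_comp fun x => ‖x‖ₑ ^ 2)).symm
    simp only [e]
    exact hV.2
  · rintro ⟨hF, hVT, hs⟩
    obtain ⟨h1, h2⟩ := hX.tendsto_condExp_past hF hs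
    have hcyl : ∀ n, IsCylindrical P X (P[F | pastSigma X n]) := fun n =>
      ⟨⟨n, stronglyMeasurable_condExp.aestronglyMeasurable⟩, hF.2.condExp one_le_two⟩
    have hSX : ∀ n, MemL2X P X (P[F | pastSigma X n]) := fun n =>
      ⟨stronglyMeasurable_condExp.aestronglyMeasurable.mono (sigmaOf_mono (Set.subset_univ _)),
        hF.2.condExp one_le_two⟩
    refine ⟨hF, ⟨fun k => (hT k F hF).congr_ae (hVT k).symm, ?_⟩, _, hcyl, h1, ?_⟩
    · have e : ∀ k, ∫⁻ ω, ‖V k ω‖ₑ ^ 2 ∂P = ∫⁻ ω, ‖D P X k F ω‖ₑ ^ 2 ∂P := fun k => by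
        rw [hTn k F hF]
        exact lintegral_congr_ae ((hVT k).fun_comp fun x => ‖x‖ₑ ^ 2)
      simp only [e]
      exact hs
    · refine h2.congr fun n => tsum_congr fun k => ?_
      rw [← hTs k _ _ (hSX n) hF]
      refine lintegral_congr_ae ?_
      filter_upwards [hVT k] with ω hω
      rw [hω]

theorem isClosureOn_D_iff {F : Ω → ℝ} {V : ℕ → Ω → ℝ} :
    IsClosureOn P X (D P X) F V ↔
      MemL2X P X F ∧ (∀ k, V k =ᵐ[P] D P X k F) ∧ ∑' k, ∫⁻ ω, ‖D P X k F ω‖ₑ ^ 2 ∂P < ∞ :=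
  hX.isClosureOn_iff (fun k _ h => h.D k) (fun _ _ _ => rfl) fun _ _ _ _ _ => rfl

theorem isClosureOn_Dhat_iff {F : Ω → ℝ} {V : ℕ → Ω → ℝ} :
    IsClosureOn P X (Dhat P X p) F V ↔
      MemL2X P X F ∧ (∀ k, V k =ᵐ[P] Dhat P X p k F) ∧
        ∑' k, ∫⁻ ω, ‖D P X k F ω‖ₑ ^ 2 ∂P < ∞ :=
  hX.isClosureOn_iff (fun k _ h => h.Dhat hX k) (fun k _ h => lintegral_enorm_D_sq hX h k)
    fun k _ _ h h' => lintegral_enorm_Dhat_sub_sq hX h h' k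

theorem memDomD_iff {F : Ω → ℝ} : MemDomD P X F ↔
    MemL2X P X F ∧ ∑' k, ∫⁻ ω, ‖Dhat P X p k F ω‖ₑ ^ 2 ∂P < ∞ := by
  constructor
  · rintro ⟨V, hV⟩
    obtain ⟨h1, -, h2⟩ := hX.isClosureOn_D_iff.1 hV
    simp only [lintegral_enorm_D_sq hX h1] at h2
    exact ⟨h1, h2⟩
  · rintro ⟨h1, h2⟩
    simp only [← lintegral_enorm_D_sq hX h1] at h2
    exact ⟨_, hX.isClosureOn_D_iff.2 ⟨h1, fun _ => EventuallyEq.rfl, h2⟩⟩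

theorem memDomDhat_iff_memDomD {F : Ω → ℝ} : MemDomDhat P X p F ↔ MemDomD P X F := by
  constructor
  · rintro ⟨V, hV⟩
    obtain ⟨h1, -, h2⟩ := hX.isClosureOn_Dhat_iff.1 hV
    exact ⟨_, hX.isClosureOn_D_iff.2 ⟨h1, fun _ => EventuallyEq.rfl, h2⟩⟩
  · rintro ⟨V, hV⟩
    obtain ⟨h1, -, h2⟩ := hX.isClosureOn_D_iff.1 hV
    exact ⟨_, hX.isClosureOn_Dhat_iff.2 ⟨h1, fun _ => EventuallyEq.rfl, h2⟩⟩

end IsRademacherSeq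

/-- The processes `A` which represent `F` by `E[F H] = ∑ E[A_k D̂_k H]`. -/
structure IsRepresenting (P : Measure Ω) (X : ℕ → Ω → ℝ) (p : ℕ → ℝ) (F : Ω → ℝ)
    (A : ℕ → Ω → ℝ) : Prop where
  aestronglyMeasurable : ∀ k, AEStronglyMeasurable[exceptSigma X k] (A k) P
  memLp : ∀ k, MemLp (A k) 2 P
  sum_lt_top : ∑' k, ∫⁻ ω, ‖A k ω‖ₑ ^ 2 ∂P < ∞
  integral_mul : ∀ H, MemDomD P X H →
    ∑' k, ∫ ω, A k ω * Dhat P X p k H ω ∂P = ∫ ω, F ω * H ω ∂P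

section Existence
open scoped InnerProductSpace
variable [IsProbabilityMeasure P] (hX : IsRademacherSeq P X p)
include hX

theorem exists_isPseudoInverse {F : Ω → ℝ} (hF : MemL2X P X F) (hF0 : ∫ ω, F ω ∂P = 0) :
    ∃ G, IsPseudoInverse P X F G := by
  have hsys := hX.isProjectionSystem
  have hx := hF.neg.2.coeFn_toLp
  set x := hF.neg.2.toLp (-F)
  have hxt := hX.tendsto_proj (x := x) (hF.neg.1.congr hx.symm)
  have hx0 : hX.proj {j | j < 0} x = 0 := by
    rw [hX.proj_zero_eq_zero_iff, integral_congr_ae hx, integral_neg', hF0, neg_zero]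
  obtain ⟨g, hg, hg0, hgs, hgi⟩ := hsys.exists_pseudoInverse hxt hx0
  have hgX : MemL2X P X g := ⟨hX.aestronglyMeasurable_of_tendsto_proj hg, Lp.memLp g⟩
  have hgD := (hX.summable_iff (F := g) EventuallyEq.rfl).1 hgs
  refine ⟨g, ⟨fun k => D P X k g,
    hX.isClosureOn_D_iff.2 ⟨hgX, fun _ => EventuallyEq.rfl, hgD⟩,
    ⟨fun k => hgX.D k, hgD⟩, hF.neg, fun H W hHW => ?_⟩, hX.proj_zero_eq_zero_iff.1 hg0⟩
  obtain ⟨hH, hW, hHs⟩ := hX.isClosureOn_D_iff.1 hHW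
  have hy := hH.2.coeFn_toLp
  set y := hH.2.toLp H
  have h1 := hgi y (hX.tendsto_proj (hH.1.congr hy.symm)) ((hX.summable_iff hy).2 hHs)
  rw [inner_eq_integral hy hx] at h1
  rw [← h1]
  refine tsum_congr fun k => ?_
  rw [inner_eq_integral (hX.coeFn_sub_proj k hy) (hX.coeFn_sub_proj k (F := g) EventuallyEq.rfl)]
  refine integral_congr_ae ?_
  filter_upwards [hW k] with ω h
  rw [h]

/-- From `δ D G = -F`, duality gives `E[F H] = -∑ E[D_k G D_k H]`; the isometry replaces `D` by
`Dhat`, and the sign goes into `-G`. -/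
theorem IsPseudoInverse.isRepresenting {F G : Ω → ℝ} (hG : IsPseudoInverse P X F G) :
    IsRepresenting P X p F (fun k => Dhat P X p k (-G)) := by
  obtain ⟨⟨V, hGV, hVd⟩, -⟩ := hG
  obtain ⟨hGX, hV, hGs⟩ := hX.isClosureOn_D_iff.1 hGV
  have hn : ∀ k, ∫⁻ ω, ‖Dhat P X p k (-G) ω‖ₑ ^ 2 ∂P = ∫⁻ ω, ‖D P X k G ω‖ₑ ^ 2 ∂P := fun k => by
    rw [lintegral_enorm_D_sq hX hGX]
    refine lintegral_congr_ae ?_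
    filter_upwards [Dhat_neg_ae_eq hX hGX k] with ω h
    rw [h, enorm_neg]
  refine ⟨fun k => aestronglyMeasurable_Dhat hGX.neg.1 k, fun k => (hGX.neg.Dhat hX k).2, ?_,
    fun H hH => ?_⟩
  · simp only [hn]; exact hGs
  · obtain ⟨W, hHW⟩ := hH
    obtain ⟨hHX, hW, hHs⟩ := hX.isClosureOn_D_iff.1 hHW
    have h1 := hVd.2.2 H W hHW
    have h2 : ∫ ω, F ω * H ω ∂P = -∫ ω, H ω * (-F) ω ∂P := by
      rw [← integral_neg]; congr 1; ext ω; simp [mul_comm]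
    rw [h2, ← h1, ← tsum_neg]
    refine tsum_congr fun k => ?_
    have h3 : ∫ ω, W k ω * V k ω ∂P = ∫ ω, D P X k G ω * D P X k H ω ∂P := by
      refine integral_congr_ae ?_
      filter_upwards [hV k, hW k] with ω h1 h2
      rw [h1, h2, mul_comm]
    rw [h3, integral_D_mul_D hX hGX hHX, ← integral_neg]
    refine integral_congr_ae ?_
    filter_upwards [Dhat_neg_ae_eq hX hGX k] with ω h
    rw [h, neg_mul]

theorem clarkOcone_isRepresenting {F : Ω → ℝ} (hF : MemDomD P X F) (hF0 : ∫ ω, F ω ∂P = 0) :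
    IsRepresenting P X p F (fun k => P[Dhat P X p k F | pastSigma X k]) := by
  have hsys := hX.isProjectionSystem
  obtain ⟨hFX, hFs⟩ := hX.memDomD_iff.1 hF
  have hpast : ∀ k, pastSigma X k ≤ exceptSigma X k := fun k =>
    sigmaOf_mono fun j (hj : j < k) => hj.ne
  have hAm : ∀ k, AEStronglyMeasurable[exceptSigma X k] (P[Dhat P X p k F | pastSigma X k]) P :=
    fun k => (stronglyMeasurable_condExp.mono (hpast k)).aestronglyMeasurable
  have hAL : ∀ k, MemLp (P[Dhat P X p k F | pastSigma X k]) 2 P := fun k =>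
    (hFX.Dhat hX k).2.condExp one_le_two
  refine ⟨hAm, hAL, lt_of_le_of_lt (ENNReal.tsum_le_tsum fun k => ?_) hFs, fun H hH => ?_⟩
  · have hd := (hFX.Dhat hX k).2.coeFn_toLp
    rw [← ofReal_norm_sq hd, ← ofReal_norm_sq (hX.coeFn_proj {j | j < k} hd)]
    have := hsys.norm_left_le k ((hFX.Dhat hX k).2.toLp _)
    exact ENNReal.ofReal_le_ofReal (by gcongr)
  · obtain ⟨hHX, hHs⟩ := hX.memDomD_iff.1 hH
    simp only [← lintegral_enorm_D_sq hX hHX] at hHs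
    have hx := hFX.2.coeFn_toLp
    set x := hFX.2.toLp F
    have hy := hHX.2.coeFn_toLp
    set y := hHX.2.toLp H
    have hx0 : hX.proj {j | j < 0} x = 0 := by
      rw [hX.proj_zero_eq_zero_iff, integral_congr_ae hx, hF0]
    have h1 := hsys.hasSum_clarkOcone (hX.tendsto_proj (hFX.1.congr hx.symm)) hx0
      ((hX.summable_iff hy).2 hHs)
    rw [inner_eq_integral hx hy] at h1
    rw [← h1.tsum_eq]
    refine tsum_congr fun k => ?_
    rw [inner_eq_integral (hX.coeFn_proj {j | j < k + 1} (hX.coeFn_sub_proj k hx))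
      (hX.coeFn_sub_proj k hy)]
    have hYm : AEStronglyMeasurable[pastSigma X (k + 1)] (Y X p k) P := by
      refine (Measurable.stronglyMeasurable ?_).aestronglyMeasurable
      have : Measurable[pastSigma X (k + 1)] (X k) :=
        measurable_sigmaOf (M := {j | j < k + 1}) (Nat.lt_succ_self k)
      exact ((this.add_const _).sub_const _).div_const _
    have hDi := (hFX.Dhat hX k).integrable
    have hYD : Integrable (Y X p k * Dhat P X p k F) P :=
      (hFX.D k).integrable.congr (D_ae_eq_Y_mul_Dhat hX hFX k)
    -- With indices from zero, `pastSigma X (k + 1)` includes the `k`-th coordinate, so `Y_k` can be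
    -- taken out. What remains does not depend on that coordinate, so conditioning drops to
    -- `pastSigma X k`.
    have h2 : P[D P X k F | pastSigma X (k + 1)] =ᵐ[P]
        Y X p k * P[Dhat P X p k F | pastSigma X k] := by
      refine (condExp_congr_ae (D_ae_eq_Y_mul_Dhat hX hFX k)).trans
        ((condExp_mul_of_aestronglyMeasurable_left hYm hYD hDi).trans ?_)
      have h3 := hX.condExp_sigmaOf_inter {j | j < k + 1} (aestronglyMeasurable_Dhat hFX.1 k) hDi
      have h4 : {j | j ≠ k} ∩ {j | j < k + 1} = {j | j < k} := by
        ext j; simp only [Set.mem_inter_iff, Set.mem_ofPred_eq]; omega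
      rw [h4] at h3
      exact EventuallyEq.rfl.mul h3
    refine (integral_mul_Y_sq hX ((hAm k).mul (aestronglyMeasurable_Dhat hHX.1 k))
      ((hAL k).integrable_mul (hHX.Dhat hX k).2)).2.symm.trans (integral_congr_ae ?_)
    filter_upwards [h2, D_ae_eq_Y_mul_Dhat hX hHX k] with ω h5 h6
    rw [h5, h6]
    simp only [Pi.mul_apply]; ring

end Existence
end
end RademacherStein
-- The Stein estimate for representing processes, and the Wasserstein bound.
namespace RademacherStein
noncomputable section
variable {Ω : Type*} [mΩ : MeasurableSpace Ω] {P : Measure Ω} {X : ℕ → Ω → ℝ} {p : ℕ → ℝ}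

section Series
variable {W : ℕ → Ω → ℝ} (hW : ∀ k, AEStronglyMeasurable (W k) P)
  (hs : ∑' k, ∫⁻ ω, ‖W k ω‖ₑ ∂P < ∞)
include hW hs

theorem ae_summable_of_tsum_lintegral : ∀ᵐ ω ∂P, Summable fun k => W k ω := by
  have := summable_norm_of_tsum_eLpNorm_ne_top le_rfl hW (by
    simpa only [eLpNorm_one_eq_lintegral_enorm] using hs.ne)
  exact this.mono fun ω h => h.of_norm

theorem integrable_tsum_of_tsum_lintegral : Integrable (fun ω => ∑' k, W k ω) P := by
  refine ⟨aestronglyMeasurable_of_tendsto_ae atTop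
    (f := fun n ω => ∑ k ∈ Finset.range n, W k ω)
    (fun n => Finset.aestronglyMeasurable_fun_sum _ fun k _ => hW k) ?_, ?_⟩
  · filter_upwards [ae_summable_of_tsum_lintegral hW hs] with ω h
    exact h.hasSum.tendsto_sum_nat
  · refine lt_of_le_of_lt (lintegral_mono fun ω => enorm_tsum_le_tsum_enorm) ?_
    rwa [lintegral_tsum fun k => (hW k).enorm]

theorem integral_mul_tsum {φ : Ω → ℝ} (hφ : AEStronglyMeasurable φ P) {C : ℝ}
    (hC : ∀ ω, |φ ω| ≤ C) :
    (∀ k, Integrable (fun ω => φ ω * W k ω) P) ∧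
    Summable (fun k => ∫ ω, φ ω * W k ω ∂P) ∧
      ∫ ω, φ ω * ∑' k, W k ω ∂P = ∑' k, ∫ ω, φ ω * W k ω ∂P := by
  have hle : ∀ k, ∫⁻ ω, ‖φ ω * W k ω‖ₑ ∂P ≤ ENNReal.ofReal C * ∫⁻ ω, ‖W k ω‖ₑ ∂P := fun k => by
    rw [← lintegral_const_mul' _ _ ENNReal.ofReal_ne_top]
    refine lintegral_mono fun ω => ?_
    rw [enorm_mul, Real.enorm_eq_ofReal_abs (φ ω)]
    gcongr
    exact hC ω
  have hsum : ∑' k, ∫⁻ ω, ‖φ ω * W k ω‖ₑ ∂P < ∞ :=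
    lt_of_le_of_lt (ENNReal.tsum_le_tsum hle) (by
      rw [ENNReal.tsum_mul_left]; exact ENNReal.mul_lt_top ENNReal.ofReal_lt_top hs)
  refine ⟨fun k => ⟨hφ.mul (hW k), lt_of_le_of_lt (ENNReal.le_tsum k) hsum⟩, ?_, ?_⟩
  · refine Summable.of_enorm (ne_of_lt (lt_of_le_of_lt (ENNReal.tsum_le_tsum fun k => ?_) hsum))
    exact enorm_integral_le_lintegral_enorm _
  · have h := integral_tsum (f := fun k ω => φ ω * W k ω) (fun k => hφ.mul (hW k)) hsum.ne
    rw [← h]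
    simp only [tsum_mul_left]

end Series

theorem tsum_lintegral_mul_lt_top {A B : ℕ → Ω → ℝ} (hBm : ∀ k, AEStronglyMeasurable (B k) P)
    (hA : ∑' k, ∫⁻ ω, ‖A k ω‖ₑ ^ 2 ∂P < ∞) (hB : ∑' k, ∫⁻ ω, ‖B k ω‖ₑ ^ 2 ∂P < ∞) :
    ∑' k, ∫⁻ ω, ‖A k ω‖ₑ * ‖B k ω‖ₑ ∂P < ∞ := by
  refine lt_of_le_of_lt (ENNReal.tsum_le_tsum fun k => ?_)
    (by rw [ENNReal.tsum_add]; exact ENNReal.add_lt_top.2 ⟨hA, hB⟩)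
  rw [← lintegral_add_right' _ ((hBm k).enorm.pow_const 2)]
  refine lintegral_mono fun ω => ?_
  rcases le_total ‖A k ω‖ₑ ‖B k ω‖ₑ with h | h
  · calc _ ≤ ‖B k ω‖ₑ * ‖B k ω‖ₑ := by gcongr
      _ ≤ _ := by rw [← sq]; exact le_add_self
  · calc _ ≤ ‖A k ω‖ₑ * ‖A k ω‖ₑ := by gcongr
      _ ≤ _ := by rw [← sq]; exact le_self_add

section Bounds
variable [IsProbabilityMeasure P] (hX : IsRademacherSeq P X p)
include hX

/-- `D̂_k` is a difference operator, so composing with `f` costs at most a factor `K`. This admits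
`f(F)` as test functional in the representation without a chain rule. -/
theorem MemDomD.comp_lipschitz {F : Ω → ℝ} (hF : MemDomD P X F) {f : ℝ → ℝ} {K : ℝ≥0}
    (hf : LipschitzWith K f) : MemDomD P X (fun ω => f (F ω)) := by
  obtain ⟨hFX, hFs⟩ := hX.memDomD_iff.1 hF
  have hm : AEStronglyMeasurable[sigmaOf X Set.univ] (fun ω => f (F ω)) P :=
    hf.continuous.comp_aestronglyMeasurable hFX.1
  refine hX.memDomD_iff.2 ⟨⟨hm, ?_⟩, ?_⟩
  · have hb1 : MemLp (fun _ : Ω => |f 0|) 2 P := memLp_const _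
    have hb2 : MemLp (fun ω => (K : ℝ) * ‖F ω‖) 2 P := hFX.2.norm.const_mul _
    have hb : MemLp (fun ω => |f 0| + K * ‖F ω‖) 2 P := hb1.add hb2
    refine hb.of_le (hf.continuous.comp_aestronglyMeasurable hFX.2.1) (ae_of_all _ fun ω => ?_)
    have h1 := hf.dist_le_mul (F ω) 0
    rw [Real.dist_eq, Real.dist_eq, sub_zero] at h1
    have h2 := abs_sub_abs_le_abs_sub (f (F ω)) (f 0)
    have h3 : 0 ≤ |f 0| + K * ‖F ω‖ := by positivity
    rw [Real.norm_of_nonneg h3, Real.norm_eq_abs, Real.norm_eq_abs]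
    linarith
  · have hle : ∀ k, ∫⁻ ω, ‖Dhat P X p k (fun ω => f (F ω)) ω‖ₑ ^ 2 ∂P ≤
        (K : ℝ≥0∞) ^ 2 * ∫⁻ ω, ‖Dhat P X p k F ω‖ₑ ^ 2 ∂P := fun k => by
      rw [← lintegral_const_mul' _ _ (by simp)]
      have hspl := isSplit_representative hFX.1 k
      refine lintegral_mono_ae ?_
      filter_upwards [(hspl.comp hf.continuous.measurable).Dhat_ae_eq hX hm] with ω h
      rw [h, Dhat, ← mul_pow]
      refine pow_le_pow_left' ?_ 2
      rw [enorm_mul, enorm_mul, mul_left_comm]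
      refine mul_le_mul' le_rfl ?_
      have h1 := hf.edist_le_mul (representative P X F (Function.update (fun n => X n ω) k 1))
        (representative P X F (Function.update (fun n => X n ω) k (-1)))
      rwa [edist_eq_enorm_sub, edist_eq_enorm_sub] at h1
    refine lt_of_le_of_lt (ENNReal.tsum_le_tsum hle) ?_
    rw [ENNReal.tsum_mul_left]
    exact ENNReal.mul_lt_top (by simp [ENNReal.pow_lt_top_iff]) hFs

variable {F : Ω → ℝ} {A : ℕ → Ω → ℝ} (hF : MemDomD P X F) (hA : IsRepresenting P X p F A)
include hF hA

/-- The factor `Y_k²` integrates to one independently of the others, which leaves a sum of products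
of two square-summable processes. -/
theorem tsum_lintegral_mul_Y_sq_lt_top :
    ∑' k, ∫⁻ ω, ‖A k ω * Dhat P X p k F ω * Y X p k ω ^ 2‖ₑ ∂P < ∞ := by
  obtain ⟨hFX, hFs⟩ := hX.memDomD_iff.1 hF
  refine lt_of_le_of_lt (ENNReal.tsum_le_tsum fun k => le_of_eq ?_) (tsum_lintegral_mul_lt_top
    (fun k => (hFX.Dhat hX k).2.1) hA.sum_lt_top hFs)
  have hm : AEStronglyMeasurable[exceptSigma X k] (fun ω => ‖(A k * Dhat P X p k F) ω‖) P :=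
    continuous_norm.comp_aestronglyMeasurable
      ((hA.aestronglyMeasurable k).mul (aestronglyMeasurable_Dhat (p := p) hFX.1 k))
  have hi : Integrable (fun ω => ‖(A k * Dhat P X p k F) ω‖) P :=
    ((hA.memLp k).integrable_mul (hFX.Dhat hX k).2).norm
  obtain ⟨h1, h2⟩ := integral_mul_Y_sq hX hm hi
  have h3 := congrArg ENNReal.ofReal h2
  rw [ofReal_integral_eq_lintegral_ofReal hi (ae_of_all _ fun _ => norm_nonneg _),
    ofReal_integral_eq_lintegral_ofReal h1 (ae_of_all _ fun _ => by positivity)] at h3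
  have e1 : ∀ ω, ‖A k ω * Dhat P X p k F ω * Y X p k ω ^ 2‖ₑ =
      ENNReal.ofReal (‖(A k * Dhat P X p k F) ω‖ * Y X p k ω ^ 2) := fun ω => by
    rw [← ofReal_norm, norm_mul, Real.norm_of_nonneg (sq_nonneg (Y X p k ω))]; rfl
  simp only [e1, h3]
  refine lintegral_congr fun ω => ?_
  rw [ofReal_norm, Pi.mul_apply, enorm_mul]

theorem aestronglyMeasurable_mul_Y_sq (k : ℕ) :
    AEStronglyMeasurable (fun ω => A k ω * Dhat P X p k F ω * Y X p k ω ^ 2) P :=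
  (((IsSplit.self (hA.aestronglyMeasurable k)).mul
    (IsSplit.self (aestronglyMeasurable_Dhat (hX.memDomD_iff.1 hF).1.1 k))).mul
    (isSplit_Y_sq k hX)).aestronglyMeasurable hX

theorem isSplit_mul_Y (k : ℕ) : IsSplit P X k
    (fun ω => √(p k * (1 - p k)) * (|A k ω| * Dhat P X p k F ω) * Y X p k ω)
    (fun ω => √(p k * (1 - p k)) * (|A k ω| * Dhat P X p k F ω) *
      ((1 - p k) / √(p k * (1 - p k))))
    (fun ω => √(p k * (1 - p k)) * (|A k ω| * Dhat P X p k F ω) *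
      -(p k / √(p k * (1 - p k)))) :=
  (IsSplit.self (A := fun ω => √(p k * (1 - p k)) * (|A k ω| * Dhat P X p k F ω))
    (((continuous_abs.comp_aestronglyMeasurable (hA.aestronglyMeasurable k)).mul
      (aestronglyMeasurable_Dhat (hX.memDomD_iff.1 hF).1.1 k)).const_mul _)).mul (isSplit_Y k)

theorem tsum_lintegral_mul_Y_lt_top :
    ∑' k, ∫⁻ ω, ‖√(p k * (1 - p k)) * (|A k ω| * Dhat P X p k F ω) * Y X p k ω‖ₑ ∂P < ∞ := by
  obtain ⟨hFX, hFs⟩ := hX.memDomD_iff.1 hF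
  have hAB := tsum_lintegral_mul_lt_top (fun k => (hFX.Dhat hX k).2.1) hA.sum_lt_top hFs
  refine lt_of_le_of_lt (ENNReal.tsum_le_tsum fun k => ?_)
    (by
      rw [ENNReal.tsum_add]
      exact ENNReal.add_lt_top.2 ⟨hAB, tsum_lintegral_mul_Y_sq_lt_top hX hF hA⟩)
  rw [← lintegral_add_right' _ (aestronglyMeasurable_mul_Y_sq hX hF hA k).enorm]
  refine lintegral_mono fun ω => ?_
  have hs : √(p k * (1 - p k)) ≤ 1 := by
    -- With `√(pq) ≤ 1` and `|Y| ≤ 1 + Y²`, the sum is dominated by the one without `Y` plus the one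
    -- with `Y²`.
    refine Real.sqrt_le_iff.2 ⟨zero_le_one, ?_⟩
    nlinarith [hX.pos k, hX.sub_pos k]
  have hy : |Y X p k ω| ≤ 1 + Y X p k ω ^ 2 := by
    nlinarith [sq_abs (Y X p k ω), sq_nonneg (|Y X p k ω| - 1), abs_nonneg (Y X p k ω)]
  rw [← enorm_mul, ← ofReal_norm, ← ofReal_norm, ← ofReal_norm,
    ← ENNReal.ofReal_add (norm_nonneg _) (norm_nonneg _)]
  refine ENNReal.ofReal_le_ofReal ?_
  simp only [norm_mul, Real.norm_eq_abs, abs_abs, abs_pow, sq_abs,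
    abs_of_nonneg (Real.sqrt_nonneg _)]
  calc _ ≤ 1 * (|A k ω| * |Dhat P X p k F ω|) * (1 + Y X p k ω ^ 2) := by gcongr
    _ = _ := by ring

theorem IsRepresenting.seriesConverge : SeriesConverge P X p A (fun k => Dhat P X p k F) :=
  ⟨ae_summable_of_tsum_lintegral (aestronglyMeasurable_mul_Y_sq hX hF hA)
    (tsum_lintegral_mul_Y_sq_lt_top hX hF hA),
  ae_summable_of_tsum_lintegral (fun k => (isSplit_mul_Y hX hF hA k).aestronglyMeasurable hX)
    (tsum_lintegral_mul_Y_lt_top hX hF hA)⟩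

/-- The bound behind Stein's method: here `f'` is a version of the derivative of `f`. -/
theorem enorm_integral_sub_le {U V : ℕ → Ω → ℝ} (hUV : ∀ k, IsSplit P X k F (U k) (V k))
    {f f' : ℝ → ℝ} {K : ℝ≥0} (hf : LipschitzWith K f) (hf' : Measurable f') {C : ℝ}
    (hC : ∀ x, |f' x| ≤ C) :
    ‖∫ ω, f' (F ω) ∂P - ∫ ω, F ω * f (F ω) ∂P‖ₑ ≤
      ENNReal.ofReal C * ∫⁻ ω, ‖1 - ∑' k, A k ω * Dhat P X p k F ω * Y X p k ω ^ 2‖ₑ ∂P +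
      ∑' k, ∫⁻ ω, ‖√(p k * (1 - p k)) * A k ω * (f (U k ω) - f (V k ω) - (U k ω - V k ω) *
        ((1 - p k) * f' (U k ω) + p k * f' (V k ω)))‖ₑ ∂P := by
  obtain ⟨hFX, hFs⟩ := hX.memDomD_iff.1 hF
  have hH := hF.comp_lipschitz hX hf
  obtain ⟨hHX, hHs⟩ := hX.memDomD_iff.1 hH
  set H : Ω → ℝ := fun ω => f (F ω) with hHdef
  have hB : ∀ k, Dhat P X p k F =ᵐ[P] fun ω => √(p k * (1 - p k)) * (U k ω - V k ω) :=
    fun k => (hUV k).Dhat_ae_eq hX hFX.1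
  have hDH : ∀ k, Dhat P X p k H =ᵐ[P] fun ω => √(p k * (1 - p k)) * (f (U k ω) - f (V k ω)) :=
    fun k => ((hUV k).comp hf.continuous.measurable).Dhat_ae_eq hX hHX.1
  have hφm : AEStronglyMeasurable (fun ω => f' (F ω)) P :=
    (hf'.comp_aemeasurable hFX.2.1.aemeasurable).aestronglyMeasurable
  have hφi : Integrable (fun ω => f' (F ω)) P :=
    Integrable.of_bound hφm C (ae_of_all _ fun ω => hC _)
  have hWm := aestronglyMeasurable_mul_Y_sq hX hF hA
  have hWs := tsum_lintegral_mul_Y_sq_lt_top hX hF hA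
  obtain ⟨hi1, hs1, he1⟩ := integral_mul_tsum hWm hWs hφm fun ω => hC _
  have hSi := integrable_tsum_of_tsum_lintegral hWm hWs
  -- the representation of `E[F f(F)]`
  have hi2 : ∀ k, Integrable (fun ω => A k ω * Dhat P X p k H ω) P := fun k =>
    (hA.memLp k).integrable_mul (hHX.Dhat hX k).2
  have hs2 : Summable fun k => ∫ ω, A k ω * Dhat P X p k H ω ∂P := by
    refine Summable.of_enorm (ne_of_lt (lt_of_le_of_lt (ENNReal.tsum_le_tsum fun k => ?_)
      (tsum_lintegral_mul_lt_top (fun k => (hHX.Dhat hX k).2.1) hA.sum_lt_top hHs)))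
    have := enorm_integral_le_lintegral_enorm (μ := P) fun ω => A k ω * Dhat P X p k H ω
    simpa only [enorm_mul] using this
  have he2 := hA.integral_mul H hH
  -- the difference of the two series, term by term
  have hterm : ∀ k, ∫ ω, A k ω * Dhat P X p k H ω ∂P -
      ∫ ω, f' (F ω) * (A k ω * Dhat P X p k F ω * Y X p k ω ^ 2) ∂P =
      ∫ ω, √(p k * (1 - p k)) * A k ω * (f (U k ω) - f (V k ω) - (U k ω - V k ω) *
        ((1 - p k) * f' (U k ω) + p k * f' (V k ω))) ∂P := fun k => by
    have hspl := ((hUV k).comp hf').mul (((IsSplit.self (hA.aestronglyMeasurable k)).mul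
      (IsSplit.self (aestronglyMeasurable_Dhat (p := p) hFX.1 k))).mul (isSplit_Y_sq k hX))
    obtain ⟨hiU, hiV⟩ := (hspl.integrable_iff hX).1 (hi1 k)
    rw [hspl.integral_eq hX hiU hiV, ← integral_const_mul, ← integral_const_mul,
      ← integral_add (hiU.const_mul _) (hiV.const_mul _)]
    refine (integral_sub (hi2 k) ((hiU.const_mul _).add (hiV.const_mul _))).symm.trans
      (integral_congr_ae ?_)
    filter_upwards [hB k, hDH k] with ω h1 h2
    have hp := (hX.pos k).ne'
    have hq := (hX.sub_pos k).ne'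
    simp only [Pi.add_apply, h1, h2]
    field_simp
  have hmain : ∫ ω, f' (F ω) ∂P - ∫ ω, F ω * f (F ω) ∂P =
      ∫ ω, f' (F ω) * (1 - ∑' k, A k ω * Dhat P X p k F ω * Y X p k ω ^ 2) ∂P -
      ∑' k, ∫ ω, √(p k * (1 - p k)) * A k ω * (f (U k ω) - f (V k ω) - (U k ω - V k ω) *
        ((1 - p k) * f' (U k ω) + p k * f' (V k ω))) ∂P := by
    have h3 : Integrable (fun ω => f' (F ω) *
        ∑' k, A k ω * Dhat P X p k F ω * Y X p k ω ^ 2) P :=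
      hSi.bdd_mul hφm (ae_of_all _ fun ω => hC (F ω))
    simp only [← hterm]
    rw [hs2.tsum_sub hs1, he2, ← he1]
    simp only [mul_sub, mul_one]
    rw [integral_sub hφi h3]
    ring
  rw [hmain]
  refine enorm_sub_le.trans (add_le_add ?_ ?_)
  · refine (enorm_integral_le_lintegral_enorm _).trans ?_
    rw [← lintegral_const_mul' _ _ ENNReal.ofReal_ne_top]
    refine lintegral_mono fun ω => ?_
    rw [enorm_mul, Real.enorm_eq_ofReal_abs (f' _)]
    gcongr
    exact hC _
  · exact enorm_tsum_le_tsum_enorm.trans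
      (ENNReal.tsum_le_tsum fun k => enorm_integral_le_lintegral_enorm _)

/-- Taking `f` as the Stein solution of a Lipschitz function, the defect is at most `(p² + q²)(U -
V)²`. Here `p² + q² = 1 - 2pq` and `(D̂_k F)² = pq (U - V)²`, so the prefactor `√(pq)` becomes the
weight `(1 - 2pq)/√(pq)`. -/
theorem IsRepresenting.dW_le :
    dW (P.map F) (gaussianReal 0 1) ≤ boundW P X p A (fun k => Dhat P X p k F) := by
  obtain ⟨hFX, hFs⟩ := hX.memDomD_iff.1 hF
  refine iSup₂_le fun h hh => ?_
  obtain ⟨f, f', hff', hC, hf'L, hst⟩ := exists_stein_solution_lipschitz hh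
  have hfL : LipschitzWith (Real.toNNReal √(2 / Real.pi)) f := by
    refine lipschitzWith_of_nnnorm_deriv_le (fun x => (hff' x).differentiableAt) fun x => ?_
    rw [(hff' x).deriv, ← NNReal.coe_le_coe, Real.coe_toNNReal _ (Real.sqrt_nonneg _)]
    exact hC x
  have hf'm := hf'L.continuous.measurable
  have hφi : Integrable (fun ω => f' (F ω)) P :=
    Integrable.of_bound (hf'm.comp_aemeasurable hFX.2.1.aemeasurable).aestronglyMeasurable _
      (ae_of_all _ fun ω => hC _)
  have hFf : Integrable (fun ω => F ω * f (F ω)) P :=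
    hFX.2.integrable_mul (hX.memDomD_iff.1 (hF.comp_lipschitz hX hfL)).1.2
  have hhi : Integrable (fun ω => h (F ω)) P :=
    (hX.memDomD_iff.1 (hF.comp_lipschitz hX hh)).1.integrable
  have e : ∫ x, h x ∂(P.map F) - ∫ x, h x ∂(gaussianReal 0 1) =
      ∫ ω, f' (F ω) ∂P - ∫ ω, F ω * f (F ω) ∂P := by
    rw [integral_map hFX.2.1.aemeasurable hh.continuous.aestronglyMeasurable,
      ← integral_sub hφi hFf]
    simp only [hst]
    rw [integral_sub hhi (integrable_const _)]
    simp
  rw [e, ← Real.enorm_eq_ofReal_abs]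
  refine (enorm_integral_sub_le hX hF hA (fun k => isSplit_representative hFX.1 k) hfL hf'm
    hC).trans (add_le_add le_rfl (ENNReal.tsum_le_tsum fun k => ?_))
  rw [← lintegral_const_mul' _ _ ENNReal.ofReal_ne_top]
  refine lintegral_mono fun ω => ?_
  set u := representative P X F (Function.update (fun n => X n ω) k 1)
  set v := representative P X F (Function.update (fun n => X n ω) k (-1))
  have hexp := two_point_expansion_lipschitz (p := p k) hff' hf'L v u
  have hs := hX.sqrt_pos k
  have hsq := hX.sq_sqrt k
  have hD : Dhat P X p k F ω = √(p k * (1 - p k)) * (u - v) := rfl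
  have hc : 0 ≤ (1 - 2 * p k * (1 - p k)) / √(p k * (1 - p k)) :=
    div_nonneg (by nlinarith [sq_nonneg (p k), sq_nonneg (1 - p k)]) hs.le
  rw [← enorm_pow, ← enorm_mul, ← ofReal_norm, ← ofReal_norm, ← ENNReal.ofReal_mul hc]
  refine ENNReal.ofReal_le_ofReal ?_
  rw [norm_mul, norm_mul, norm_mul, Real.norm_of_nonneg hs.le, norm_pow, Real.norm_eq_abs,
    Real.norm_eq_abs, Real.norm_eq_abs, sq_abs]
  simp only [hD, mul_pow, hsq]
  calc _ ≤ √(p k * (1 - p k)) * |A k ω| * ((p k ^ 2 + (1 - p k) ^ 2) * (u - v) ^ 2) := by gcongr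
    _ = _ := by
      rw [div_mul_eq_mul_div, eq_div_iff hs.ne']
      linear_combination (|A k ω| * (p k ^ 2 + (1 - p k) ^ 2) * (u - v) ^ 2) * hsq

end Bounds
end
end RademacherStein
-- The Kolmogorov bound.
namespace RademacherStein
noncomputable section
variable {Ω : Type*} [mΩ : MeasurableSpace Ω] {P : Measure Ω} {X : ℕ → Ω → ℝ} {p : ℕ → ℝ}
  [IsProbabilityMeasure P] (hX : IsRademacherSeq P X p)
  {F : Ω → ℝ} {A : ℕ → Ω → ℝ} (hF : MemDomD P X F) (hA : IsRepresenting P X p F A)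
include hX hF hA

/-- The remainder of the expansion of a Stein solution, for indicator test functions: here `M` is
a bounded monotone function. -/
theorem lintegral_mul_increment_le {M : ℝ → ℝ} (hM : Monotone M) (hM2 : ∀ x y, M x - M y ≤ 2)
    {C : ℝ} (hMC : ∀ x, |M x| ≤ C) {k : ℕ} {U V : Ω → ℝ} (hUV : IsSplit P X k F U V) {R : Ω → ℝ}
    (hR : ∀ ω, |R ω| ≤ max (p k) (1 - p k) * ((U ω - V ω) * (M (U ω) - M (V ω)))) :
    0 ≤ ∫ ω, M (F ω) * (√(p k * (1 - p k)) * (|A k ω| * Dhat P X p k F ω) * Y X p k ω) ∂P ∧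
    ∫⁻ ω, ‖√(p k * (1 - p k)) * A k ω * R ω‖ₑ ∂P ≤
      ENNReal.ofReal (2 * ∫ ω, M (F ω) *
        (√(p k * (1 - p k)) * (|A k ω| * Dhat P X p k F ω) * Y X p k ω) ∂P) +
      2 * (ENNReal.ofReal |p k - (1 - p k)| * ∫⁻ ω, ‖A k ω‖ₑ * ‖Dhat P X p k F ω‖ₑ ∂P) := by
  obtain ⟨hFX, hFs⟩ := hX.memDomD_iff.1 hF
  have hp := hX.pos k
  have hq := hX.sub_pos k
  have hs := hX.sqrt_pos k
  have hsplM := hUV.comp hM.measurable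
  have hspl := hsplM.mul (isSplit_mul_Y hX hF hA k)
  have hi := (integral_mul_tsum
    (fun k => (isSplit_mul_Y hX hF hA k).aestronglyMeasurable hX)
    (tsum_lintegral_mul_Y_lt_top hX hF hA) (hsplM.aestronglyMeasurable hX) fun ω => hMC _).1 k
  obtain ⟨hiU, hiV⟩ := (hspl.integrable_iff hX).1 hi
  -- The remainder is at most `max(p, q) T`. On the other hand, averaging the `M(F)`-weighted series
  -- term over `X_k` gives exactly `pq T`, since `√(pq) Y_k` takes the values `q` and `-p`.
  let T : Ω → ℝ := fun ω => |A k ω| * (√(p k * (1 - p k)) * (U ω - V ω) * (M (U ω) - M (V ω)))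
  have hMUV : ∀ ω, 0 ≤ (U ω - V ω) * (M (U ω) - M (V ω)) := fun ω => by
    rcases le_total (U ω) (V ω) with h | h
    · exact mul_nonneg_of_nonpos_of_nonpos (sub_nonpos.2 h) (sub_nonpos.2 (hM h))
    · exact mul_nonneg (sub_nonneg.2 h) (sub_nonneg.2 (hM h))
  have hT0 : ∀ ω, 0 ≤ T ω := fun ω => by
    have := hMUV ω
    have : T ω = |A k ω| * (√(p k * (1 - p k)) * ((U ω - V ω) * (M (U ω) - M (V ω)))) := by
      simp only [T]; ring
    rw [this]; positivity
  have hB := hUV.Dhat_ae_eq hX hFX.1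
  have hTae : (fun ω => p k * (M (U ω) * (√(p k * (1 - p k)) * (|A k ω| * Dhat P X p k F ω) *
      ((1 - p k) / √(p k * (1 - p k))))) + (1 - p k) * (M (V ω) *
      (√(p k * (1 - p k)) * (|A k ω| * Dhat P X p k F ω) * -(p k / √(p k * (1 - p k)))))) =ᵐ[P]
      fun ω => p k * (1 - p k) * T ω := by
    filter_upwards [hB] with ω h
    simp only [T, h]
    field_simp
    ring
  have hint : Integrable (fun ω => p k * (1 - p k) * T ω) P :=
    ((hiU.const_mul (p k)).add (hiV.const_mul (1 - p k))).congr hTae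
  have hI : ∫ ω, M (F ω) * (√(p k * (1 - p k)) * (|A k ω| * Dhat P X p k F ω) * Y X p k ω) ∂P =
      ∫ ω, p k * (1 - p k) * T ω ∂P := by
    rw [hspl.integral_eq hX hiU hiV, ← integral_const_mul, ← integral_const_mul]
    exact (integral_add (hiU.const_mul _) (hiV.const_mul _)).symm.trans (integral_congr_ae hTae)
  have hpq : 0 ≤ p k * (1 - p k) := (mul_pos hp hq).le
  refine ⟨by rw [hI]; exact integral_nonneg fun ω => mul_nonneg hpq (hT0 ω), ?_⟩
  rw [hI, ← integral_const_mul, ofReal_integral_eq_lintegral_ofReal (hint.const_mul 2)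
      (ae_of_all _ fun ω => mul_nonneg zero_le_two (mul_nonneg hpq (hT0 ω))),
    ← lintegral_const_mul' _ _ ENNReal.ofReal_ne_top,
    ← lintegral_const_mul' _ _ ENNReal.ofNat_ne_top,
    ← lintegral_add_left' (hint.const_mul 2).1.aemeasurable.ennreal_ofReal]
  refine lintegral_mono_ae ?_
  filter_upwards [hB] with ω hω
  have hT2 : T ω ≤ 2 * (|A k ω| * |Dhat P X p k F ω|) := by
    have h1 : (U ω - V ω) * (M (U ω) - M (V ω)) ≤ |U ω - V ω| * 2 := by
      refine (le_abs_self _).trans ?_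
      rw [abs_mul]
      refine mul_le_mul_of_nonneg_left ?_ (abs_nonneg _)
      rw [abs_le]
      exact ⟨by linarith [hM2 (V ω) (U ω)], hM2 _ _⟩
    rw [hω, abs_mul, abs_of_pos hs]
    calc T ω = |A k ω| * (√(p k * (1 - p k)) * ((U ω - V ω) * (M (U ω) - M (V ω)))) := by
          simp only [T]; ring
      _ ≤ |A k ω| * (√(p k * (1 - p k)) * (|U ω - V ω| * 2)) := by gcongr
      _ = _ := by ring
  -- The part `2pq T` is twice the averaged series term; in the part with `|p - q|`, `T` is bounded
  -- crudely using that `M` oscillates by at most 2.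
  have hmax : max (p k) (1 - p k) ≤ 2 * (p k * (1 - p k)) + |p k - (1 - p k)| := by
    rcases le_total (p k) (1 - p k) with h | h
    · rw [max_eq_right h, abs_of_nonpos (sub_nonpos.2 h)]; nlinarith
    · rw [max_eq_left h, abs_of_nonneg (sub_nonneg.2 h)]; nlinarith
  rw [← enorm_mul, ← ofReal_norm, ← ofReal_norm, ← ENNReal.ofReal_mul (abs_nonneg _),
    ← ENNReal.ofReal_ofNat 2, ← ENNReal.ofReal_mul (by norm_num),
    ← ENNReal.ofReal_add (mul_nonneg zero_le_two (mul_nonneg hpq (hT0 ω))) (by positivity)]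
  refine ENNReal.ofReal_le_ofReal ?_
  rw [norm_mul, norm_mul, norm_mul, Real.norm_of_nonneg hs.le, Real.norm_eq_abs, Real.norm_eq_abs,
    Real.norm_eq_abs]
  calc _ ≤ √(p k * (1 - p k)) * |A k ω| *
        (max (p k) (1 - p k) * ((U ω - V ω) * (M (U ω) - M (V ω)))) := by gcongr; exact hR ω
    _ = max (p k) (1 - p k) * T ω := by simp only [T]; ring
    _ ≤ (2 * (p k * (1 - p k)) + |p k - (1 - p k)|) * T ω :=
      mul_le_mul_of_nonneg_right hmax (hT0 ω)
    _ = 2 * (p k * (1 - p k) * T ω) + |p k - (1 - p k)| * T ω := by ring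
    _ ≤ 2 * (p k * (1 - p k) * T ω) +
        |p k - (1 - p k)| * (2 * (|A k ω| * |Dhat P X p k F ω|)) := by gcongr
    _ = _ := by ring

/-- The factor 4 is the product of the 2 in front of the averaged series term and the bound `|M| ≤
2`. Summing before taking absolute values keeps the whole series inside the expectation. -/
theorem IsRepresenting.dK_le :
    dK (P.map F) (gaussianReal 0 1) ≤ boundK P X p A (fun k => Dhat P X p k F) := by
  obtain ⟨hFX, hFs⟩ := hX.memDomD_iff.1 hF
  refine iSup_le fun z => ?_
  obtain ⟨f, g, hfg, hgm, hgb, hmv⟩ := exists_stein_solution_Iic z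
  have hFm := hFX.2.1.aemeasurable
  let ι : ℝ → ℝ := (Set.Iic z).indicator 1
  have hιm : Measurable ι := measurable_one.indicator measurableSet_Iic
  have hι : ∀ x, 0 ≤ ι x ∧ ι x ≤ 1 := fun x =>
    ⟨Set.indicator_nonneg (fun _ _ => zero_le_one) x,
      Set.indicator_le_self' (fun _ _ => zero_le_one) x⟩
  have hιa : Antitone ι := fun a b hab => by
    by_cases hb : b ≤ z
    · simp [ι, hb, hab.trans hb]
    · simpa [ι, hb] using (hι a).1
  let f' : ℝ → ℝ := fun x => g x + ι x - gcdf z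
  have hf'm : Measurable f' := (hgm.measurable.add hιm).sub_const _
  have hC : ∀ x, |f' x| ≤ 1 := fun x => by
    have h1 := hgb x
    have h2 := hι x
    rw [abs_le]
    exact ⟨by simp only [f']; linarith, by simp only [f']; linarith⟩
  have hfL : LipschitzWith 1 f := by
    refine LipschitzWith.of_le_add fun x y => ?_
    rw [Real.dist_eq]
    rcases le_total x y with h | h
    · rw [abs_of_nonpos (sub_nonpos.2 h)]
      have h1 := (hmv x y h).1
      have h2 : (y - x) * (-1) ≤ (y - x) * (g x + ι y - gcdf z) :=
        mul_le_mul_of_nonneg_left (by linarith [hgb x, hι y]) (sub_nonneg.2 h)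
      linarith
    · rw [abs_of_nonneg (sub_nonneg.2 h)]
      have h1 := (hmv y x h).2
      have h2 : (x - y) * (g x + ι y - gcdf z) ≤ (x - y) * 1 :=
        mul_le_mul_of_nonneg_left (by linarith [hgb x, hι y]) (sub_nonneg.2 h)
      linarith
  let M : ℝ → ℝ := fun x => g x - ι x
  have hMm : Monotone M := fun a b hab => sub_le_sub (hgm hab) (hιa hab)
  have hM2 : ∀ x y, M x - M y ≤ 2 := fun x y => by
    simp only [M]; linarith [hgb x, hgb y, hι x, hι y]
  have hMC : ∀ x, |M x| ≤ 2 := fun x => by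
    have h1 := gcdf_pos z
    have h2 := gcdf_pos (-z)
    have h3 := gcdf_add_gcdf_neg z
    rw [abs_le]; simp only [M]
    constructor <;> linarith [hgb x, hι x]
  have hφi : Integrable (fun ω => f' (F ω)) P :=
    Integrable.of_bound (hf'm.comp_aemeasurable hFm).aestronglyMeasurable _
      (ae_of_all _ fun ω => hC _)
  have hFf : Integrable (fun ω => F ω * f (F ω)) P :=
    hFX.2.integrable_mul (hX.memDomD_iff.1 (hF.comp_lipschitz hX hfL)).1.2
  have hιi : Integrable (fun ω => ι (F ω)) P :=
    Integrable.of_bound (hιm.comp_aemeasurable hFm).aestronglyMeasurable 1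
      (ae_of_all _ fun ω => by rw [Real.norm_of_nonneg (hι _).1]; exact (hι _).2)
  have e : (P.map F).real (Set.Iic z) - (gaussianReal 0 1).real (Set.Iic z) =
      ∫ ω, f' (F ω) ∂P - ∫ ω, F ω * f (F ω) ∂P := by
    rw [gaussianReal_real_Iic, ← integral_indicator_one measurableSet_Iic,
      integral_map hFm hιm.aestronglyMeasurable, ← integral_sub hφi hFf]
    have : ∀ ω, f' (F ω) - F ω * f (F ω) = ι (F ω) - gcdf z := fun ω => by
      rw [hfg]; simp only [f']; ring
    simp only [this]
    rw [integral_sub hιi (integrable_const _)]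
    simp [ι]
  rw [e, ← Real.enorm_eq_ofReal_abs]
  have hUV := fun k => isSplit_representative hFX.1 k
  refine (enorm_integral_sub_le hX hF hA hUV hfL hf'm hC).trans ?_
  have hk := fun k => lintegral_mul_increment_le hX hF hA hMm hM2 hMC (hUV k)
    (R := fun ω => f (representative P X F (Function.update (fun n => X n ω) k 1)) -
      f (representative P X F (Function.update (fun n => X n ω) k (-1))) -
      (representative P X F (Function.update (fun n => X n ω) k 1) -
        representative P X F (Function.update (fun n => X n ω) k (-1))) *
      ((1 - p k) * f' (representative P X F (Function.update (fun n => X n ω) k 1)) +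
        p k * f' (representative P X F (Function.update (fun n => X n ω) k (-1)))))
    fun ω => two_point_expansion_Iic (hX.pos k).le (hX.lt_one k).le hgm hιa hmv _ _
  rw [ENNReal.ofReal_one, one_mul, boundK, add_assoc]
  refine add_le_add le_rfl ((ENNReal.tsum_le_tsum fun k => (hk k).2).trans ?_)
  rw [ENNReal.tsum_add, ENNReal.tsum_mul_left, add_comm]
  refine add_le_add le_rfl ?_
  have hWm := fun k => (isSplit_mul_Y hX hF hA k).aestronglyMeasurable hX
  have hWs := tsum_lintegral_mul_Y_lt_top hX hF hA
  obtain ⟨-, hs1, he1⟩ := integral_mul_tsum hWm hWs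
    (hMm.measurable.comp_aemeasurable hFm).aestronglyMeasurable fun ω => hMC (F ω)
  -- Monotonicity of `M` makes every summand nonnegative, so the extended sum is the `ofReal` of a
  -- real one and equals `2 E[M(F) ∑ …]`.
  rw [← ENNReal.ofReal_tsum_of_nonneg (fun k => mul_nonneg zero_le_two (hk k).1)
    (hs1.mul_left 2), tsum_mul_left]
  refine (ENNReal.ofReal_le_ofReal (le_abs_self _)).trans ?_
  rw [← Real.enorm_eq_ofReal_abs]
  have he2 : ∑' k, ∫ ω, M (F ω) *
      (√(p k * (1 - p k)) * (|A k ω| * Dhat P X p k F ω) * Y X p k ω) ∂P =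
      ∫ ω, M (F ω) * ∑' k,
        √(p k * (1 - p k)) * (|A k ω| * Dhat P X p k F ω) * Y X p k ω ∂P := he1.symm
  rw [he2, enorm_mul, Real.enorm_eq_ofReal_abs 2, abs_two, ENNReal.ofReal_ofNat]
  calc _ ≤ 2 * ∫⁻ ω, ‖M (F ω) * ∑' k,
        √(p k * (1 - p k)) * (|A k ω| * Dhat P X p k F ω) * Y X p k ω‖ₑ ∂P := by
        gcongr; exact enorm_integral_le_lintegral_enorm _
    _ ≤ 2 * ∫⁻ ω, 2 * ‖∑' k,
        √(p k * (1 - p k)) * (|A k ω| * Dhat P X p k F ω) * Y X p k ω‖ₑ ∂P := by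
        gcongr with ω
        rw [enorm_mul, Real.enorm_eq_ofReal_abs (M _), ← ENNReal.ofReal_ofNat 2]
        gcongr
        exact hMC _
    _ = _ := by
        rw [lintegral_const_mul' _ _ ENNReal.ofNat_ne_top, ← mul_assoc]
        norm_num

end
end RademacherStein

open RademacherStein in
theorem corollary3p11 {Ω : Type*} [MeasurableSpace Ω] (P : Measure Ω) [IsProbabilityMeasure P]
    (X : ℕ → Ω → ℝ) (p : ℕ → ℝ) (hX : IsRademacherSeq P X p) :
    -- the domains of `D̂` and `D` coincide
    (∀ F : Ω → ℝ, MemDomDhat P X p F ↔ MemDomD P X F) ∧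
    ∀ F : Ω → ℝ, MemDomD P X F → ∫ ω, F ω ∂P = 0 →
      -- Malliavin-Stein bounds, where `G = L⁻¹ F` exists
      (∃ G, IsPseudoInverse P X F G) ∧
      (∀ G, IsPseudoInverse P X F G →
        SeriesConverge P X p (fun k => Dhat P X p k (-G)) (fun k => Dhat P X p k F) ∧
        dW (P.map F) (gaussianReal 0 1) ≤
          boundW P X p (fun k => Dhat P X p k (-G)) (fun k => Dhat P X p k F) ∧
        dK (P.map F) (gaussianReal 0 1) ≤
          boundK P X p (fun k => Dhat P X p k (-G)) (fun k => Dhat P X p k F)) ∧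
      -- Clark-Ocone bounds
      SeriesConverge P X p (fun k => P[Dhat P X p k F | pastSigma X k])
        (fun k => Dhat P X p k F) ∧
      dW (P.map F) (gaussianReal 0 1) ≤
        boundW P X p (fun k => P[Dhat P X p k F | pastSigma X k]) (fun k => Dhat P X p k F) ∧
      dK (P.map F) (gaussianReal 0 1) ≤
        boundK P X p (fun k => P[Dhat P X p k F | pastSigma X k]) (fun k => Dhat P X p k F) := by
  refine ⟨fun F => hX.memDomDhat_iff_memDomD, fun F hF hF0 => ?_⟩
  have hCO := clarkOcone_isRepresenting hX hF hF0
  refine ⟨exists_isPseudoInverse hX (hX.memDomD_iff.1 hF).1 hF0, fun G hG => ?_,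
    hCO.seriesConverge hX hF, hCO.dW_le hX hF, hCO.dK_le hX hF⟩
  have hMS := hG.isRepresenting hX
  exact ⟨hMS.seriesConverge hX hF, hMS.dW_le hX hF, hMS.dK_le hX hF⟩
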